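/- For a finite simple graph $G$ and $X\subseteq V(G)$, let $d(X)$ be the number of edges of $G$ with exactly one end in $X$, let $\mathrm{size}(X)=|X|$, let $\mathrm{nonedge}(X)$ be the number of pairs of distinct non-adjacent vertices in $X$, and let $\mathrm{nondeg}(X)$ be the maximum degree of the complement of $G[X]$ (with $\mathrm{nondeg}(\emptyset)=0$). For $\mu\in\{\mathrm{size},\mathrm{nonedge},\mathrm{nondeg}\}$ and integers $p,q\ge 0$, a $(\mu,p,q)$-partition of $G$ is a partition of $V(G)$ into nonempty sets $C$, each of which satisfies $\mu(C)\le p$ and $d(C)\le q$. In the problem $(\mu,p,q)$-Partition the input is a finite simple graph $G$ and integers $p,q\ge 0$, and the task is to find a $(\mu,p,q)$-partition of $G$ or to report that there is none. **Theorem.** For each of $\mu=\mathrm{size}$, $\mu=\mathrm{nonedge}$ and $\mu=\mathrm{nondeg}$, the problem $(\mu,p,q)$-Partition can be solved by a deterministic algorithm in time $2^{O(p)}\cdot n^{O(1)}$, where $n=|V(G)|$. Explicitly: for each of the three $\mu$ there are one random access program (over natural numbers, whose arithmetic operations are addition and truncated subtraction, at unit cost) and a constant $c$ such that on every input $(G,p,q)$,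 with $G$ given by its adjacency matrix, the program halts with a correct answer within $c\cdot 2^{cp}\cdot (n+1)^{c}$ steps. In particular, $p$ and $q$ are part of the input, and the bound does not depend on $q$. -/

import Mathlib

namespace GraphClustering

/-! ### Graph clustering -/

section Clustering

variable {V : Type*} [Fintype V] [DecidableEq V]

/-- `d(X)`: the number of edges of `G` between `X` and its complement.
(As `X` and its complement are disjoint, each such edge is exactly one pair in `interedges`.) -/
noncomputable def cutSize (G : SimpleGraph V) (X : Finset V) : ℕ :=
  open Classical in (G.interedges X Xᶜ).card

/-- `size(X)`: the number of vertices of `X`. -/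
def size (_G : SimpleGraph V) (X : Finset V) : ℕ :=
  X.card

/-- `nonedge(X)`: the number of edges of the complement of `G` with both ends in `X`. -/
noncomputable def nonedge (G : SimpleGraph V) (X : Finset V) : ℕ :=
  open Classical in (X.sym2.filter fun e => e ∈ Gᶜ.edgeSet).card

/-- `nondeg(X)`: the maximum, over the vertices `v` of `X`, of the number of vertices of `X` that
are adjacent to `v` in the complement of `G` (and `0` if `X` is empty). -/
noncomputable def nondeg (G : SimpleGraph V) (X : Finset V) : ℕ :=
  open Classical in X.sup fun v => (X.filter fun u => Gᶜ.Adj v u).card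

/-- `C` is a `(μ, p, q)`-cluster of `G`. -/
def IsCluster (G : SimpleGraph V) (μ : Finset V → ℕ) (p q : ℕ) (C : Finset V) : Prop :=
  μ C ≤ p ∧ cutSize G C ≤ q

/-- The partition `P` of the vertex set (into nonempty parts) is a `(μ, p, q)`-partition of `G`:
all its parts are `(μ, p, q)`-clusters. -/
def IsClusterPartition (G : SimpleGraph V) (μ : Finset V → ℕ) (p q : ℕ)
    (P : Finpartition (Finset.univ : Finset V)) : Prop :=
  ∀ C ∈ P.parts, IsCluster G μ p q C

end Clustering

/-! ### Random access programs with a step count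

Structured programs over natural-number variables and natural-number arrays. Names of variables and
arrays are fixed in the program text, indices into arrays are computed. The only arithmetic
operations are addition and truncated subtraction (there is no multiplication, so that the unit-cost
measure is polynomially equivalent to time on Turing machines). -/

/-- The memory: the value of each variable, and of each cell of each array. -/
@[ext] structure State where
  var : ℕ → ℕ
  arr : ℕ → ℕ → ℕ

/-- Expressions: constants, variables, array cells with a computed index, sums, and truncated
differences. -/
inductive Expr where
  | const (k : ℕ)
  | var (x : ℕ)
  | cell (a : ℕ) (i : Expr)
  | add (e f : Expr)
  | sub (e f : Expr)

/-- The value of an expression. -/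
def Expr.eval (s : State) : Expr → ℕ
  | .const k => k
  | .var x => s.var x
  | .cell a i => s.arr a (i.eval s)
  | .add e f => e.eval s + f.eval s
  | .sub e f => e.eval s - f.eval s

/-- The number of steps for evaluating an expression: one for each of its nodes. -/
def Expr.cost : Expr → ℕ
  | .const _ => 1
  | .var _ => 1
  | .cell _ i => i.cost + 1
  | .add e f => e.cost + f.cost + 1
  | .sub e f => e.cost + f.cost + 1

/-- Programs. A test `e` succeeds if the value of `e` is not `0`. -/
inductive Program where
  | skip
  | assign (x : ℕ) (e : Expr)
  | store (a : ℕ) (i e : Expr)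
  | seq (P Q : Program)
  | ite (e : Expr) (P Q : Program)
  | loop (e : Expr) (P : Program)

/-- The memory after the variable `x` has been set to `k`. -/
def State.setVar (s : State) (x k : ℕ) : State :=
  { s with var := Function.update s.var x k }

/-- The memory after cell `i` of the array `a` has been set to `k`. -/
def State.setCell (s : State) (a i k : ℕ) : State :=
  { s with arr := Function.update s.arr a (Function.update (s.arr a) i k) }

/-- `Runs P s s' t`: the program `P`, started with memory `s`, halts after exactly `t` steps, with
memory `s'`. -/
inductive Runs : Program → State → State → ℕ → Prop where
  | skip (s : State) : Runs .skip s s 1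
  | assign (s : State) (x : ℕ) (e : Expr) :
      Runs (.assign x e) s (s.setVar x (e.eval s)) (e.cost + 1)
  | store (s : State) (a : ℕ) (i e : Expr) :
      Runs (.store a i e) s (s.setCell a (i.eval s) (e.eval s)) (i.cost + e.cost + 1)
  | seq {P Q : Program} {s s' s'' : State} {t t' : ℕ} :
      Runs P s s' t → Runs Q s' s'' t' → Runs (.seq P Q) s s'' (t + t')
  | ite_true {e : Expr} {P Q : Program} {s s' : State} {t : ℕ} :
      e.eval s ≠ 0 → Runs P s s' t → Runs (.ite e P Q) s s' (e.cost + 1 + t)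
  | ite_false {e : Expr} {P Q : Program} {s s' : State} {t : ℕ} :
      e.eval s = 0 → Runs Q s s' t → Runs (.ite e P Q) s s' (e.cost + 1 + t)
  | loop_true {e : Expr} {P : Program} {s s' s'' : State} {t t' : ℕ} :
      e.eval s ≠ 0 → Runs P s s' t → Runs (.loop e P) s' s'' t' →
      Runs (.loop e P) s s'' (e.cost + 1 + t + t')
  | loop_false {e : Expr} {P : Program} {s : State} :
      e.eval s = 0 → Runs (.loop e P) s s (e.cost + 1)

/-! ### Solving the partition problem by a program -/

/-- The memory that holds the instance `(G, p, q)`: the variables `0`, `1`, `2` hold `n`, `p`, `q`,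
the array `0` holds the adjacency matrix of `G` row by row, and everything else is `0`. -/
noncomputable def inputState {n : ℕ} (G : SimpleGraph (Fin n)) (p q : ℕ) : State where
  var x := if x = 0 then n else if x = 1 then p else if x = 2 then q else 0
  arr a i := open Classical in
    if a = 0 ∧ ∃ u v : Fin n, G.Adj u v ∧ i = (u : ℕ) * n + (v : ℕ) then 1 else 0

/-- The memory `s` holds the partition `P` of the vertex set: two vertices `u`, `v` are in the same
part if and only if the cells `u` and `v` of the array `1` have the same value. -/
def HoldsPartition {n : ℕ} (s : State) (P : Finpartition (Finset.univ : Finset (Fin n))) : Prop :=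
  ∀ u v : Fin n, P.part u = P.part v ↔ s.arr 1 u = s.arr 1 v

/-- The memory `s` holds a correct answer to the instance `(G, p, q)`: either the variable `0` is
`1` and `s` holds a `(μ, p, q)`-partition of `G`, or the variable `0` is `0` and `G` has no
`(μ, p, q)`-partition. -/
def IsCorrectAnswer {n : ℕ} (G : SimpleGraph (Fin n)) (μ : Finset (Fin n) → ℕ) (p q : ℕ)
    (s : State) : Prop :=
  (s.var 0 = 1 ∧ ∃ P, IsClusterPartition G μ p q P ∧ HoldsPartition s P) ∨
    (s.var 0 = 0 ∧ ¬ ∃ P, IsClusterPartition G μ p q P)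

/-- `(μ, p, q)`-Partition, with `p` and `q` in the input, can be solved in time `T n p` on `n`-vertex
simple graphs: one program, for every instance `(G, p, q)`, halts within `T n p` steps with a correct
answer. -/
def PartitionSolvableInTime
    (μ : ∀ n : ℕ, SimpleGraph (Fin n) → Finset (Fin n) → ℕ) (T : ℕ → ℕ → ℕ) : Prop :=
  ∃ A : Program, ∀ (n : ℕ) (G : SimpleGraph (Fin n)) (p q : ℕ),
    ∃ (s : State) (t : ℕ), Runs A (inputState G p q) s t ∧ t ≤ T n p ∧
      IsCorrectAnswer G (μ n G) p q s

end GraphClustering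

/-!
The partition problem reduces to finding, for each vertex `v`, a cluster that contains `v`. Indeed
the three measures are monotone and the cut function is posimodular (`cutSize_sdiff_add_le`), so that
for two intersecting clusters `X` and `Y` one of `X \ Y`, `Y \ X` is a cluster as well. Replacing
`X` or `Y` accordingly, clusters that cover all vertices become disjoint without losing a vertex
(`run_uncross`). Conversely, if a vertex is in no cluster, there is no partition.

Let `C` be a minimal cluster containing `v`. A union `K` of components of `G[C - v]` cannot be
removed from `C`, so more than half of the edges that leave `K` end in `v`
(`exists_thrifty_cluster`). In particular a connected set `K` of this kind has fewer than `#K`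
neighbours other than `v`, and it is found, starting from any of its vertices, by a search that reads
at most two bits of advice for each vertex of `K` (`exists_explore`). There are two cases.

* `C - v` has more than `3 * p` vertices. Then each vertex has at most `p` non-neighbours in `C`. By
  counting, some vertex `u` of `C - v` has at most one neighbour `x` outside of `C - v`. The vertices
  equal or adjacent to `u`, without `x` and `v`, form a core that contains all but at most `p` of the
  vertices of `C - v`. Those that it misses are adjacent to at least half of the core, and as the cut
  is small, at most `p + 2` vertices outside of the core are. So `C` is described by `u`, `x` and
  `p + 2` bits (`exists_core_fringe`).
* `C - v` has at most `3 * p` vertices. Then a cluster is assembled from components of `G[C - v]`.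
  Naming a vertex of each component would take too much advice, up to `3 * p * log n` bits. Instead
  the algorithm is told the type of a smallest remaining component, that is, a few numbers that
  control its effect on the measure and on the cut (`IsLocal`), and picks any set `K` of this type. If `K` meets or touches a remaining component, the latter is found from one of
  the few vertices in or next to `K`. Otherwise `K` may replace the component. Either way the advice
  has length linear in the size of the set that is added (`exists_moves`).

So advice of `O(p + log n)` bits leads to a cluster containing `v`, if there is one
(`exists_advice`), and the algorithm tries all numbers below some `N = 2 ^ O(p) * n ^ O(1)` as
advice.

The algorithm is written in a language in which all sums and loops range over the numbers below `N`.
Its commands are compiled to random access programs (`Cmd.runs_compile`), in a time that is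
polynomial in `N` for each fixed command (`Cmd.polyBounded_cost`). The number `N` itself is computed
by a command of the same language, with `n + p` in the place of `N` (`run_bound`).
-/

namespace GraphClustering

/-! ### A language of bounded loops -/

@[simp] theorem State.setVar_var (s : State) (x k y : ℕ) :
    (s.setVar x k).var y = if y = x then k else s.var y := by
  simp [State.setVar, Function.update_apply]

@[simp] theorem State.setVar_arr (s : State) (x k : ℕ) : (s.setVar x k).arr = s.arr := rfl

@[simp] theorem State.setCell_var (s : State) (a i k : ℕ) : (s.setCell a i k).var = s.var := rfl

@[simp] theorem State.setCell_arr (s : State) (a i k b j : ℕ) :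
    (s.setCell a i k).arr b j = if b = a ∧ j = i then k else s.arr b j := by
  by_cases h : b = a
  · subst h; simp [State.setCell, Function.update_apply]
  · simp [State.setCell, h]

/-- The memory after the whole array `a` has been replaced by `f`. -/
def State.setArr (s : State) (a : ℕ) (f : ℕ → ℕ) : State :=
  { s with arr := Function.update s.arr a f }

@[simp] theorem State.setArr_var (s : State) (a : ℕ) (f : ℕ → ℕ) : (s.setArr a f).var = s.var := rfl

@[simp] theorem State.setArr_arr (s : State) (a : ℕ) (f : ℕ → ℕ) (b : ℕ) :
    (s.setArr a f).arr b = if b = a then f else s.arr b := by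
  simp [State.setArr, Function.update_apply]

/-- Terms with bounded summation. All sums range over the numbers below one common bound `N`, which
is a parameter of the semantics; `sum x t` binds the variable `x`. -/
inductive Term where
  | const (k : ℕ)
  | var (x : ℕ)
  | cell (a : ℕ) (t : Term)
  | add (t u : Term)
  | sub (t u : Term)
  | ite (c t u : Term)
  | sum (x : ℕ) (t : Term)

/-- The value of a term, with all sums ranging over the numbers below `N`. -/
def Term.eval (N : ℕ) : Term → State → ℕ
  | .const k, _ => k
  | .var x, s => s.var x
  | .cell a t, s => s.arr a (t.eval N s)
  | .add t u, s => t.eval N s + u.eval N s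
  | .sub t u, s => t.eval N s - u.eval N s
  | .ite c t u, s => if c.eval N s ≠ 0 then t.eval N s else u.eval N s
  | .sum x t, s => ∑ i ∈ Finset.range N, t.eval N (s.setVar x i)

/-- Commands. `fill a x t` replaces the cells `x < N` of the array `a`, all at once, by the values
of `t`; `loop x c` performs `c` for each value `x < N`, in increasing order, whatever `c` does to
`x`. -/
inductive Cmd where
  | assign (x : ℕ) (t : Term)
  | fill (a x : ℕ) (t : Term)
  | seq (c d : Cmd)
  | ite (t : Term) (c d : Cmd)
  | skip
  | loop (x : ℕ) (c : Cmd)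

/-- The effect of a command, with all sums and loops ranging over the numbers below `N`. -/
def Cmd.run (N : ℕ) : Cmd → State → State
  | .assign x t, s => s.setVar x (t.eval N s)
  | .fill a x t, s => s.setArr a fun i => if i < N then t.eval N (s.setVar x i) else s.arr a i
  | .seq c d, s => d.run N (c.run N s)
  | .ite t c d, s => if t.eval N s ≠ 0 then c.run N s else d.run N s
  | .skip, s => s
  | .loop x c, s => (List.range N).foldl (fun s' i => c.run N (s'.setVar x i)) s

/-! ### Compilation -/

/-- The first variable (and array) that commands may not mention. Variable `40` holds the common
loop bound, larger variables and array `40` are scratch memory. -/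
abbrev scratch : ℕ := 40

/-- A program performing `P` with `x` running through the values below the common bound, counted in
the register `r`. -/
def forProgram (r x : ℕ) (P : Program) : Program :=
  .seq (.assign r (.const 0)) (.loop (.sub (.var scratch) (.var r))
    (.seq (.assign x (.var r)) (.seq P (.assign r (.add (.var r) (.const 1))))))

/-- The program that evaluates a term into the register `r`, using larger registers as scratch
memory. -/
def Term.compile : Term → ℕ → Program
  | .const k, r => .assign r (.const k)
  | .var x, r => .assign r (.var x)
  | .cell a t, r => .seq (t.compile r) (.assign r (.cell a (.var r)))
  | .add t u, r => .seq (t.compile r) (.seq (u.compile (r + 1))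
      (.assign r (.add (.var r) (.var (r + 1)))))
  | .sub t u, r => .seq (t.compile r) (.seq (u.compile (r + 1))
      (.assign r (.sub (.var r) (.var (r + 1)))))
  | .ite c t u, r => .seq (c.compile r) (.ite (.var r) (t.compile r) (u.compile r))
  | .sum x t, r => .seq (.assign r (.const 0)) (.seq (.assign (r + 1) (.var x))
      (.seq (forProgram (r + 2) x
        (.seq (t.compile (r + 3)) (.assign r (.add (.var r) (.var (r + 3))))))
      (.assign x (.var (r + 1)))))

/-- The program that performs a command, using the registers from `r` on as scratch memory. -/
def Cmd.compile : Cmd → ℕ → Program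
  | .assign x t, r => .seq (t.compile r) (.assign x (.var r))
  | .fill a x t, r => .seq (.assign r (.var x))
      (.seq (forProgram (r + 1) x (.seq (t.compile (r + 2)) (.store scratch (.var x) (.var (r + 2)))))
      (.seq (forProgram (r + 1) x (.store a (.var x) (.cell scratch (.var x))))
      (.assign x (.var r))))
  | .seq c d, r => .seq (c.compile r) (d.compile r)
  | .ite t c d, r => .seq (t.compile r) (.ite (.var r) (c.compile r) (d.compile r))
  | .skip, _ => .skip
  | .loop x c, r => forProgram r x (c.compile (r + 1))

/-- The term mentions only variables and arrays below the scratch memory. -/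
def Term.WF : Term → Bool
  | .const _ => true
  | .var x => decide (x < scratch)
  | .cell a t => decide (a < scratch) && t.WF
  | .add t u => t.WF && u.WF
  | .sub t u => t.WF && u.WF
  | .ite c t u => c.WF && (t.WF && u.WF)
  | .sum x t => decide (x < scratch) && t.WF

/-- The command mentions only variables and arrays below the scratch memory. -/
def Cmd.WF : Cmd → Bool
  | .assign x t => decide (x < scratch) && t.WF
  | .fill a x t => decide (a < scratch) && (decide (x < scratch) && t.WF)
  | .seq c d => c.WF && d.WF
  | .ite t c d => t.WF && (c.WF && d.WF)
  | .skip => true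
  | .loop x c => decide (x < scratch) && c.WF

/-- A bound for the running time of the compiled term. -/
def Term.cost (N : ℕ) : Term → ℕ
  | .const _ => 2
  | .var _ => 2
  | .cell _ t => t.cost N + 3
  | .add t u => t.cost N + u.cost N + 4
  | .sub t u => t.cost N + u.cost N + 4
  | .ite c t u => c.cost N + t.cost N + u.cost N + 2
  | .sum _ t => N * (t.cost N + 4 + 10) + 12

/-- A bound for the running time of the compiled command. -/
def Cmd.cost (N : ℕ) : Cmd → ℕ
  | .assign _ t => t.cost N + 2
  | .fill _ _ t => N * (t.cost N + 3 + 10) + N * (4 + 10) + 16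
  | .seq c d => c.cost N + d.cost N
  | .ite t c d => t.cost N + c.cost N + d.cost N + 2
  | .skip => 1
  | .loop _ c => N * (c.cost N + 10) + 6

/-- The loop of `forProgram`, from the value `i` of the counter on, under an invariant `I` that may
depend on the counter. -/
theorem runs_loop_body {P : Program} {r x N b : ℕ} (I : ℕ → State → Prop)
    (h : ∀ i < N, ∀ s, I i s → s.var scratch = N → s.var r = i →
      ∃ s' t, Runs P (s.setVar x i) s' t ∧ t ≤ b ∧ s'.var scratch = N ∧ s'.var r = i ∧
        I (i + 1) (s'.setVar r (i + 1)))
    (hr : scratch < r) :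
    ∀ k i s, i + k = N → I i s → s.var scratch = N → s.var r = i →
      ∃ s' t, Runs (.loop (.sub (.var scratch) (.var r))
        (.seq (.assign x (.var r)) (.seq P (.assign r (.add (.var r) (.const 1)))))) s s' t ∧
        t ≤ k * (b + 10) + 4 ∧ I N s' ∧ s'.var scratch = N := by
  intro k
  induction k with
  | zero =>
    intro i s hi hI hN hri
    obtain rfl : i = N := by omega
    exact ⟨s, _, .loop_false (by simp [Expr.eval, hN, hri]), by simp [Expr.cost], hI, hN⟩
  | succ k ih =>
    intro i s hi hI hN hri
    obtain ⟨s', t, hrun, ht, hN', hr', hI'⟩ := h i (by omega) s hI hN hri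
    obtain ⟨s'', t', hrun', ht', hI'', hN''⟩ := ih (i + 1) (s'.setVar r (i + 1)) (by omega) hI'
      (by simp [hr.ne, hN']) (by simp)
    refine ⟨s'', _, .loop_true (t' := t') (by simp [Expr.eval, hN, hri]; omega)
      (.seq (.assign _ _ _) (.seq (s' := s') (t := t) ?_ (.assign _ _ _))) ?_, ?_, hI'', hN''⟩
    · simpa [Expr.eval, hri] using hrun
    · simpa [Expr.eval, hr'] using hrun'
    · simp only [Expr.cost]
      nlinarith

/-- The rule for `forProgram`: an invariant `I`, indexed by the number of completed rounds, together
with a bound `b` for the time of each round. -/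
theorem runs_forProgram {P : Program} {r x N b : ℕ} (I : ℕ → State → Prop)
    (hr : scratch < r)
    (h : ∀ i < N, ∀ s, I i s → s.var scratch = N → s.var r = i →
      ∃ s' t, Runs P (s.setVar x i) s' t ∧ t ≤ b ∧ s'.var scratch = N ∧ s'.var r = i ∧
        I (i + 1) (s'.setVar r (i + 1)))
    (s : State) (h0 : I 0 (s.setVar r 0)) (hN : s.var scratch = N) :
    ∃ s' t, Runs (forProgram r x P) s s' t ∧ t ≤ N * (b + 10) + 6 ∧ I N s' ∧
      s'.var scratch = N := by
  obtain ⟨s', t, hrun, ht, hI, hN'⟩ := runs_loop_body (x := x) I h hr N 0 (s.setVar r 0) (by omega)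
    h0 (by simp [hr.ne, hN]) (by simp)
  exact ⟨s', _, .seq (.assign _ _ _) hrun, by simp only [Expr.cost]; omega, hI, hN'⟩

/-- Two memories agree outside of the scratch memory. -/
structure Agree (s s' : State) : Prop where
  var : ∀ x < scratch, s.var x = s'.var x
  arr : ∀ a < scratch, s.arr a = s'.arr a

/-- Correctness of the compilation of terms. Only the registers from `r` on change, which is what
keeps intermediate results and loop counters of enclosing programs intact; the variables bound by
sums are restored. -/
theorem Term.runs_compile (N : ℕ) (t : Term) : t.WF → ∀ (r : ℕ) (s₁ s₂ : State), scratch < r →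
    Agree s₁ s₂ → s₁.var scratch = N →
    ∃ s' k, Runs (t.compile r) s₁ s' k ∧ k ≤ t.cost N ∧ s'.var r = t.eval N s₂ ∧
      (∀ x < r, s'.var x = s₁.var x) ∧ s'.arr = s₁.arr := by
  induction t with
  | const k =>
    intro _ r s₁ s₂ hr _ _
    exact ⟨_, _, .assign _ _ _, by simp [Expr.cost, cost], by simp [Expr.eval, eval],
      fun x hx => by simp [hx.ne], rfl⟩
  | var x =>
    intro hw r s₁ s₂ hr ha _
    simp only [WF, decide_eq_true_eq] at hw
    exact ⟨_, _, .assign _ _ _, by simp [Expr.cost, cost], by simp [Expr.eval, eval, ha.var x hw],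
      fun x hx => by simp [hx.ne], rfl⟩
  | cell a t ih =>
    intro hw r s₁ s₂ hr ha hN
    simp only [WF, Bool.and_eq_true, decide_eq_true_eq] at hw
    obtain ⟨s', k, h1, h2, h3, h4, h5⟩ := ih hw.2 r s₁ s₂ hr ha hN
    exact ⟨_, _, .seq h1 (.assign _ _ _), by simp only [Expr.cost, cost]; omega,
      by simp [Expr.eval, eval, h3, h5, ha.arr a hw.1], fun x hx => by simp [hx.ne, h4 x hx],
      by simp [h5]⟩
  | add t u iht ihu =>
    intro hw r s₁ s₂ hr ha hN
    simp only [WF, Bool.and_eq_true] at hw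
    obtain ⟨s', k, h1, h2, h3, h4, h5⟩ := iht hw.1 r s₁ s₂ hr ha hN
    obtain ⟨s'', k', h1', h2', h3', h4', h5'⟩ := ihu hw.2 (r + 1) s' s₂ (by omega)
      ⟨fun x hx => by rw [h4 x (by omega), ha.var x hx], fun a h => by rw [h5, ha.arr a h]⟩
      (by rw [h4 _ (by omega), hN])
    exact ⟨_, _, .seq h1 (.seq h1' (.assign _ _ _)), by simp only [Expr.cost, cost]; omega,
      by simp [Expr.eval, eval, h3, h3', h4'], fun x hx => by
        simp [hx.ne, h4' x (by omega), h4 x hx], by simp [h5, h5']⟩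
  | sub t u iht ihu =>
    intro hw r s₁ s₂ hr ha hN
    simp only [WF, Bool.and_eq_true] at hw
    obtain ⟨s', k, h1, h2, h3, h4, h5⟩ := iht hw.1 r s₁ s₂ hr ha hN
    obtain ⟨s'', k', h1', h2', h3', h4', h5'⟩ := ihu hw.2 (r + 1) s' s₂ (by omega)
      ⟨fun x hx => by rw [h4 x (by omega), ha.var x hx], fun a h => by rw [h5, ha.arr a h]⟩
      (by rw [h4 _ (by omega), hN])
    exact ⟨_, _, .seq h1 (.seq h1' (.assign _ _ _)), by simp only [Expr.cost, cost]; omega,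
      by simp [Expr.eval, eval, h3, h3', h4'], fun x hx => by
        simp [hx.ne, h4' x (by omega), h4 x hx], by simp [h5, h5']⟩
  | ite c t u ihc iht ihu =>
    intro hw r s₁ s₂ hr ha hN
    simp only [WF, Bool.and_eq_true] at hw
    obtain ⟨s', k, h1, h2, h3, h4, h5⟩ := ihc hw.1 r s₁ s₂ hr ha hN
    have ha' : Agree s' s₂ :=
      ⟨fun x hx => by rw [h4 x (by omega), ha.var x hx], fun a h => by rw [h5, ha.arr a h]⟩
    have hN' : s'.var scratch = N := by rw [h4 _ (by omega), hN]
    by_cases hc : c.eval N s₂ = 0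
    · obtain ⟨s'', k', h1', h2', h3', h4', h5'⟩ := ihu hw.2.2 r s' s₂ hr ha' hN'
      exact ⟨s'', _, .seq h1 (.ite_false (by simp [Expr.eval, h3, hc]) h1'),
        by simp only [Expr.cost, cost]; omega, by simp [eval, hc, h3'],
        fun x hx => by rw [h4' x hx, h4 x hx], by rw [h5', h5]⟩
    · obtain ⟨s'', k', h1', h2', h3', h4', h5'⟩ := iht hw.2.1 r s' s₂ hr ha' hN'
      exact ⟨s'', _, .seq h1 (.ite_true (by simp [Expr.eval, h3, hc]) h1'),
        by simp only [Expr.cost, cost]; omega, by simp [eval, hc, h3'],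
        fun x hx => by rw [h4' x hx, h4 x hx], by rw [h5', h5]⟩
  | sum x t ih =>
    intro hw r s₁ s₂ hr ha hN
    simp only [WF, Bool.and_eq_true, decide_eq_true_eq] at hw
    obtain ⟨s', k, h1, h2, ⟨h3, h4, h5, h6⟩, h7⟩ := runs_forProgram (r := r + 2) (x := x) (N := N)
      (P := .seq (t.compile (r + 3)) (.assign r (.add (.var r) (.var (r + 3)))))
      (b := t.cost N + 4)
      (fun i s => s.var r = ∑ j ∈ Finset.range i, t.eval N (s₂.setVar x j) ∧
        s.var (r + 1) = s₁.var x ∧ (∀ y < r, y ≠ x → s.var y = s₁.var y) ∧ s.arr = s₁.arr)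
      (by omega) (by
        rintro i hi s ⟨g1, g2, g3, g4⟩ g5 g6
        obtain ⟨s', k, h1, h2, h3, h4, h5⟩ := ih hw.2 (r + 3) (s.setVar x i) (s₂.setVar x i)
          (by omega) ⟨fun y hy => by
            by_cases hyx : y = x
            · simp [hyx]
            · simp [hyx, g3 y (by omega) hyx, ha.var y hy], fun a h => by
            simp [g4, ha.arr a h]⟩ (by simp [g5, hw.1.ne'])
        refine ⟨_, _, .seq h1 (.assign _ _ _), by simp only [Expr.cost]; omega, ?_, ?_, ?_, ?_, ?_, ?_⟩
        · simp [hr.ne, h4 scratch (by omega), hw.1.ne', g5]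
        · simp [h4 (r + 2) (by omega), g6, show r + 2 ≠ x by omega]
        · simp [Finset.sum_range_succ, Expr.eval, h3, h4 r (by omega), g1, show r ≠ x by omega]
        · simp [h4 (r + 1) (by omega), show r + 1 ≠ x by omega, g2]
        · intro y hy hyx
          simp [show y ≠ r + 2 by omega, hy.ne, h4 y (by omega), hyx, g3 y hy hyx]
        · simp [h5, g4])
      ((s₁.setVar r 0).setVar (r + 1) (s₁.var x))
      ⟨by simp, by simp, fun y hy hyx => by
        simp [show y ≠ r by omega, show y ≠ r + 1 by omega, show y ≠ r + 2 by omega], by simp⟩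
      (by simp [show scratch ≠ r + 1 by omega, show scratch ≠ r by omega, hN])
    refine ⟨_, _, .seq (.assign _ _ _) (.seq (.assign _ _ _) (.seq (s' := s') (t := k) ?_
      (.assign _ _ _))), ?_, ?_, ?_, ?_⟩
    · simpa [Expr.eval, show x ≠ r by omega] using h1
    · simp only [Expr.cost, cost]; omega
    · simp [show r ≠ x by omega, h3, eval]
    · intro y hy
      by_cases hyx : y = x
      · simp [hyx, Expr.eval, h4]
      · simp [hyx, h5 y hy hyx]
    · simp [h6]

/-- Correctness of the compilation of commands. Scratch variables below `r`, in particular the loop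
bound and the counters of enclosing loops, do not change. -/
theorem Cmd.runs_compile (N : ℕ) (c : Cmd) : c.WF → ∀ (r : ℕ) (s₁ s₂ : State), scratch < r →
    Agree s₁ s₂ → s₁.var scratch = N →
    ∃ s' k, Runs (c.compile r) s₁ s' k ∧ k ≤ c.cost N ∧ Agree s' (c.run N s₂) ∧
      (∀ x < r, scratch ≤ x → s'.var x = s₁.var x) := by
  induction c with
  | assign x t =>
    intro hw r s₁ s₂ hr ha hN
    simp only [WF, Bool.and_eq_true, decide_eq_true_eq] at hw
    obtain ⟨s', k, h1, h2, h3, h4, h5⟩ := t.runs_compile N hw.2 r s₁ s₂ hr ha hN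
    refine ⟨_, _, .seq h1 (.assign _ _ _), by simp only [Expr.cost, cost]; omega,
      ⟨fun y hy => ?_, fun a h => by simp [run, h5, ha.arr a h]⟩, fun y hy hy' => ?_⟩
    · by_cases hyx : y = x
      · simp [hyx, run, Expr.eval, h3]
      · simp [hyx, run, h4 y (by omega), ha.var y hy]
    · simp [show y ≠ x by omega, h4 y hy]
  | fill a x t =>
    intro hw r s₁ s₂ hr ha hN
    simp only [WF, Bool.and_eq_true, decide_eq_true_eq] at hw
    obtain ⟨hwa, hwx, hwt⟩ := hw
    obtain ⟨s', k, h1, h2, ⟨h3, h4, h5, h6⟩, h7⟩ := runs_forProgram (r := r + 1) (x := x) (N := N)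
      (P := .seq (t.compile (r + 2)) (.store scratch (.var x) (.var (r + 2))))
      (b := t.cost N + 3)
      (fun i s => s.var r = s₁.var x ∧ (∀ y < r, y ≠ x → s.var y = s₁.var y) ∧
        (∀ b < scratch, s.arr b = s₁.arr b) ∧
        ∀ j < i, s.arr scratch j = t.eval N (s₂.setVar x j))
      (by omega) (by
        rintro i hi s ⟨g1, g2, g3, g4⟩ g5 g6
        obtain ⟨s', k, h1, h2, h3, h4, h5⟩ := t.runs_compile N hwt (r + 2) (s.setVar x i)
          (s₂.setVar x i) (by omega) ⟨fun y hy => by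
            by_cases hyx : y = x
            · simp [hyx]
            · simp [hyx, g2 y (by omega) hyx, ha.var y hy], fun a h => by
            simp [g3 a h, ha.arr a h]⟩ (by simp [g5, hwx.ne'])
        refine ⟨_, _, .seq h1 (.store _ _ _ _), by simp only [Expr.cost]; omega,
          ?_, ?_, ?_, ?_, ?_, ?_⟩
        · simp [h4 scratch (by omega), hwx.ne', g5]
        · simp [h4 (r + 1) (by omega), g6, show r + 1 ≠ x by omega]
        · simp [h4 r (by omega), show r ≠ x by omega, g1]
        · intro y hy hyx
          simp [show y ≠ r + 1 by omega, h4 y (by omega), hyx, g2 y hy hyx]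
        · intro b hb
          funext j
          simp [hb.ne, h5, g3 b hb]
        · intro j hj
          have hx : s'.var x = i := by simp [h4 x (by omega)]
          by_cases hji : j = i
          · simp [Expr.eval, hx, hji, h3]
          · simp [Expr.eval, hx, hji, h5, g4 j (by omega)])
      (s₁.setVar r (s₁.var x))
      ⟨by simp, fun y hy hyx => by
        simp [show y ≠ r by omega, show y ≠ r + 1 by omega], by simp, by simp⟩
      (by simp [show scratch ≠ r by omega, hN])
    obtain ⟨s'', k', h1', h2', ⟨h3', h4', h5', h6', h8'⟩, h7'⟩ := runs_forProgram (r := r + 1)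
      (x := x) (N := N)
      (P := .store a (.var x) (.cell scratch (.var x)))
      (b := 4)
      (fun i s => s.var r = s₁.var x ∧ (∀ y < r, y ≠ x → s.var y = s₁.var y) ∧
        (∀ b < scratch, b ≠ a → s.arr b = s₁.arr b) ∧ s.arr scratch = s'.arr scratch ∧
        ∀ j, s.arr a j = if j < i then t.eval N (s₂.setVar x j) else s₁.arr a j)
      (by omega) (by
        rintro i hi s ⟨g1, g2, g3, g4, g5⟩ g6 g7
        refine ⟨_, _, .store _ _ _ _, by simp only [Expr.cost]; omega, ?_, ?_, ?_, ?_, ?_, ?_, ?_⟩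
        · simp [hwx.ne', g6]
        · simp [g7, show r + 1 ≠ x by omega]
        · simp [show r ≠ x by omega, g1]
        · intro y hy hyx
          simp [show y ≠ r + 1 by omega, hyx, g2 y hy hyx]
        · intro b hb hba
          funext j
          simp [hba, g3 b hb hba]
        · funext j
          simp [hwa.ne', g4]
        · intro j
          by_cases hji : j = i
          · simp [Expr.eval, hji, g4, h6 i hi]
          · have : j < i + 1 ↔ j < i := by omega
            simp [Expr.eval, hji, g5, this])
      s' ⟨by simp [h3], fun y hy hyx => by
        simp [show y ≠ r + 1 by omega, h4 y hy hyx], fun b hb _ => by simp [h5 b hb], by simp,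
        fun j => by simp [h5 a hwa]⟩ h7
    refine ⟨_, _, .seq (.assign _ _ _) (.seq (s' := s') (t := k) ?_ (.seq h1' (.assign _ _ _))),
      ?_, ⟨?_, ?_⟩, ?_⟩
    · simpa [Expr.eval] using h1
    · simp only [Expr.cost, cost]; omega
    · intro y hy
      by_cases hyx : y = x
      · simp [hyx, Expr.eval, h3', run, ha.var x hwx]
      · simp [hyx, h4' y (by omega) hyx, run, ha.var y hy]
    · intro b hb
      by_cases hba : b = a
      · funext j
        simp [hba, h8', run, ha.arr a hwa]
      · simp [hba, h5' b hb hba, run, ha.arr b hb]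
    · intro y hy hy'
      simp [show y ≠ x by omega, h4' y hy (by omega)]
  | seq c d ihc ihd =>
    intro hw r s₁ s₂ hr ha hN
    simp only [WF, Bool.and_eq_true] at hw
    obtain ⟨s', k, h1, h2, h3, h4⟩ := ihc hw.1 r s₁ s₂ hr ha hN
    obtain ⟨s'', k', h1', h2', h3', h4'⟩ := ihd hw.2 r s' _ hr h3 (by rw [h4 _ hr le_rfl, hN])
    exact ⟨s'', _, .seq h1 h1', by simp only [cost]; omega, h3',
      fun x hx hx' => by rw [h4' x hx hx', h4 x hx hx']⟩
  | ite t c d ihc ihd =>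
    intro hw r s₁ s₂ hr ha hN
    simp only [WF, Bool.and_eq_true] at hw
    obtain ⟨s', k, h1, h2, h3, h4, h5⟩ := t.runs_compile N hw.1 r s₁ s₂ hr ha hN
    have ha' : Agree s' s₂ :=
      ⟨fun x hx => by rw [h4 x (by omega), ha.var x hx], fun a h => by rw [h5, ha.arr a h]⟩
    have hN' : s'.var scratch = N := by rw [h4 _ (by omega), hN]
    by_cases hc : t.eval N s₂ = 0
    · obtain ⟨s'', k', h1', h2', h3', h4'⟩ := ihd hw.2.2 r s' s₂ hr ha' hN'
      exact ⟨s'', _, .seq h1 (.ite_false (by simp [Expr.eval, h3, hc]) h1'),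
        by simp only [Expr.cost, cost]; omega, by simpa [run, hc] using h3',
        fun x hx hx' => by rw [h4' x hx hx', h4 x hx]⟩
    · obtain ⟨s'', k', h1', h2', h3', h4'⟩ := ihc hw.2.1 r s' s₂ hr ha' hN'
      exact ⟨s'', _, .seq h1 (.ite_true (by simp [Expr.eval, h3, hc]) h1'),
        by simp only [Expr.cost, cost]; omega, by simpa [run, hc] using h3',
        fun x hx hx' => by rw [h4' x hx hx', h4 x hx]⟩
  | skip =>
    intro _ r s₁ s₂ _ ha _
    exact ⟨s₁, _, .skip _, le_rfl, ha, fun _ _ _ => rfl⟩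
  | loop x c ih =>
    intro hw r s₁ s₂ hr ha hN
    simp only [WF, Bool.and_eq_true, decide_eq_true_eq] at hw
    obtain ⟨s', k, h1, h2, ⟨h3, h4⟩, h5⟩ := runs_forProgram (r := r) (x := x) (N := N)
      (P := c.compile (r + 1)) (b := c.cost N)
      (fun i s => Agree s ((List.range i).foldl (fun s' j => c.run N (s'.setVar x j)) s₂) ∧
        ∀ y < r, scratch ≤ y → s.var y = s₁.var y)
      hr (by
        rintro i hi s ⟨g1, g2⟩ g3 g4
        obtain ⟨s', k, h1, h2, h3, h4⟩ := ih hw.2 (r + 1) (s.setVar x i)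
          (((List.range i).foldl (fun s' j => c.run N (s'.setVar x j)) s₂).setVar x i) (by omega)
          ⟨fun y hy => by
            by_cases hyx : y = x
            · simp [hyx]
            · simp only [State.setVar_var, hyx, if_false]; exact g1.var y hy,
            fun a h => by simp only [State.setVar_arr]; exact g1.arr a h⟩
          (by simp [g3, hw.1.ne'])
        refine ⟨s', k, h1, h2, ?_, ?_, ⟨?_, ?_⟩, ?_⟩
        · rw [h4 _ (by omega) le_rfl]; simp [hw.1.ne', g3]
        · rw [h4 _ (by omega) hr.le]; simp [show r ≠ x by omega, g4]
        · intro y hy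
          simp only [State.setVar_var, show y ≠ r by omega, if_false, List.range_succ,
            List.foldl_append, List.foldl_cons, List.foldl_nil]
          exact h3.var y hy
        · intro a h
          simp only [State.setVar_arr, List.range_succ,
            List.foldl_append, List.foldl_cons, List.foldl_nil]
          exact h3.arr a h
        · intro y hy hy'
          simp [hy.ne, h4 y (by omega) hy', show y ≠ x by omega, g2 y hy hy'])
      s₁ ⟨⟨fun y hy => by simp [show y ≠ r by omega, ha.var y hy], fun a h => by
        simp [ha.arr a h]⟩, fun y hy _ => by simp [hy.ne]⟩ hN
    exact ⟨s', k, h1, by simp only [cost]; omega, h3, h4⟩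

/-! ### Polynomial bounds -/

/-- `f` is bounded by a polynomial. -/
def PolyBounded (f : ℕ → ℕ) : Prop := ∃ k, ∀ N, f N ≤ k * (N + 1) ^ k

theorem PolyBounded.const (k : ℕ) : PolyBounded fun _ => k :=
  ⟨k, fun N => Nat.le_mul_of_pos_right _ (by positivity)⟩

theorem PolyBounded.id : PolyBounded fun N => N := ⟨1, fun N => by simp⟩

theorem PolyBounded.add {f g : ℕ → ℕ} (hf : PolyBounded f) (hg : PolyBounded g) :
    PolyBounded fun N => f N + g N := by
  obtain ⟨k, hk⟩ := hf
  obtain ⟨l, hl⟩ := hg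
  refine ⟨k + l, fun N => ?_⟩
  rw [add_mul]
  exact add_le_add ((hk N).trans (Nat.mul_le_mul_left _ (Nat.pow_le_pow_right (by omega) (by omega))))
    ((hl N).trans (Nat.mul_le_mul_left _ (Nat.pow_le_pow_right (by omega) (by omega))))

theorem PolyBounded.mul {f g : ℕ → ℕ} (hf : PolyBounded f) (hg : PolyBounded g) :
    PolyBounded fun N => f N * g N := by
  obtain ⟨k, hk⟩ := hf
  obtain ⟨l, hl⟩ := hg
  refine ⟨k * l + k + l, fun N => ?_⟩
  calc f N * g N ≤ (k * (N + 1) ^ k) * (l * (N + 1) ^ l) := Nat.mul_le_mul (hk N) (hl N)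
    _ = (k * l) * (N + 1) ^ (k + l) := by rw [pow_add]; ring
    _ ≤ _ := Nat.mul_le_mul (by omega) (Nat.pow_le_pow_right (by omega) (by omega))

theorem Term.polyBounded_cost (t : Term) : PolyBounded fun N => t.cost N := by
  induction t with
  | const k => exact .const 2
  | var x => exact .const 2
  | cell a t ih => exact ih.add (.const 3)
  | add t u iht ihu => exact (iht.add ihu).add (.const 4)
  | sub t u iht ihu => exact (iht.add ihu).add (.const 4)
  | ite c t u ihc iht ihu => exact ((ihc.add iht).add ihu).add (.const 2)
  | sum x t ih => exact (PolyBounded.id.mul ((ih.add (.const 4)).add (.const 10))).add (.const 12)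

theorem Cmd.polyBounded_cost (c : Cmd) : PolyBounded fun N => c.cost N := by
  induction c with
  | assign x t => exact t.polyBounded_cost.add (.const 2)
  | fill a x t => exact ((PolyBounded.id.mul ((t.polyBounded_cost.add (.const 3)).add (.const 10))).add
      (PolyBounded.id.mul (.const (4 + 10)))).add (.const 16)
  | seq c d ihc ihd => exact ihc.add ihd
  | ite t c d ihc ihd => exact ((t.polyBounded_cost.add ihc).add ihd).add (.const 2)
  | skip => exact .const 1
  | loop x c ih => exact (PolyBounded.id.mul (ih.add (.const 10))).add (.const 6)

/-! ### Counting edges and non-edges -/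

section Counting

variable {n : ℕ} {G : SimpleGraph (Fin n)}

/-- The indicator of a proposition. -/
noncomputable def ind (P : Prop) : ℕ := open Classical in if P then 1 else 0

theorem ind_of {P : Prop} (h : P) : ind P = 1 := by simp [ind, h]

theorem ind_of_not {P : Prop} (h : ¬P) : ind P = 0 := by simp [ind, h]

@[simp] theorem ind_true : ind True = 1 := ind_of trivial

@[simp] theorem ind_false : ind False = 0 := ind_of_not id

theorem ind_ne_zero {P : Prop} : ind P ≠ 0 ↔ P := by
  by_cases h : P <;> simp [h]

theorem ind_mono {P Q : Prop} (h : P → Q) : ind P ≤ ind Q := by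
  by_cases hP : P
  · simp [hP, h hP]
  · simp [hP]

theorem sum_ind {α : Type*} [Fintype α] (P : α → Prop) [DecidablePred P] :
    ∑ a, ind (P a) = (Finset.univ.filter P).card := by
  rw [Finset.card_filter]
  refine Finset.sum_congr rfl fun a _ => ?_
  by_cases h : P a <;> simp [h]

theorem sum_ind_mem (X : Finset (Fin n)) : ∑ u, ind (u ∈ X) = X.card := by
  rw [sum_ind]; simp

/-- The number of pairs of adjacent vertices in `X × Y`. -/
noncomputable def edges (G : SimpleGraph (Fin n)) (X Y : Finset (Fin n)) : ℕ :=
  ∑ u, ∑ w, ind (u ∈ X ∧ w ∈ Y ∧ G.Adj u w)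

/-- The number of pairs of distinct non-adjacent vertices in `X × Y`. -/
noncomputable def nonedges (G : SimpleGraph (Fin n)) (X Y : Finset (Fin n)) : ℕ :=
  ∑ u, ∑ w, ind (u ∈ X ∧ w ∈ Y ∧ u ≠ w ∧ ¬G.Adj u w)

/-- The number of vertices of `X` other than `u` that are not adjacent to `u`. -/
noncomputable def nonnbrs (G : SimpleGraph (Fin n)) (X : Finset (Fin n)) (u : Fin n) : ℕ :=
  ∑ w, ind (w ∈ X ∧ u ≠ w ∧ ¬G.Adj u w)

theorem cutSize_eq (X : Finset (Fin n)) : cutSize G X = edges G X Xᶜ := by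
  classical
  rw [cutSize, SimpleGraph.interedges, Rel.interedges, Finset.card_filter, Finset.sum_product,
    edges]
  rw [← Finset.sum_subset (Finset.subset_univ X)]
  · refine Finset.sum_congr rfl fun u hu => ?_
    rw [← Finset.sum_subset (Finset.subset_univ Xᶜ)]
    · refine Finset.sum_congr rfl fun w hw => ?_
      by_cases h : G.Adj u w <;> simp_all
    · intro w _ hw
      simp_all
  · intro u _ hu
    simp [hu]

theorem cutSize_eq' (X : Finset (Fin n)) :
    cutSize G X = ∑ u, ∑ w, ind (u ∈ X ∧ w ∉ X ∧ G.Adj u w) := by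
  simp [cutSize_eq, edges]

theorem edges_comm (X Y : Finset (Fin n)) : edges G X Y = edges G Y X := by
  rw [edges, edges, Finset.sum_comm]
  refine Finset.sum_congr rfl fun u _ => Finset.sum_congr rfl fun w _ => ?_
  rw [G.adj_comm]
  congr 1
  exact propext ⟨fun h => ⟨h.2.1, h.1, h.2.2⟩, fun h => ⟨h.2.1, h.1, h.2.2⟩⟩

theorem nonedges_comm (X Y : Finset (Fin n)) : nonedges G X Y = nonedges G Y X := by
  rw [nonedges, nonedges, Finset.sum_comm]
  refine Finset.sum_congr rfl fun u _ => Finset.sum_congr rfl fun w _ => ?_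
  rw [G.adj_comm, ne_comm]
  congr 1
  exact propext ⟨fun h => ⟨h.2.1, h.1, h.2.2⟩, fun h => ⟨h.2.1, h.1, h.2.2⟩⟩

theorem edges_mono {X X' Y Y' : Finset (Fin n)} (hX : X ⊆ X') (hY : Y ⊆ Y') :
    edges G X Y ≤ edges G X' Y' :=
  Finset.sum_le_sum fun _ _ => Finset.sum_le_sum fun _ _ =>
    ind_mono fun h => ⟨hX h.1, hY h.2.1, h.2.2⟩

theorem edges_singleton (v : Fin n) (K : Finset (Fin n)) :
    edges G {v} K = ∑ w, ind (w ∈ K ∧ G.Adj v w) := by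
  rw [edges, Finset.sum_eq_single v]
  · simp
  · intro u _ hu; simp [hu]
  · simp

theorem edges_singleton_le (v : Fin n) (K : Finset (Fin n)) : edges G {v} K ≤ K.card := by
  rw [edges_singleton, ← sum_ind_mem]
  exact Finset.sum_le_sum fun _ _ => ind_mono fun h => h.1

theorem edges_union_right (X : Finset (Fin n)) {Y Z : Finset (Fin n)} (h : Disjoint Y Z) :
    edges G X (Y ∪ Z) = edges G X Y + edges G X Z := by
  simp only [edges, ← Finset.sum_add_distrib]
  refine Finset.sum_congr rfl fun u _ => Finset.sum_congr rfl fun w _ => ?_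
  have : w ∈ Y → w ∉ Z := fun hh => Finset.disjoint_left.1 h hh
  by_cases h1 : w ∈ Y <;> by_cases h2 : w ∈ Z <;> simp_all

theorem nonedges_le (X Y : Finset (Fin n)) : nonedges G X Y ≤ X.card * Y.card := by
  rw [← sum_ind_mem, ← sum_ind_mem, Finset.sum_mul_sum]
  refine Finset.sum_le_sum fun u _ => Finset.sum_le_sum fun w _ => ?_
  by_cases h1 : u ∈ X <;> by_cases h2 : w ∈ Y <;> simp [h1, h2, ind]
  split <;> simp

theorem nonedges_add_edges {X Y : Finset (Fin n)} (h : Disjoint X Y) :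
    nonedges G X Y + edges G X Y = X.card * Y.card := by
  rw [← sum_ind_mem, ← sum_ind_mem, Finset.sum_mul_sum, nonedges, edges]
  simp only [← Finset.sum_add_distrib]
  refine Finset.sum_congr rfl fun u _ => Finset.sum_congr rfl fun w _ => ?_
  by_cases h1 : u ∈ X <;> by_cases h2 : w ∈ Y <;> simp [h1, h2]
  have : u ≠ w := fun e => Finset.disjoint_left.1 h h1 (e ▸ h2)
  by_cases h3 : G.Adj u w <;> simp [h3, this]

theorem nonedges_union {B K : Finset (Fin n)} (h : Disjoint B K) :
    nonedges G (B ∪ K) (B ∪ K) = nonedges G B B + nonedges G K K + 2 * nonedges G B K := by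
  rw [two_mul]
  nth_rw 5 [nonedges_comm]
  simp only [nonedges, ← Finset.sum_add_distrib]
  refine Finset.sum_congr rfl fun u _ => Finset.sum_congr rfl fun w _ => ?_
  have hu : u ∈ B → u ∉ K := fun hh => Finset.disjoint_left.1 h hh
  have hw : w ∈ B → w ∉ K := fun hh => Finset.disjoint_left.1 h hh
  by_cases h1 : u ∈ B <;> by_cases h2 : w ∈ B <;> by_cases h3 : u ∈ K <;> by_cases h4 : w ∈ K <;>
    simp_all

theorem cutSize_union {B K : Finset (Fin n)} (h : Disjoint B K) :
    cutSize G (B ∪ K) + 2 * edges G B K = cutSize G B + cutSize G K := by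
  rw [two_mul]
  nth_rw 2 [edges_comm]
  simp only [edges, cutSize_eq', ← Finset.sum_add_distrib]
  refine Finset.sum_congr rfl fun u _ => Finset.sum_congr rfl fun w _ => ?_
  have hu : u ∈ B → u ∉ K := fun hh => Finset.disjoint_left.1 h hh
  have hw : w ∈ B → w ∉ K := fun hh => Finset.disjoint_left.1 h hh
  by_cases h1 : u ∈ B <;> by_cases h2 : w ∈ B <;> by_cases h3 : u ∈ K <;> by_cases h4 : w ∈ K <;>
    simp_all

theorem two_mul_cutSize (X : Finset (Fin n)) :
    2 * cutSize G X = ∑ u, ∑ w, ind (¬(u ∈ X ↔ w ∈ X) ∧ G.Adj u w) := by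
  have h : cutSize G X = ∑ u, ∑ w, ind (w ∈ X ∧ u ∉ X ∧ G.Adj u w) := by
    rw [cutSize_eq', Finset.sum_comm]
    simp only [G.adj_comm]
  rw [two_mul]
  nth_rw 1 [h]
  simp only [cutSize_eq', ← Finset.sum_add_distrib]
  refine Finset.sum_congr rfl fun u _ => Finset.sum_congr rfl fun w _ => ?_
  by_cases h1 : u ∈ X <;> by_cases h2 : w ∈ X <;> simp [h1, h2]

/-- Posimodularity of the cut function. -/
theorem cutSize_sdiff_add_le (X Y : Finset (Fin n)) :
    cutSize G (X \ Y) + cutSize G (Y \ X) ≤ cutSize G X + cutSize G Y := by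
  refine Nat.le_of_mul_le_mul_left (?_ : 2 * _ ≤ 2 * _) two_pos
  simp only [mul_add, two_mul_cutSize, ← Finset.sum_add_distrib]
  refine Finset.sum_le_sum fun u _ => Finset.sum_le_sum fun w _ => ?_
  by_cases h1 : u ∈ X <;> by_cases h2 : w ∈ X <;> by_cases h3 : u ∈ Y <;> by_cases h4 : w ∈ Y <;>
    simp [h1, h2, h3, h4]

/-- If `B` is joined to `K` through the vertex `v` only, then all edges between them are at `v`. -/
theorem edges_eq_of_not_adj {B K : Finset (Fin n)} {v : Fin n} (hv : v ∈ B)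
    (h : ∀ b ∈ B, b ≠ v → ∀ k ∈ K, ¬G.Adj b k) : edges G B K = edges G {v} K := by
  refine Finset.sum_congr rfl fun u _ => Finset.sum_congr rfl fun w _ => ?_
  by_cases hu : u = v
  · simp [hu, hv]
  · congr 1
    simp only [hu, Finset.mem_singleton, false_and, eq_iff_iff, iff_false]
    exact fun hh => h u hh.1 hu w hh.2.1 hh.2.2

/-- The vertices outside of `K` and other than `v` that are adjacent to a vertex of `K`. -/
noncomputable def nbhd (G : SimpleGraph (Fin n)) (v : Fin n) (K : Finset (Fin n)) :
    Finset (Fin n) :=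
  open Classical in Finset.univ.filter fun x => x ∉ K ∧ x ≠ v ∧ ∃ u ∈ K, G.Adj u x

theorem mem_nbhd {v x : Fin n} {K : Finset (Fin n)} :
    x ∈ nbhd G v K ↔ x ∉ K ∧ x ≠ v ∧ ∃ u ∈ K, G.Adj u x := by
  simp [nbhd]

theorem card_nbhd_add_edges_le {v : Fin n} {K : Finset (Fin n)} (hv : v ∉ K) :
    (nbhd G v K).card + edges G {v} K ≤ cutSize G K := by
  have h1 : edges G K {v} + edges G K (nbhd G v K) ≤ cutSize G K := by
    rw [cutSize_eq, ← edges_union_right]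
    · refine edges_mono subset_rfl fun x hx => ?_
      simp only [Finset.mem_union, Finset.mem_singleton, mem_nbhd] at hx
      rcases hx with rfl | hx
      · simpa using hv
      · simpa using hx.1
    · simp [mem_nbhd]
  have h2 : (nbhd G v K).card ≤ edges G K (nbhd G v K) := by
    rw [edges_comm, ← sum_ind_mem]
    refine Finset.sum_le_sum fun x _ => ?_
    by_cases hx : x ∈ nbhd G v K
    · obtain ⟨_, _, u, hu, hux⟩ := mem_nbhd.1 hx
      refine le_trans ?_ (Finset.single_le_sum (fun _ _ => Nat.zero_le _) (Finset.mem_univ u))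
      simp [hx, hu, hux.symm]
    · simp [hx]
  rw [edges_comm] at h1
  omega

theorem two_mul_nonedge (X : Finset (Fin n)) : 2 * nonedge G X = nonedges G X X := by
  classical
  let H : SimpleGraph (Fin n) :=
    { Adj := fun u w => u ∈ X ∧ w ∈ X ∧ u ≠ w ∧ ¬G.Adj u w
      symm := ⟨fun u w h => ⟨h.2.1, h.1, h.2.2.1.symm, fun h' => h.2.2.2 h'.symm⟩⟩
      loopless := ⟨fun u h => h.2.2.1 rfl⟩ }
  have h1 : nonedge G X = H.edgeFinset.card := by
    rw [nonedge]
    congr 1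
    ext e
    induction e with | _ u w
    simp only [Finset.mem_filter, Finset.mem_sym2_iff, Sym2.mem_iff, forall_eq_or_imp, forall_eq,
      SimpleGraph.mem_edgeSet, SimpleGraph.compl_adj, SimpleGraph.mem_edgeFinset, H]
    tauto
  rw [h1, ← H.sum_degrees_eq_twice_card_edges, nonedges]
  refine Finset.sum_congr rfl fun u _ => ?_
  rw [sum_ind, ← SimpleGraph.card_neighborFinset_eq_degree]
  congr 1
  ext w
  simp [H]

theorem nondeg_le_iff {X : Finset (Fin n)} {k : ℕ} :
    nondeg G X ≤ k ↔ ∀ u ∈ X, nonnbrs G X u ≤ k := by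
  classical
  rw [nondeg, Finset.sup_le_iff]
  refine forall₂_congr fun u _ => ?_
  rw [nonnbrs, sum_ind]
  have : X.filter (fun w => Gᶜ.Adj u w) =
      Finset.univ.filter fun w => w ∈ X ∧ u ≠ w ∧ ¬G.Adj u w := by
    ext w; simp
  rw [← this]

theorem nonnbrs_mono {X Y : Finset (Fin n)} (h : X ⊆ Y) (u : Fin n) :
    nonnbrs G X u ≤ nonnbrs G Y u :=
  Finset.sum_le_sum fun _ _ => ind_mono fun hh => ⟨h hh.1, hh.2⟩

theorem nonedges_mono {X Y : Finset (Fin n)} (h : X ⊆ Y) : nonedges G X X ≤ nonedges G Y Y :=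
  Finset.sum_le_sum fun _ _ => Finset.sum_le_sum fun _ _ =>
    ind_mono fun hh => ⟨h hh.1, h hh.2.1, hh.2.2⟩

theorem nonnbrs_union {B K : Finset (Fin n)} (h : Disjoint B K) (u : Fin n) :
    nonnbrs G (B ∪ K) u = nonnbrs G B u + nonnbrs G K u := by
  simp only [nonnbrs, ← Finset.sum_add_distrib]
  refine Finset.sum_congr rfl fun w _ => ?_
  have hw : w ∈ B → w ∉ K := fun hh => Finset.disjoint_left.1 h hh
  by_cases h2 : w ∈ B <;> by_cases h4 : w ∈ K <;> simp_all

theorem nonnbrs_of_forall {X : Finset (Fin n)} {u : Fin n} (h : ∀ w ∈ X, u ≠ w ∧ ¬G.Adj u w) :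
    nonnbrs G X u = X.card := by
  rw [nonnbrs, ← sum_ind_mem]
  exact Finset.sum_congr rfl fun w _ => congrArg ind (propext ⟨fun h => h.1, fun hw => ⟨hw, h w hw⟩⟩)

theorem nonnbrs_add_edges {X : Finset (Fin n)} {u : Fin n} (h : u ∉ X) :
    nonnbrs G X u + edges G {u} X = X.card := by
  rw [nonnbrs, edges_singleton, ← sum_ind_mem, ← Finset.sum_add_distrib]
  refine Finset.sum_congr rfl fun w _ => ?_
  by_cases hw : w ∈ X
  · have : u ≠ w := fun e => h (e ▸ hw)
    by_cases h3 : G.Adj u w <;> simp [hw, h3, this]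
  · simp [hw]

theorem nondeg_le_nonedge (X : Finset (Fin n)) : nondeg G X ≤ nonedge G X := by
  classical
  rw [nondeg_le_iff]
  intro u hu
  have h := two_mul_nonedge (G := G) X
  have hX : nonedges G X X = nonedges G (X.erase u) (X.erase u) + nonedges G {u} {u} +
      2 * nonedges G (X.erase u) {u} := by
    rw [← nonedges_union (by simp), Finset.union_comm, ← Finset.insert_eq, Finset.insert_erase hu]
  have h2 : nonedges G (X.erase u) {u} = nonnbrs G X u := by
    rw [nonedges_comm, nonedges, Finset.sum_eq_single u]
    · refine Finset.sum_congr rfl fun w _ => congrArg ind (propext ?_)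
      simp only [Finset.mem_singleton, Finset.mem_erase, true_and]
      exact ⟨fun hh => ⟨hh.1.2, hh.2⟩, fun hh => ⟨⟨hh.2.1.symm, hh.1⟩, hh.2⟩⟩
    · intro w _ hw; simp [hw]
    · simp
  omega

end Counting

/-! ### Minimal clusters -/

section Combinatorics

variable {n : ℕ} {G : SimpleGraph (Fin n)}

/-- `K` is a union of connected components of `G[R]`. -/
def ClosedIn (G : SimpleGraph (Fin n)) (R K : Finset (Fin n)) : Prop :=
  K ⊆ R ∧ ∀ a ∈ K, ∀ b ∈ R, G.Adj a b → b ∈ K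

/-- Every nonempty union `K` of connected components of `G[R]` is attached to the rest of the graph
mainly through `v`: more than half of the edges of its cut end in `v`. -/
def Thrifty (G : SimpleGraph (Fin n)) (v : Fin n) (R : Finset (Fin n)) : Prop :=
  ∀ K, ClosedIn G R K → K.Nonempty → cutSize G K < 2 * edges G {v} K

/-- What the algorithm needs to know of the function `μ`. A set `K` that is joined to a set `B`
through a single vertex `v` of `B` may be replaced by another such set `K'` with the same number of
vertices and the same number of neighbours of `v`, provided that `K'` satisfies the local condition
`φ v K' t` for a small number `t` that depends on `K`. -/
structure IsLocal (G : SimpleGraph (Fin n)) (μ : Finset (Fin n) → ℕ)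
    (φ : Fin n → Finset (Fin n) → ℕ → Prop) : Prop where
  mono : ∀ {X Y}, X ⊆ Y → μ X ≤ μ Y
  card_or_nondeg : ∀ {X p}, μ X ≤ p → X.card ≤ p ∨ nondeg G X ≤ p
  exchange : ∀ {v B K p}, v ∈ B → Disjoint B K → (∀ b ∈ B, b ≠ v → ∀ k ∈ K, ¬G.Adj b k) →
    μ (B ∪ K) ≤ p → ∃ t ≤ K.card ^ 2, φ v K t ∧ ∀ K', Disjoint B K' →
      (∀ b ∈ B, b ≠ v → ∀ k ∈ K', ¬G.Adj b k) → K'.card = K.card →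
      edges G {v} K' = edges G {v} K → φ v K' t → μ (B ∪ K') ≤ p

theorem isLocal_size : IsLocal G (size G) fun _ _ _ => True where
  mono h := Finset.card_le_card h
  card_or_nondeg h := .inl h
  exchange {v B K p} _ hd _ h := by
    refine ⟨0, by positivity, trivial, fun K' hd' _ hc _ _ => ?_⟩
    rw [size, Finset.card_union_of_disjoint hd']
    rw [size, Finset.card_union_of_disjoint hd] at h
    omega

theorem isLocal_nonedge : IsLocal G (nonedge G) fun _ K t => nonedges G K K ≤ t where
  mono {X Y} h := by
    have h1 := nonedges_mono (G := G) h
    rw [← two_mul_nonedge, ← two_mul_nonedge] at h1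
    omega
  card_or_nondeg h := .inr ((nondeg_le_nonedge _).trans h)
  exchange {v B K p} hv hd hn h := by
    refine ⟨nonedges G K K, by rw [sq]; exact nonedges_le K K, le_rfl, fun K' hd' hn' hc he hφ => ?_⟩
    have h1 := two_mul_nonedge (G := G) (B ∪ K)
    have h2 := two_mul_nonedge (G := G) (B ∪ K')
    rw [nonedges_union hd] at h1
    rw [nonedges_union hd'] at h2
    have h3 := nonedges_add_edges (G := G) hd
    have h4 := nonedges_add_edges (G := G) hd'
    rw [edges_eq_of_not_adj hv hn] at h3
    rw [edges_eq_of_not_adj hv hn', hc, he] at h4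
    omega

theorem isLocal_nondeg : IsLocal G (nondeg G)
    fun v K t => ∀ u ∈ K, nonnbrs G K u + ind (¬G.Adj u v) ≤ t where
  mono {X Y} h := by
    rw [nondeg_le_iff]
    exact fun u hu => (nonnbrs_mono h u).trans (nondeg_le_iff.1 le_rfl u (h hu))
  card_or_nondeg h := .inr h
  exchange {v B K p} hv hd hn h := by
    classical
    rw [nondeg_le_iff] at h
    rcases K.eq_empty_or_nonempty with rfl | hK
    · refine ⟨0, by simp, by simp, fun K' _ _ hc _ _ => ?_⟩
      rw [Finset.card_empty, Finset.card_eq_zero] at hc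
      rwa [hc, nondeg_le_iff]
    -- a vertex of `K` is a non-neighbour of all vertices of `B` other than itself and `v`
    have key : ∀ K, Disjoint B K → (∀ b ∈ B, b ≠ v → ∀ k ∈ K, ¬G.Adj b k) → ∀ u ∈ K,
        nonnbrs G (B ∪ K) u = nonnbrs G K u + ind (¬G.Adj u v) + (B.card - 1) := by
      intro K hd hn u hu
      have hB : nonnbrs G B u = nonnbrs G {v} u + nonnbrs G (B.erase v) u := by
        rw [← nonnbrs_union (by simp), ← Finset.insert_eq, Finset.insert_erase hv]
      have hne : ∀ b ∈ B, u ≠ b := fun b hb e => Finset.disjoint_left.1 hd hb (e ▸ hu)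
      rw [nonnbrs_union hd, hB, nonnbrs_of_forall (X := B.erase v), Finset.card_erase_of_mem hv]
      · have : nonnbrs G {v} u = ind (¬G.Adj u v) := by
          rw [nonnbrs, Finset.sum_eq_single v]
          · simp [hne v hv]
          · intro w _ hw; simp [hw]
          · simp
        omega
      · intro b hb
        rw [Finset.mem_erase] at hb
        exact ⟨hne b hb.2, fun hh => hn b hb.2 hb.1 u hu hh.symm⟩
    obtain ⟨u₀, hu₀, hmax⟩ := Finset.exists_max_image K
      (fun u => nonnbrs G K u + ind (¬G.Adj u v)) hK
    refine ⟨nonnbrs G K u₀ + ind (¬G.Adj u₀ v), ?_, hmax, fun K' hd' hn' hc he hφ => ?_⟩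
    · have h1 : nonnbrs G K u₀ + 1 ≤ K.card := by
        have : nonnbrs G K u₀ ≤ (K.erase u₀).card := by
          rw [← sum_ind_mem]
          exact Finset.sum_le_sum fun w _ => ind_mono fun hh =>
            Finset.mem_erase.2 ⟨hh.2.1.symm, hh.1⟩
        rw [Finset.card_erase_of_mem hu₀] at this
        have := hK.card_pos
        omega
      have h2 : ind (¬G.Adj u₀ v) ≤ 1 := by
        rw [← ind_true]; exact ind_mono fun _ => trivial
      have : K.card ≤ K.card ^ 2 := Nat.le_self_pow two_ne_zero _
      omega
    · rw [nondeg_le_iff]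
      intro u hu
      rcases Finset.mem_union.1 hu with hu | hu
      · have hold := h u (Finset.mem_union_left _ hu)
        rw [nonnbrs_union hd] at hold
        rw [nonnbrs_union hd']
        by_cases huv : u = v
        · subst huv
          have h1 := nonnbrs_add_edges (G := G) (X := K) (u := u) (Finset.disjoint_left.1 hd hv)
          have h2 := nonnbrs_add_edges (G := G) (X := K') (u := u) (Finset.disjoint_left.1 hd' hv)
          omega
        · rw [nonnbrs_of_forall (X := K) fun k hk =>
            ⟨fun e : u = k => Finset.disjoint_left.1 hd hu (e ▸ hk), hn u hu huv k hk⟩] at hold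
          rw [nonnbrs_of_forall (X := K') fun k hk =>
            ⟨fun e : u = k => Finset.disjoint_left.1 hd' hu (e ▸ hk), hn' u hu huv k hk⟩]
          omega
      · have h1 := h u₀ (Finset.mem_union_right _ hu₀)
        rw [key K hd hn u₀ hu₀] at h1
        rw [key K' hd' hn' u hu]
        have := hφ u hu
        omega

variable {μ : Finset (Fin n) → ℕ} {φ : Fin n → Finset (Fin n) → ℕ → Prop} {p q : ℕ}

/-- In a minimal cluster containing `v`, the other vertices form a thrifty set. -/
theorem exists_thrifty_cluster (hμ : IsLocal G μ φ) {v : Fin n}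
    (h : ∃ C, v ∈ C ∧ IsCluster G μ p q C) :
    ∃ C, v ∈ C ∧ IsCluster G μ p q C ∧ Thrifty G v (C.erase v) := by
  classical
  obtain ⟨C, ⟨hv, hC⟩, hmin⟩ := exists_minimal_of_wellFoundedLT
    (fun C => v ∈ C ∧ IsCluster G μ p q C) h
  refine ⟨C, hv, hC, fun K hK hne => ?_⟩
  obtain ⟨hKC, hcl⟩ := hK
  have hKC' : K ⊆ C := hKC.trans (Finset.erase_subset _ _)
  have hvK : v ∉ K := fun hh => (Finset.mem_erase.1 (hKC hh)).1 rfl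
  have hvB : v ∈ C \ K := Finset.mem_sdiff.2 ⟨hv, hvK⟩
  have hBq : q < cutSize G (C \ K) := by
    by_contra! hq
    have := hmin (y := C \ K) ⟨hvB, (hμ.mono Finset.sdiff_subset).trans hC.1, hq⟩
      Finset.sdiff_subset
    obtain ⟨k, hk⟩ := hne
    exact (Finset.mem_sdiff.1 (this (hKC' hk))).2 hk
  have h1 := cutSize_union (G := G) (B := C \ K) (K := K) Finset.sdiff_disjoint
  rw [Finset.sdiff_union_of_subset hKC', edges_eq_of_not_adj hvB] at h1
  · have := hC.2
    omega
  · intro b hb hbv k hk hadj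
    rw [Finset.mem_sdiff] at hb
    exact hb.2 (hcl k hk b (Finset.mem_erase.2 ⟨hbv, hb.1⟩) hadj.symm)

theorem Thrifty.mono {v : Fin n} {R K : Finset (Fin n)} (h : Thrifty G v R)
    (hK : ∀ L, ClosedIn G K L → ClosedIn G R L) : Thrifty G v K := fun L hL => h L (hK L hL)

theorem ClosedIn.sdiff {R K : Finset (Fin n)} (h : ClosedIn G R K) : ClosedIn G R (R \ K) := by
  refine ⟨Finset.sdiff_subset, fun a ha b hb hab => ?_⟩
  rw [Finset.mem_sdiff] at *
  exact ⟨hb, fun hbK => ha.2 (h.2 b hbK a ha.1 hab.symm)⟩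

theorem ClosedIn.trans {R K L : Finset (Fin n)} (h : ClosedIn G R K) (h' : ClosedIn G K L) :
    ClosedIn G R L :=
  ⟨h'.1.trans h.1, fun a ha b hb hab => h'.2 a ha b (h.2 a (h'.1 ha) b hb hab) hab⟩

/-- The graph `G[K]` is connected (or empty). -/
def IsConn (G : SimpleGraph (Fin n)) (K : Finset (Fin n)) : Prop :=
  ∀ X, ClosedIn G K X → X.Nonempty → X = K

/-- The connected component of `z` in `G[R]`. -/
theorem exists_component {R : Finset (Fin n)} {z : Fin n} (hz : z ∈ R) :
    ∃ K, z ∈ K ∧ ClosedIn G R K ∧ IsConn G K := by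
  classical
  obtain ⟨K, ⟨hzK, hK⟩, hmin⟩ := exists_minimal_of_wellFoundedLT
    (fun K => z ∈ K ∧ ClosedIn G R K) ⟨R, hz, subset_rfl, fun _ _ _ hb _ => hb⟩
  refine ⟨K, hzK, hK, fun X hX hne => ?_⟩
  by_cases hzX : z ∈ X
  · exact hX.1.antisymm (hmin ⟨hzX, hK.trans hX⟩ hX.1)
  · have := hmin (y := K \ X) ⟨Finset.mem_sdiff.2 ⟨hzK, hzX⟩, hK.trans hX.sdiff⟩
      Finset.sdiff_subset
    obtain ⟨x, hx⟩ := hne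
    exact absurd hx (Finset.mem_sdiff.1 (this (hX.1 hx))).2

/-- A connected component of `G[R]` of the smallest possible size. -/
theorem exists_smallest_component {R : Finset (Fin n)} (hR : R.Nonempty) :
    ∃ K, K.Nonempty ∧ ClosedIn G R K ∧ IsConn G K ∧
      ∀ L, ClosedIn G R L → L.Nonempty → K.card ≤ L.card := by
  classical
  obtain ⟨K, hK, hmin⟩ := Finset.exists_min_image
    (R.powerset.filter fun K => K.Nonempty ∧ ClosedIn G R K) Finset.card
    ⟨R, by simpa using ⟨hR, subset_rfl, fun _ _ _ hb _ => hb⟩⟩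
  simp only [Finset.mem_filter, Finset.mem_powerset] at hK hmin
  have hmin' : ∀ L, ClosedIn G R L → L.Nonempty → K.card ≤ L.card :=
    fun L hL hne => hmin L ⟨hL.1, hne, hL⟩
  exact ⟨K, hK.2.1, hK.2.2, fun X hX hne =>
    Finset.eq_of_subset_of_card_le hX.1 (hmin' X (hK.2.2.trans hX) hne), hmin'⟩

/-! ### Exploring a connected set -/

/-- The element of `F` with exactly `k` smaller elements in `F` (or `N` if there is none),
written as a sum over the numbers below `N`. -/
noncomputable def nth (N : ℕ) (F : Finset (Fin n)) (k : ℕ) : ℕ :=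
  ∑ x ∈ Finset.range N, ind ((∑ z : Fin n, ind (z.val ≤ x ∧ z ∈ F)) ≤ k)

theorem nth_rank {N : ℕ} (hN : n ≤ N) {F : Finset (Fin n)} {z : Fin n} (hz : z ∈ F) :
    nth N F (F.filter (· < z)).card = z := by
  have h : ∀ x ∈ Finset.range N,
      ind ((∑ y : Fin n, ind (y.val ≤ x ∧ y ∈ F)) ≤ (F.filter (· < z)).card) =
        if x < z.val then 1 else 0 := by
    intro x _
    rw [sum_ind]
    split_ifs with hx
    · refine ind_of (Finset.card_le_card fun y hy => ?_)
      simp only [Finset.mem_filter, Finset.mem_univ, true_and] at hy ⊢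
      exact ⟨hy.2, Fin.lt_def.2 (by omega)⟩
    · refine ind_of_not (not_le.2 (Finset.card_lt_card ?_))
      rw [Finset.ssubset_iff_of_subset]
      · exact ⟨z, by simp [hz]; omega, by simp⟩
      · intro y hy
        simp only [Finset.mem_filter, Finset.mem_univ, true_and] at hy ⊢
        have := Fin.lt_def.1 hy.2
        exact ⟨by omega, hy.1⟩
  rw [nth, Finset.sum_congr rfl h, Finset.sum_boole]
  have : (Finset.range N).filter (fun x => x < z.val) = Finset.range z.val := by
    ext x
    simp only [Finset.mem_filter, Finset.mem_range]
    have := z.isLt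
    omega
  simp [this]

theorem nth_empty (N k : ℕ) : nth N (∅ : Finset (Fin n)) k = N := by
  simp [nth]

theorem exists_nth_zero {N : ℕ} (hN : n ≤ N) {F : Finset (Fin n)} (hF : F.Nonempty) :
    ∃ y ∈ F, nth N F 0 = y := by
  refine ⟨F.min' hF, F.min'_mem hF, ?_⟩
  rw [← nth_rank hN (F.min'_mem hF)]
  congr 1
  rw [eq_comm, Finset.card_eq_zero, Finset.filter_eq_empty_iff]
  exact fun x hx => not_lt.2 (F.min'_le x hx)

/-- The vertices outside of `K` and `O` with a neighbour in `K`. -/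
noncomputable def frontier (G : SimpleGraph (Fin n)) (K O : Finset (Fin n)) : Finset (Fin n) :=
  open Classical in Finset.univ.filter fun x => x ∉ K ∧ x ∉ O ∧ ∃ u ∈ K, G.Adj u x

theorem mem_frontier {K O : Finset (Fin n)} {x : Fin n} :
    x ∈ frontier G K O ↔ x ∉ K ∧ x ∉ O ∧ ∃ u ∈ K, G.Adj u x := by
  simp [frontier]

/-- One step of an exploration that has put the vertices of the first set in, and those of the
second one out. The last bit of the third component tells what happens to the first vertex of the
frontier. (As the program computes halves by a bounded sum, they are cut off at `N`.) -/
noncomputable def exploreStep (G : SimpleGraph (Fin n)) (N : ℕ)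
    (st : Finset (Fin n) × Finset (Fin n) × ℕ) : Finset (Fin n) × Finset (Fin n) × ℕ :=
  open Classical in
  (Finset.univ.filter fun x => x ∈ st.1 ∨
      x.val = nth N (frontier G st.1 st.2.1) 0 ∧ st.2.2 - 2 * min N (st.2.2 / 2) ≠ 0,
    Finset.univ.filter fun x => x ∈ st.2.1 ∨
      x.val = nth N (frontier G st.1 st.2.1) 0 ∧ ¬st.2.2 - 2 * min N (st.2.2 / 2) ≠ 0,
    min N (st.2.2 / 2))

/-- The set found by an exploration from `w` that avoids `v` and is directed by the bits of `b`. -/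
noncomputable def explore (G : SimpleGraph (Fin n)) (N : ℕ) (v : Fin n) (w b : ℕ) :
    Finset (Fin n) :=
  ((exploreStep G N)^[N] (Finset.univ.filter fun x => x.val = w, {v}, b)).1

theorem explore_iterate_of_frontier_eq_empty {N : ℕ} (hN : n ≤ N) {K O : Finset (Fin n)}
    (h : frontier G K O = ∅) (m b : ℕ) : ((exploreStep G N)^[m] (K, O, b)).1 = K := by
  induction m generalizing b with
  | zero => rfl
  | succ m ih =>
    rw [Function.iterate_succ_apply]
    have h1 : exploreStep G N (K, O, b) = (K, O, min N (b / 2)) := by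
      have h2 : ∀ x : Fin n, x.val ≠ N := fun x => by have := x.isLt; omega
      simp [exploreStep, h, nth_empty, h2]
    rw [h1, ih]

/-- Suitable bits direct an exploration from a part `K` of the connected set `K₀` to the whole of
`K₀`, since each step settles a vertex of `K₀` or a neighbour of `K₀`. -/
theorem exists_explore_iterate {N : ℕ} (hN : n ≤ N) {v : Fin n} {K₀ : Finset (Fin n)}
    (hconn : IsConn G K₀) (l : ℕ) : ∀ K O : Finset (Fin n), 2 ^ l ≤ N → K ⊆ K₀ → K.Nonempty →
    v ∈ O → Disjoint O K₀ → (K₀ \ K).card + (nbhd G v K₀ \ O).card ≤ l →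
    ∃ b < 2 ^ l, ∀ m ≥ l, ((exploreStep G N)^[m] (K, O, b)).1 = K₀ := by
  classical
  induction l with
  | zero =>
    intro K O _ hK hne hv hd hc
    have hKK : K = K₀ := by
      refine hK.antisymm ?_
      rw [← Finset.sdiff_eq_empty_iff_subset, ← Finset.card_eq_zero]
      omega
    subst hKK
    have hf : frontier G K O = ∅ := by
      rw [Finset.eq_empty_iff_forall_notMem]
      intro x hx
      rw [mem_frontier] at hx
      have : x ∈ nbhd G v K \ O := Finset.mem_sdiff.2
        ⟨mem_nbhd.2 ⟨hx.1, fun e => hx.2.1 (e ▸ hv), hx.2.2⟩, hx.2.1⟩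
      have := Finset.card_pos.2 ⟨x, this⟩
      omega
    exact ⟨0, by simp, fun m _ => explore_iterate_of_frontier_eq_empty hN hf m 0⟩
  | succ l ih =>
    intro K O hl hK hne hv hd hc
    have hl' : 2 ^ l ≤ N := (Nat.pow_le_pow_right two_pos (Nat.le_succ l)).trans hl
    rcases (frontier G K O).eq_empty_or_nonempty with hf | hf
    · have hKK : K = K₀ := by
        refine hconn K ⟨hK, fun a ha b hb hab => ?_⟩ hne
        by_contra hbK
        have : b ∈ frontier G K O :=
          mem_frontier.2 ⟨hbK, fun hbO => Finset.disjoint_left.1 hd hbO hb, a, ha, hab⟩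
        simp [hf] at this
      subst hKK
      exact ⟨0, by positivity, fun m _ => explore_iterate_of_frontier_eq_empty hN hf m 0⟩
    · obtain ⟨y, hy, hnth⟩ := exists_nth_zero hN hf
      rw [mem_frontier] at hy
      have hpow : 2 ^ (l + 1) = 2 * 2 ^ l := by rw [pow_succ]; ring
      by_cases hyK : y ∈ K₀
      · obtain ⟨b, hb, hrun⟩ := ih (insert y K) O hl' (Finset.insert_subset hyK hK)
          (Finset.insert_nonempty _ _) hv hd (by
            have : (K₀ \ insert y K).card < (K₀ \ K).card := by
              refine Finset.card_lt_card ((Finset.ssubset_iff_of_subset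
                (Finset.sdiff_subset_sdiff subset_rfl (Finset.subset_insert _ _))).2
                ⟨y, Finset.mem_sdiff.2 ⟨hyK, hy.1⟩, by simp⟩)
            omega)
        refine ⟨2 * b + 1, by omega, fun m hm => ?_⟩
        obtain ⟨m, rfl⟩ : ∃ m', m = m' + 1 := ⟨m - 1, by omega⟩
        rw [Function.iterate_succ_apply]
        have h1 : exploreStep G N (K, O, 2 * b + 1) = (insert y K, O, b) := by
          have h2 : min N ((2 * b + 1) / 2) = b := by omega
          have h3 : 2 * b + 1 - 2 * b = 1 := by omega
          simp only [exploreStep, hnth, h2, h3]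
          refine Prod.ext ?_ (Prod.ext ?_ rfl)
          · ext x; simp [Fin.ext_iff, or_comm]
          · ext x; simp
        rw [h1]
        exact hrun m (by omega)
      · obtain ⟨b, hb, hrun⟩ := ih K (insert y O) hl' hK hne (Finset.mem_insert_of_mem hv)
          (by rw [Finset.disjoint_insert_left]; exact ⟨hyK, hd⟩) (by
            have : (nbhd G v K₀ \ insert y O).card < (nbhd G v K₀ \ O).card := by
              obtain ⟨u, hu, huy⟩ := hy.2.2
              refine Finset.card_lt_card ((Finset.ssubset_iff_of_subset
                (Finset.sdiff_subset_sdiff subset_rfl (Finset.subset_insert _ _))).2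
                ⟨y, Finset.mem_sdiff.2 ⟨mem_nbhd.2 ⟨hyK, fun e => hy.2.1 (e ▸ hv), u, hK hu, huy⟩,
                  hy.2.1⟩, by simp⟩)
            omega)
        refine ⟨2 * b, by omega, fun m hm => ?_⟩
        obtain ⟨m, rfl⟩ : ∃ m', m = m' + 1 := ⟨m - 1, by omega⟩
        rw [Function.iterate_succ_apply]
        have h1 : exploreStep G N (K, O, 2 * b) = (K, insert y O, b) := by
          have h2 : min N (2 * b / 2) = b := by omega
          have h3 : 2 * b - 2 * b = 0 := by omega
          simp only [exploreStep, hnth, h2, h3]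
          refine Prod.ext ?_ (Prod.ext ?_ rfl)
          · ext x; simp
          · ext x; simp [Fin.ext_iff, or_comm]
        rw [h1]
        exact hrun m (by omega)

/-- A connected thrifty set of `k` vertices is found from each of its vertices by an exploration
directed by `2 * k` bits. -/
theorem exists_explore {N : ℕ} (hN : n ≤ N) {v : Fin n} {K : Finset (Fin n)} (hconn : IsConn G K)
    (hv : v ∉ K) (hcut : cutSize G K < 2 * edges G {v} K) (hK : 4 ^ K.card ≤ N) {w : Fin n}
    (hw : w ∈ K) : ∃ b < 4 ^ K.card, explore G N v w b = K := by
  have h4 : 4 ^ K.card = 2 ^ (2 * K.card) := by rw [pow_mul]; norm_num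
  have hw' : (Finset.univ.filter fun x : Fin n => x.val = w.val) = {w} := by
    ext x; simp [Fin.ext_iff]
  obtain ⟨b, hb, h⟩ := exists_explore_iterate (v := v) hN hconn (2 * K.card) {w} {v} (h4 ▸ hK)
    (by simpa using hw) (by simp) (by simp) (by simpa using hv) (by
      have h1 := card_nbhd_add_edges_le (G := G) hv
      have h2 := edges_singleton_le (G := G) v K
      have h3 := Finset.card_le_card (Finset.sdiff_subset (s := K) (t := {w}))
      have h4 := Finset.card_le_card (Finset.sdiff_subset (s := nbhd G v K) (t := {v}))
      omega)
  exact ⟨b, h4 ▸ hb, by rw [explore, hw']; exact h N (by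
    have : 2 * K.card < 2 ^ (2 * K.card) := Nat.lt_two_pow_self
    omega)⟩

end Combinatorics

section Branching

variable {n : ℕ} {G : SimpleGraph (Fin n)} {μ : Finset (Fin n) → ℕ}
  {φ : Fin n → Finset (Fin n) → ℕ → Prop} {p q : ℕ}

/-! ### Assembling a small cluster from components -/

/-- The advice for one round of the assembly: the description `s`, `d`, `e`, `t` of a component, a
bound `β` for the codes under which such a component is searched, and the position `i` and the code
`b` that tell which set is added. -/
structure Move where
  s : ℕ
  d : ℕ
  e : ℕ
  t : ℕ
  β : ℕ
  i : ℕ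
  b : ℕ

/-- The set `K` agrees with the description in `m`, and it can be added to `A`: it is disjoint from
`A` and not adjacent to any vertex of `A` except `v`. -/
def Fits (G : SimpleGraph (Fin n)) (φ : Fin n → Finset (Fin n) → ℕ → Prop) (v : Fin n)
    (A : Finset (Fin n)) (m : Move) (K : Finset (Fin n)) : Prop :=
  K.card = m.s ∧ cutSize G K = m.d ∧ edges G {v} K = m.e ∧ φ v K m.t ∧
    ∀ u ∈ K, u ∉ A ∧ ∀ z ∈ A, z ≠ v → ¬G.Adj u z

/-- The last one among the explored sets that fit (or the empty set). -/
noncomputable def representative (G : SimpleGraph (Fin n))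
    (φ : Fin n → Finset (Fin n) → ℕ → Prop) (N : ℕ) (v : Fin n) (A : Finset (Fin n)) (m : Move) :
    Finset (Fin n) :=
  open Classical in
  (List.range N).foldl (fun R w => (List.range N).foldl (fun R b =>
    if b < m.β ∧ Fits G φ v A m (explore G N v w b) then explore G N v w b else R) R) ∅

/-- The vertices in or next to `R`, without `v`. -/
noncomputable def hood (G : SimpleGraph (Fin n)) (v : Fin n) (R : Finset (Fin n)) :
    Finset (Fin n) :=
  open Classical in Finset.univ.filter fun x => x ≠ v ∧ (x ∈ R ∨ ∃ u ∈ R, G.Adj u x)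

theorem mem_hood {v x : Fin n} {R : Finset (Fin n)} :
    x ∈ hood G v R ↔ x ≠ v ∧ (x ∈ R ∨ ∃ u ∈ R, G.Adj u x) := by
  simp [hood]

/-- One round of the assembly. -/
noncomputable def moveStep (G : SimpleGraph (Fin n)) (φ : Fin n → Finset (Fin n) → ℕ → Prop)
    (N : ℕ) (v : Fin n) (A : Finset (Fin n)) (m : Move) : Finset (Fin n) :=
  if m.s ≠ 0 then A ∪ explore G N v (nth N (hood G v (representative G φ N v A m)) m.i) m.b else A

/-- A property that is preserved by all steps and established by one of them holds in the end. -/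
theorem foldl_establishes {α β : Type*} {f : β → α → β} (Q : β → Prop) {l : List α} {i : α}
    (hi : i ∈ l) (hpres : ∀ b, ∀ j ∈ l, Q b → Q (f b j)) (hest : ∀ b, Q (f b i)) (b : β) :
    Q (l.foldl f b) := by
  have hkeep : ∀ (l' : List α) b, (∀ j ∈ l', j ∈ l) → Q b → Q (l'.foldl f b) := by
    intro l'
    induction l' with
    | nil => exact fun b _ h => h
    | cons j l' ih =>
      exact fun b hl h => ih _ (fun k hk => hl k (List.mem_cons_of_mem _ hk))
        (hpres b j (hl j List.mem_cons_self) h)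
  obtain ⟨l₁, l₂, rfl⟩ := List.append_of_mem hi
  rw [List.foldl_append, List.foldl_cons]
  exact hkeep l₂ _ (fun j hj => by simp [hj]) (hest _)

/-- If some explored set fits, then the representative is an explored set that fits. -/
theorem exists_representative {N : ℕ} {v : Fin n} {A : Finset (Fin n)} {m : Move}
    (h : ∃ w < N, ∃ b < N, b < m.β ∧ Fits G φ v A m (explore G N v w b)) :
    ∃ w b, b < m.β ∧ Fits G φ v A m (explore G N v w b) ∧
      representative G φ N v A m = explore G N v w b := by
  obtain ⟨w, hw, b, hb, hfit⟩ := h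
  rw [representative]
  have hpres : ∀ (w : ℕ) (R : Finset (Fin n)), ∀ b ∈ List.range N,
      (∃ w b, b < m.β ∧ Fits G φ v A m (explore G N v w b) ∧ R = explore G N v w b) →
      ∃ w' b', b' < m.β ∧ Fits G φ v A m (explore G N v w' b') ∧
        (open Classical in if b < m.β ∧ Fits G φ v A m (explore G N v w b) then explore G N v w b
          else R) = explore G N v w' b' := by
    intro w R b _ hR
    split_ifs with hc
    · exact ⟨w, b, hc.1, hc.2, rfl⟩
    · exact hR
  refine foldl_establishes (fun R => ∃ w b, b < m.β ∧ Fits G φ v A m (explore G N v w b) ∧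
    R = explore G N v w b) (List.mem_range.2 hw) (fun R w' _ hR => ?_) (fun R => ?_) ∅
  · have hall : ∀ (l : List ℕ) R, (∀ j ∈ l, j ∈ List.range N) →
        (∃ w b, b < m.β ∧ Fits G φ v A m (explore G N v w b) ∧ R = explore G N v w b) →
        ∃ w b, b < m.β ∧ Fits G φ v A m (explore G N v w b) ∧ l.foldl (fun R b =>
          open Classical in if b < m.β ∧ Fits G φ v A m (explore G N v w' b) then
            explore G N v w' b else R) R = explore G N v w b := by
      intro l
      induction l with
      | nil => exact fun R _ h => h
      | cons j l ih =>
        exact fun R hl h => ih _ (fun k hk => hl k (List.mem_cons_of_mem _ hk))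
          (hpres w' R j (hl j List.mem_cons_self) h)
    exact hall _ R (fun _ h => h) hR
  · refine foldl_establishes (fun R => ∃ w b, b < m.β ∧ Fits G φ v A m (explore G N v w b) ∧
      R = explore G N v w b) (List.mem_range.2 hb) (hpres w) (fun R => ?_) R
    rw [if_pos hfit]
    exact ⟨w, b, hfit.1, hfit.2, rfl⟩

/-- The number of base-4 digits that encode a list of numbers: one for each binary digit of an entry,
and a separator after each entry. -/
def codeLength (xs : List ℕ) : ℕ := (xs.map fun x => x.size + 1).sum

/-- The numbers in the advice for one round. -/
def Move.toList (m : Move) : List ℕ := [m.s, m.d, m.e, m.t, m.β, m.i, m.b]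

theorem codeLength_append (xs ys : List ℕ) :
    codeLength (xs ++ ys) = codeLength xs + codeLength ys := by
  simp [codeLength]

theorem subset_explore {N : ℕ} {v : Fin n} {w b : ℕ} {x : Fin n} (hx : x.val = w) :
    x ∈ explore G N v w b := by
  have h : ∀ m (st : Finset (Fin n) × Finset (Fin n) × ℕ), x ∈ st.1 →
      x ∈ ((exploreStep G N)^[m] st).1 := by
    intro m
    induction m with
    | zero => exact fun _ h => h
    | succ m ih =>
      intro st h
      rw [Function.iterate_succ_apply]
      exact ih _ (by simp [exploreStep, h])
  exact h N _ (by simpa using hx)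

theorem explore_eq_empty {N : ℕ} (hN : n ≤ N) {v : Fin n} {w b : ℕ} (hw : n ≤ w) :
    explore G N v w b = ∅ := by
  have : (Finset.univ.filter fun x : Fin n => x.val = w) = ∅ := by
    rw [Finset.filter_eq_empty_iff]
    intro x _; have := x.isLt; omega
  rw [explore, this]
  exact explore_iterate_of_frontier_eq_empty hN (by
    rw [Finset.eq_empty_iff_forall_notMem]; intro x; simp [mem_frontier]) N b

theorem card_filter_lt_of_mem {F : Finset (Fin n)} {z : Fin n} (hz : z ∈ F) :
    (F.filter (· < z)).card < F.card :=
  Finset.card_lt_card ((Finset.ssubset_iff_of_subset (Finset.filter_subset _ _)).2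
    ⟨z, hz, by simp⟩)

/-- The advice for one round is linear in the size `k` of the set that is added. This is why `t` is
bounded by a polynomial in `s`, and why the bound `β` is determined by `s`. -/
theorem Move.codeLength_toList_le {m : Move} {k : ℕ} (_hk : 1 ≤ k) (hs : m.s ≤ k)
    (hd : m.d < 2 * k) (he : m.e ≤ k) (ht : m.t ≤ m.s ^ 2) (hβ : m.β = 4 ^ m.s)
    (hi : m.i < 2 * k) (hb : m.b < 4 ^ k) : codeLength m.toList ≤ 20 * k := by
  have h1 : ∀ x, x ≤ k → x.size ≤ k := fun x hx => Nat.size_le.2 (hx.trans_lt Nat.lt_two_pow_self)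
  have h2 : ∀ x, x < 2 * k → x.size ≤ 2 * k := fun x hx => Nat.size_le.2 (hx.trans Nat.lt_two_pow_self)
  have h4 : ∀ j : ℕ, 4 ^ j = 2 ^ (2 * j) := fun j => by rw [pow_mul]; norm_num
  have hts : m.t.size ≤ 2 * k := by
    refine Nat.size_le.2 (ht.trans_lt ?_)
    rw [mul_comm, pow_mul]
    exact Nat.pow_lt_pow_left (hs.trans_lt Nat.lt_two_pow_self) two_ne_zero
  have hβs : m.β.size ≤ 2 * k + 1 := by
    refine Nat.size_le.2 ?_
    rw [hβ, h4]
    exact Nat.pow_lt_pow_right one_lt_two (by omega)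
  have hbs : m.b.size ≤ 2 * k := Nat.size_le.2 (h4 k ▸ hb)
  have := h1 _ hs
  have := h2 _ hd
  have := h1 _ he
  have := h2 _ hi
  simp only [codeLength, toList, List.map_cons, List.map_nil, List.sum_cons, List.sum_nil]
  omega

/-- If some thrifty set `R` completes `A` to a cluster, then suitable advice makes the assembly
turn `A` into a cluster. The reason is an exchange argument: the representative `K*` of the type of
a smallest component `K₁` of `G[R]` either touches a component of `G[R]`, which then can be reached
from a vertex in or next to `K*`, or `K₁` may be replaced by `K*`. As the component that is added is
at least as large as `K₁`, the advice has length linear in its size. -/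
theorem exists_moves (hμ : IsLocal G μ φ) {N : ℕ} (hN : n ≤ N) {v : Fin n} (r : ℕ) :
    ∀ A R : Finset (Fin n), R.card = r → v ∈ A → Disjoint A R →
      (∀ a ∈ A, a ≠ v → ∀ x ∈ R, ¬G.Adj a x) → IsCluster G μ p q (A ∪ R) → Thrifty G v R →
      4 ^ r ≤ N → ∃ l : List Move, codeLength (l.flatMap Move.toList) ≤ 20 * r ∧
        v ∈ l.foldl (moveStep G φ N v) A ∧ IsCluster G μ p q (l.foldl (moveStep G φ N v) A) := by
  classical
  induction r using Nat.strong_induction_on with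
  | _ r ih =>
  intro A R hr hvA hAR hnadj hC hthrift hNr
  rcases R.eq_empty_or_nonempty with rfl | hR
  · exact ⟨[], by simp [codeLength], hvA, by simpa using hC⟩
  obtain ⟨K₁, hne₁, hcl₁, hconn₁, hmin₁⟩ := exists_smallest_component (G := G) hR
  have hvR : v ∉ R := Finset.disjoint_left.1 hAR hvA
  have hK₁R := hcl₁.1
  have hpow : ∀ {K}, K ⊆ R → 4 ^ K.card ≤ N := fun h =>
    (Nat.pow_le_pow_right (by norm_num) (hr ▸ Finset.card_le_card h)).trans hNr
  have hvK₁ : v ∉ K₁ := fun h => hvR (hK₁R h)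
  have hcut₁ := hthrift K₁ hcl₁ hne₁
  -- the part of the cluster without `K₁`
  set B := A ∪ (R \ K₁) with hB
  have hvB : v ∈ B := Finset.mem_union_left _ hvA
  have hBK₁ : B ∪ K₁ = A ∪ R := by
    rw [hB, Finset.union_assoc, Finset.sdiff_union_of_subset hK₁R]
  have hdisj₁ : Disjoint B K₁ := Finset.disjoint_union_left.2
    ⟨hAR.mono_right hK₁R, Finset.sdiff_disjoint⟩
  have hnadj₁ : ∀ b ∈ B, b ≠ v → ∀ k ∈ K₁, ¬G.Adj b k := by
    intro b hb hbv k hk hadj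
    rcases Finset.mem_union.1 hb with hb | hb
    · exact hnadj b hb hbv k (hK₁R hk) hadj
    · rw [Finset.mem_sdiff] at hb
      exact hb.2 (hcl₁.2 k hk b hb.1 hadj.symm)
  obtain ⟨t, ht, hφ₁, hexch⟩ := hμ.exchange hvB hdisj₁ hnadj₁ (hBK₁ ▸ hC.1)
  set m₀ : Move := ⟨K₁.card, cutSize G K₁, edges G {v} K₁, t, 4 ^ K₁.card, 0, 0⟩ with hm₀
  have hfit₁ : Fits G φ v A m₀ K₁ := ⟨rfl, rfl, rfl, hφ₁, fun u hu =>
    ⟨Finset.disjoint_right.1 hAR (hK₁R hu), fun z hz hzv h =>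
      hnadj z hz hzv u (hK₁R hu) h.symm⟩⟩
  obtain ⟨w₁, hw₁⟩ := hne₁
  obtain ⟨b₁, hb₁, he₁⟩ := exists_explore hN hconn₁ hvK₁ hcut₁ (hpow hK₁R) hw₁
  obtain ⟨w, b, hbβ, hfit, hrep⟩ := exists_representative (N := N) (m := m₀) (v := v) (A := A)
    (G := G) (φ := φ) ⟨w₁, w₁.isLt.trans_le hN, b₁, hb₁.trans_le (hpow hK₁R), hb₁, by rwa [he₁]⟩
  rw [← hrep] at hfit
  set K := representative G φ N v A m₀ with hK
  obtain ⟨hcard, hcut, hedge, hφ, havoid⟩ := hfit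
  have hpos₁ : 0 < K₁.card := Finset.card_pos.2 ⟨w₁, hw₁⟩
  -- the advice does not influence the representative
  have hstep : ∀ i b', moveStep G φ N v A ⟨K₁.card, cutSize G K₁, edges G {v} K₁, t, 4 ^ K₁.card,
      i, b'⟩ = A ∪ explore G N v (nth N (hood G v K) i) b' := by
    intro i b'
    rw [moveStep, if_pos hpos₁.ne']
    rfl
  have hvK : v ∉ K := fun h => (havoid v h).1 hvA
  have hhood : (hood G v K).card < 2 * K₁.card := by
    have hsub : hood G v K ⊆ K ∪ nbhd G v K := by
      intro x hx
      rw [mem_hood] at hx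
      rw [Finset.mem_union, mem_nbhd]
      tauto
    have h1 := (Finset.card_le_card hsub).trans (Finset.card_union_le _ _)
    have h2 := card_nbhd_add_edges_le (G := G) hvK
    have h3 := edges_singleton_le (G := G) v K₁
    simp only [hm₀] at hcard hcut hedge
    omega
  have hd₁ : cutSize G K₁ < 2 * K₁.card := by
    have := edges_singleton_le (G := G) v K₁
    omega
  by_cases hmeet : ∃ z ∈ hood G v K, z ∈ R
  · obtain ⟨z, hzK, hzR⟩ := hmeet
    obtain ⟨L, hzL, hclL, hconnL⟩ := exists_component (G := G) hzR
    have hLR := hclL.1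
    obtain ⟨b', hb', he'⟩ := exists_explore hN hconnL (fun h => hvR (hLR h))
      (hthrift L hclL ⟨z, hzL⟩) (hpow hLR) hzL
    have hcL := hmin₁ L hclL ⟨z, hzL⟩
    have hcR : (R \ L).card = r - L.card := by
      rw [Finset.card_sdiff_of_subset hLR, hr]
    have hLr : L.card ≤ r := hr ▸ Finset.card_le_card hLR
    obtain ⟨l, hl1, hl2, hl3⟩ := ih (r - L.card) (by omega) (A ∪ L) (R \ L) hcR
      (Finset.mem_union_left _ hvA)
      (Finset.disjoint_union_left.2 ⟨hAR.mono_right Finset.sdiff_subset, Finset.disjoint_sdiff⟩)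
      (by
        intro a ha hav x hx hadj
        rw [Finset.mem_sdiff] at hx
        rcases Finset.mem_union.1 ha with ha | ha
        · exact hnadj a ha hav x hx.1 hadj
        · exact hx.2 (hclL.2 a ha x hx.1 hadj))
      (by rwa [Finset.union_assoc, Finset.union_sdiff_of_subset hLR])
      (hthrift.mono fun _ h => hclL.sdiff.trans h)
      ((Nat.pow_le_pow_right (by norm_num) (Nat.sub_le _ _)).trans hNr)
    refine ⟨⟨K₁.card, cutSize G K₁, edges G {v} K₁, t, 4 ^ K₁.card,
      ((hood G v K).filter (· < z)).card, b'⟩ :: l, ?_, ?_⟩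
    · rw [List.flatMap_cons, codeLength_append]
      have := Move.codeLength_toList_le (m := ⟨K₁.card, cutSize G K₁, edges G {v} K₁, t,
        4 ^ K₁.card, ((hood G v K).filter (· < z)).card, b'⟩) (k := L.card) (by omega) hcL
        (by simp only; omega) ((edges_singleton_le v K₁).trans hcL) ht rfl
        (by have := card_filter_lt_of_mem hzK; simp only; omega) hb'
      omega
    · rw [List.foldl_cons, hstep, nth_rank hN hzK, he']
      exact ⟨hl2, hl3⟩
  · -- nothing of `R` is in or next to `K`: exchange `K₁` for `K`
    have hmeet : ∀ x ∈ R, x ∉ K ∧ ∀ u ∈ K, ¬G.Adj u x := by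
      intro x hx
      have hxv : x ≠ v := fun e => hvR (e ▸ hx)
      have := fun h : x ∈ K ∨ ∃ u ∈ K, G.Adj u x => hmeet ⟨x, mem_hood.2 ⟨hxv, h⟩, hx⟩
      exact ⟨fun h => this (.inl h), fun u hu h => this (.inr ⟨u, hu, h⟩)⟩
    have hwn : w < n := by
      by_contra! hw
      rw [hrep, explore_eq_empty hN hw] at hcard
      simp only [hm₀, Finset.card_empty] at hcard
      omega
    have hwK : (⟨w, hwn⟩ : Fin n) ∈ K := hrep ▸ subset_explore rfl
    have hwh : (⟨w, hwn⟩ : Fin n) ∈ hood G v K :=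
      mem_hood.2 ⟨fun e => hvK (e ▸ hwK), .inl hwK⟩
    have hdisj : Disjoint B K := by
      rw [Finset.disjoint_right]
      intro x hx hxB
      rcases Finset.mem_union.1 hxB with h | h
      · exact (havoid x hx).1 h
      · exact (hmeet x (Finset.mem_sdiff.1 h).1).1 hx
    have hnadj' : ∀ b ∈ B, b ≠ v → ∀ k ∈ K, ¬G.Adj b k := by
      intro b hb hbv k hk hadj
      rcases Finset.mem_union.1 hb with hb | hb
      · exact (havoid k hk).2 b hb hbv hadj.symm
      · exact (hmeet b (Finset.mem_sdiff.1 hb).1).2 k hk hadj.symm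
    have hμK := hexch K hdisj hnadj' hcard hedge hφ
    have hcutK : cutSize G (B ∪ K) ≤ q := by
      have h1 := cutSize_union (G := G) hdisj
      have h2 := cutSize_union (G := G) hdisj₁
      rw [edges_eq_of_not_adj hvB hnadj'] at h1
      rw [edges_eq_of_not_adj hvB hnadj₁, hBK₁] at h2
      have := hC.2
      simp only [hm₀] at hcut hedge
      omega
    have hcR : (R \ K₁).card = r - K₁.card := by
      rw [Finset.card_sdiff_of_subset hK₁R, hr]
    have hLr : K₁.card ≤ r := hr ▸ Finset.card_le_card hK₁R
    have hBK : A ∪ K ∪ R \ K₁ = B ∪ K := by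
      rw [hB, Finset.union_right_comm]
    obtain ⟨l, hl1, hl2, hl3⟩ := ih (r - K₁.card) (by omega) (A ∪ K) (R \ K₁) hcR
      (Finset.mem_union_left _ hvA)
      (Finset.disjoint_union_left.2 ⟨hAR.mono_right Finset.sdiff_subset,
        (hdisj.mono_left Finset.subset_union_right).symm⟩)
      (by
        intro a ha hav x hx hadj
        rw [Finset.mem_sdiff] at hx
        rcases Finset.mem_union.1 ha with ha | ha
        · exact hnadj a ha hav x hx.1 hadj
        · exact (hmeet x hx.1).2 a ha hadj)
      ⟨hBK ▸ hμK, hBK ▸ hcutK⟩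
      (hthrift.mono fun _ h => hcl₁.sdiff.trans h)
      ((Nat.pow_le_pow_right (by norm_num) (Nat.sub_le _ _)).trans hNr)
    refine ⟨⟨K₁.card, cutSize G K₁, edges G {v} K₁, t, 4 ^ K₁.card,
      ((hood G v K).filter (· < ⟨w, hwn⟩)).card, b⟩ :: l, ?_, ?_⟩
    · rw [List.flatMap_cons, codeLength_append]
      have := Move.codeLength_toList_le (m := ⟨K₁.card, cutSize G K₁, edges G {v} K₁, t,
        4 ^ K₁.card, ((hood G v K).filter (· < ⟨w, hwn⟩)).card, b⟩) (k := K₁.card) hpos₁ le_rfl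
        hd₁ (edges_singleton_le v K₁) ht rfl
        (by have := card_filter_lt_of_mem hwh; simp only; omega) hbβ
      omega
    · rw [List.foldl_cons, hstep, nth_rank hN hwh, ← hrep]
      exact ⟨hl2, hl3⟩

end Branching

section Advice

variable {n : ℕ} {G : SimpleGraph (Fin n)} {μ : Finset (Fin n) → ℕ}
  {φ : Fin n → Finset (Fin n) → ℕ → Prop} {p q : ℕ}

/-! ### Large clusters -/

/-- The vertices equal or adjacent to `u`, without `x` and `v`. -/
noncomputable def core (G : SimpleGraph (Fin n)) (v : Fin n) (u x : ℕ) : Finset (Fin n) :=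
  open Classical in Finset.univ.filter fun i =>
    i ≠ v ∧ i.val ≠ x ∧ (i.val = u ∨ ∃ z : Fin n, z.val = u ∧ G.Adj z i)

/-- The vertices outside of `M` and other than `v` that are adjacent to at least half of `M`. -/
noncomputable def fringe (G : SimpleGraph (Fin n)) (v : Fin n) (M : Finset (Fin n)) :
    Finset (Fin n) :=
  open Classical in Finset.univ.filter fun i =>
    i ∉ M ∧ i ≠ v ∧ M.card ≤ 2 * ∑ z, ind (z ∈ M ∧ G.Adj i z)

/-- The set that consists of `v`, `M`, and those vertices of the fringe of `M` that are selected by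
`T`. -/
noncomputable def fringeSet (G : SimpleGraph (Fin n)) (v : Fin n) (M : Finset (Fin n))
    (T : ℕ → ℕ) : Finset (Fin n) :=
  Finset.univ.filter fun i => i = v ∨ i ∈ M ∨
    i ∈ fringe G v M ∧ T (∑ z, ind (z ∈ fringe G v M ∧ z < i)) ≠ 0

theorem mem_core {v u x i : Fin n} :
    i ∈ core G v u x ↔ i ≠ v ∧ i ≠ x ∧ (i = u ∨ G.Adj u i) := by
  have : (∃ z : Fin n, z.val = u.val ∧ G.Adj z i) ↔ G.Adj u i :=
    ⟨fun ⟨z, hz, h⟩ => Fin.ext hz ▸ h, fun h => ⟨u, rfl, h⟩⟩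
  simp only [core, Finset.mem_filter, Finset.mem_univ, true_and, this, ne_eq, Fin.ext_iff]

theorem mem_fringe {v i : Fin n} {M : Finset (Fin n)} :
    i ∈ fringe G v M ↔ i ∉ M ∧ i ≠ v ∧ M.card ≤ 2 * ∑ z, ind (z ∈ M ∧ G.Adj i z) := by
  simp [fringe]

/-- A large cluster with few non-neighbours at each vertex: some vertex `u` has at most one
neighbour `x` outside, so its neighbourhood is known up to few vertices, all of which are in a small
fringe. -/
theorem exists_core_fringe {v : Fin n} {C : Finset (Fin n)}
    (hthrift : Thrifty G v (C.erase v)) (hp : nondeg G C ≤ p) (hne : (C.erase v).Nonempty)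
    (hlarge : 3 * p ≤ (C.erase v).card) :
    ∃ u x : Fin n, core G v u x ⊆ C ∧ (∀ i ∈ C, i = v ∨ i ∈ core G v u x ∨
      i ∈ fringe G v (core G v u x)) ∧ (fringe G v (core G v u x)).card ≤ p + 2 := by
  classical
  set D := C.erase v with hD
  have hvD : v ∉ D := by simp [hD]
  have hDC : D ⊆ C := Finset.erase_subset _ _
  have hpos := hne.card_pos
  have hcut : cutSize G D < 2 * edges G {v} D :=
    hthrift D ⟨subset_rfl, fun _ _ _ hb _ => hb⟩ hne
  have hev := edges_singleton_le (G := G) v D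
  have hnon := nondeg_le_iff.1 hp
  -- a vertex with at most one neighbour outside of `D`
  obtain ⟨u, huD, hu⟩ : ∃ u ∈ D, ∑ w, ind (w ∉ D ∧ G.Adj u w) ≤ 1 := by
    by_contra! h
    have h1 : ∑ u ∈ D, 2 ≤ ∑ u ∈ D, ∑ w, ind (w ∉ D ∧ G.Adj u w) := Finset.sum_le_sum h
    have h2 : cutSize G D = ∑ u ∈ D, ∑ w, ind (w ∉ D ∧ G.Adj u w) := by
      rw [cutSize_eq', ← Finset.sum_subset (Finset.subset_univ D)]
      · exact Finset.sum_congr rfl fun u hu => by simp [hu]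
      · intro u _ hu; simp [hu]
    rw [Finset.sum_const, smul_eq_mul] at h1
    omega
  obtain ⟨x, hxD, hx⟩ : ∃ x, x ∉ D ∧ ∀ w, w ∉ D → G.Adj u w → w = x := by
    by_cases h : ∃ w, w ∉ D ∧ G.Adj u w
    · obtain ⟨x, hx⟩ := h
      refine ⟨x, hx.1, fun w hw hadj => ?_⟩
      rw [sum_ind, Finset.card_le_one] at hu
      exact hu w (by simp [hw, hadj]) x (by simp [hx])
    · exact ⟨v, hvD, fun w hw hadj => absurd ⟨w, hw, hadj⟩ h⟩
  have hcore : core G v u x = D.filter fun i => i = u ∨ G.Adj u i := by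
    ext i
    rw [mem_core, Finset.mem_filter]
    constructor
    · rintro ⟨_, hix, hi⟩
      refine ⟨?_, hi⟩
      rcases hi with rfl | hi
      · exact huD
      · by_contra hiD; exact hix (hx i hiD hi)
    · rintro ⟨hiD, hi⟩
      exact ⟨fun e => hvD (e ▸ hiD), fun e => hxD (e ▸ hiD), hi⟩
  set M := core G v u x with hM
  have hMD : M ⊆ D := hcore ▸ Finset.filter_subset _ _
  have hDM : (D \ M).card ≤ p := by
    refine le_trans ?_ (hnon u (hDC huD))
    rw [nonnbrs, ← sum_ind_mem]
    refine Finset.sum_le_sum fun w _ => ind_mono fun hw => ?_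
    rw [Finset.mem_sdiff, hcore, Finset.mem_filter] at hw
    exact ⟨hDC hw.1, fun e => hw.2 ⟨hw.1, .inl e.symm⟩, fun h => hw.2 ⟨hw.1, .inr h⟩⟩
  have hcardD := Finset.card_sdiff_add_card_eq_card hMD
  have hfr : ∀ i ∈ D \ M, i ∈ fringe G v M := by
    intro i hi
    rw [Finset.mem_sdiff] at hi
    refine mem_fringe.2 ⟨hi.2, fun e => hvD (e ▸ hi.1), ?_⟩
    have h1 : M.card ≤ nonnbrs G C i + ∑ z, ind (z ∈ M ∧ G.Adj i z) := by
      rw [nonnbrs, ← sum_ind_mem, ← Finset.sum_add_distrib]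
      refine Finset.sum_le_sum fun z _ => ?_
      by_cases hz : z ∈ M
      · have : i ≠ z := fun e => hi.2 (e ▸ hz)
        by_cases h3 : G.Adj i z <;> simp [hz, hDC (hMD hz), this, h3]
      · simp [hz]
    have := hnon i (hDC hi.1)
    omega
  refine ⟨u, x, hMD.trans hDC, fun i hi => ?_, ?_⟩
  · by_cases hiv : i = v
    · exact .inl hiv
    · by_cases hiM : i ∈ M
      · exact .inr (.inl hiM)
      · exact .inr (.inr (hfr i (Finset.mem_sdiff.2 ⟨Finset.mem_erase.2 ⟨hiv, hi⟩, hiM⟩)))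
  · change (fringe G v M).card ≤ p + 2
    -- each vertex of the fringe outside of `D` contributes at least `#M / 2` edges to the cut
    set E := fringe G v M \ D with hE
    have hsplit : fringe G v M ⊆ (D \ M) ∪ E := by
      intro i hi
      by_cases hiD : i ∈ D
      · exact Finset.mem_union_left _ (Finset.mem_sdiff.2 ⟨hiD, (mem_fringe.1 hi).1⟩)
      · exact Finset.mem_union_right _ (Finset.mem_sdiff.2 ⟨hi, hiD⟩)
    have h1 := (Finset.card_le_card hsplit).trans (Finset.card_union_le _ _)
    have h2 : edges G D {v} + edges G D E ≤ cutSize G D := by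
      rw [cutSize_eq, ← edges_union_right]
      · refine edges_mono subset_rfl fun i hi => ?_
        rcases Finset.mem_union.1 hi with hi | hi
        · rw [Finset.mem_singleton] at hi
          simpa [hi] using hvD
        · simpa using (Finset.mem_sdiff.1 hi).2
      · rw [Finset.disjoint_singleton_left]
        exact fun hh => (mem_fringe.1 (Finset.mem_sdiff.1 hh).1).2.1 rfl
    have h3 : E.card * M.card ≤ 2 * edges G D E := by
      rw [edges_comm, ← smul_eq_mul, ← Finset.sum_const, edges,
        ← Finset.sum_subset (Finset.subset_univ E) (fun i _ hi => by simp [hi]), Finset.mul_sum]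
      refine Finset.sum_le_sum fun i hi => ?_
      refine (mem_fringe.1 (Finset.mem_sdiff.1 hi).1).2.2.trans (Nat.mul_le_mul_left 2 ?_)
      exact Finset.sum_le_sum fun z _ => ind_mono fun hz => ⟨hi, hMD hz.1, hz.2⟩
    rw [edges_comm] at h2
    have h4 : E.card ≤ 2 := by
      by_contra! h
      have := Nat.mul_le_mul_right M.card h
      omega
    omega

/-- Advice of length `O(p + log n)` describes a large cluster. -/
theorem exists_fringe_advice {v : Fin n} {C : Finset (Fin n)} (hv : v ∈ C)
    (hthrift : Thrifty G v (C.erase v)) (hp : nondeg G C ≤ p) (hne : (C.erase v).Nonempty)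
    (hlarge : 3 * p ≤ (C.erase v).card) :
    ∃ xs : List ℕ, codeLength xs ≤ 2 * n.size + 2 * p + 6 ∧
      fringeSet G v (core G v (xs.getD 0 0) (xs.getD 1 0)) (fun i => xs.getD (i + 2) 0) = C := by
  classical
  obtain ⟨u, x, h1, h2, h3⟩ := exists_core_fringe hthrift hp hne hlarge
  set W := fringe G v (core G v u x) with hW
  let rank : Fin n → ℕ := fun i => (W.filter (· < i)).card
  have hrank : ∀ i ∈ W, ∀ j ∈ W, rank i = rank j → i = j := by
    have hlt : ∀ i ∈ W, ∀ j, i < j → rank i < rank j := by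
      intro i hi j hij
      refine Finset.card_lt_card ((Finset.ssubset_iff_of_subset ?_).2 ⟨i, by simp [hi, hij], by simp⟩)
      exact Finset.monotone_filter_right _ fun y _ hy => lt_trans hy hij
    intro i hi j hj hij
    by_contra hne
    rcases lt_or_gt_of_ne hne with h | h
    · exact absurd hij (hlt i hi j h).ne
    · exact absurd hij (hlt j hj i h).ne'
  let f : ℕ → ℕ := fun k => if ∃ i ∈ W, i ∈ C ∧ rank i = k then 1 else 0
  refine ⟨u.val :: x.val :: (List.range W.card).map f, ?_, ?_⟩
  · have hf : ∀ k, (f k).size ≤ 1 := by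
      intro k
      by_cases h : ∃ i ∈ W, i ∈ C ∧ rank i = k <;> simp [f, h]
    have hsum : codeLength ((List.range W.card).map f) ≤ 2 * W.card := by
      rw [codeLength, List.map_map]
      have := List.sum_le_card_nsmul ((List.range W.card).map ((fun x => x.size + 1) ∘ f)) 2 (by
        intro k hk
        obtain ⟨j, _, rfl⟩ := List.mem_map.1 hk
        have := hf j
        simp only [Function.comp_apply]
        omega)
      simpa [mul_comm] using this
    have hu := Nat.size_le_size u.isLt.le
    have hx := Nat.size_le_size x.isLt.le
    have : codeLength (u.val :: x.val :: (List.range W.card).map f) =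
        u.val.size + 1 + (x.val.size + 1 + codeLength ((List.range W.card).map f)) := by
      simp [codeLength]
    omega
  · ext i
    simp only [fringeSet, List.getD_cons_zero, List.getD_cons_succ, Finset.mem_filter,
      Finset.mem_univ, true_and, ← hW]
    have hsum : ∑ z, ind (z ∈ W ∧ z < i) = rank i := by
      rw [sum_ind]
      congr 1
      ext z; simp
    rw [hsum]
    have hget : i ∈ W → (((List.range W.card).map f).getD (rank i) 0 ≠ 0 ↔ i ∈ C) := by
      intro hi
      have hlt : rank i < W.card := card_filter_lt_of_mem hi
      rw [List.getD_eq_getElem _ _ (by simpa using hlt)]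
      simp only [List.getElem_map, List.getElem_range, f]
      by_cases hiC : i ∈ C
      · have : ∃ j ∈ W, j ∈ C ∧ rank j = rank i := ⟨i, hi, hiC, rfl⟩
        simp [this, hiC]
      · have : ¬∃ j ∈ W, j ∈ C ∧ rank j = rank i := by
          rintro ⟨j, hj, hjC, e⟩
          exact hiC (hrank j hj i hi e ▸ hjC)
        simp [this, hiC]
    constructor
    · rintro (rfl | hi | ⟨hi, hT⟩)
      · exact hv
      · exact h1 hi
      · exact (hget hi).1 hT
    · intro hi
      rcases h2 i hi with h | h | h
      · exact .inl h
      · exact .inr (.inl h)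
      · exact .inr (.inr ⟨h, (hget h).2 hi⟩)

/-! ### Advice as a number -/

/-- One step of reading a number in base 4 as a sequence of numbers: the digits `0` and `1` extend
the current entry of the sequence by a bit, the other digits move on to the next entry. The state
consists of the unread digits, the position of the current entry, and the sequence. -/
def tapeStep (N : ℕ) (st : ℕ × ℕ × (ℕ → ℕ)) : ℕ × ℕ × (ℕ → ℕ) :=
  (min N (st.1 / 4),
    if st.1 - 4 * min N (st.1 / 4) < 2 then st.2.1 else st.2.1 + 1,
    fun i => if i < N then
      if i = st.2.1 ∧ st.1 - 4 * min N (st.1 / 4) < 2 then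
        2 * st.2.2 i + (st.1 - 4 * min N (st.1 / 4)) else st.2.2 i
      else st.2.2 i)

/-- The sequence of numbers encoded by `a`. -/
def tape (N a : ℕ) : ℕ → ℕ := ((tapeStep N)^[N] (a, 0, fun _ => 0)).2.2

theorem tapeStep_bit {N a b k : ℕ} {T : ℕ → ℕ} (hb : b < 2) (ha : a ≤ N) (hk : k < N) :
    tapeStep N (4 * a + b, k, T) = (a, k, Function.update T k (2 * T k + b)) := by
  have h1 : min N ((4 * a + b) / 4) = a := by omega
  have h2 : 4 * a + b - 4 * a = b := by omega
  simp only [tapeStep, h1, h2, hb, if_true, and_true]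
  congr 2
  funext i
  by_cases h : i = k
  · subst h; simp [hk]
  · simp [h]

theorem tapeStep_sep {N a k : ℕ} {T : ℕ → ℕ} (ha : a ≤ N) :
    tapeStep N (4 * a + 2, k, T) = (a, k + 1, T) := by
  have h1 : min N ((4 * a + 2) / 4) = a := by omega
  have h2 : 4 * a + 2 - 4 * a = 2 := by omega
  simp [tapeStep, h1, h2]

/-- The digits that write `x` into an entry of the sequence that is still `0`. -/
theorem exists_tape_bits (N : ℕ) (x : ℕ) : ∀ a, 4 ^ x.size * (a + 1) ≤ N →
    ∃ a', a' < 4 ^ x.size * (a + 1) ∧ ∀ k (T : ℕ → ℕ), k < N → T k = 0 →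
      (tapeStep N)^[x.size] (a', k, T) = (a, k, Function.update T k x) := by
  induction x using Nat.binaryRec' with
  | zero =>
    intro a _
    refine ⟨a, by simp, fun k T _ hT => ?_⟩
    have : Function.update T k 0 = T := by rw [← hT, Function.update_eq_self]
    simp [this]
  | bit b x hx ih =>
    intro a ha
    have hne : Nat.bit b x ≠ 0 := by
      intro h0
      rw [Nat.bit_eq_zero_iff] at h0
      have := hx h0.1
      simp [this] at h0
    have hsize : (Nat.bit b x).size = x.size + 1 := Nat.size_bit hne
    rw [hsize, pow_succ] at ha ⊢
    have hb : b.toNat < 2 := by cases b <;> simp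
    have hle : 4 ^ x.size * (4 * a + b.toNat + 1) ≤ 4 ^ x.size * 4 * (a + 1) := by
      rw [mul_assoc]
      exact Nat.mul_le_mul_left _ (by omega)
    obtain ⟨a', ha', hrun⟩ := ih (4 * a + b.toNat) (hle.trans ha)
    refine ⟨a', ha'.trans_le hle, fun k T hk hT => ?_⟩
    have haN : a ≤ N := by
      refine le_trans ?_ ha
      rw [mul_assoc]
      have : 0 < 4 ^ x.size := by positivity
      nlinarith
    rw [Function.iterate_succ_apply', hrun k T hk hT, tapeStep_bit hb haN hk]
    simp [Nat.bit_val]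

theorem exists_tape_iterate (N : ℕ) (xs : List ℕ) : 4 ^ codeLength xs ≤ N →
    ∃ a < 4 ^ codeLength xs, ∀ m k (T : ℕ → ℕ), codeLength xs ≤ m → k + codeLength xs < N →
      (∀ i ≥ k, T i = 0) → ((tapeStep N)^[m] (a, k, T)).2.2 =
        fun i => if i < k then T i else xs.getD (i - k) 0 := by
  induction xs with
  | nil =>
    intro _
    refine ⟨0, by positivity, fun m k T _ hk hT => ?_⟩
    have hfix : tapeStep N (0, k, T) = (0, k, T) := by
      have h := tapeStep_bit (N := N) (a := 0) (b := 0) (k := k) (T := T) two_pos (Nat.zero_le _)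
        (by omega)
      simp only [mul_zero, add_zero, hT k le_rfl] at h
      rw [h, ← hT k le_rfl, Function.update_eq_self]
    rw [Function.iterate_fixed hfix]
    funext i
    by_cases h : i < k
    · simp [h]
    · simp [h, hT i (by omega)]
  | cons x xs ih =>
    intro hN
    have hlen : codeLength (x :: xs) = (x.size + 1) + codeLength xs := by simp [codeLength]
    rw [hlen, pow_add] at hN ⊢
    obtain ⟨a, ha, hrun⟩ := ih ((Nat.le_mul_of_pos_left _ (by positivity)).trans hN)
    have hle : 4 ^ x.size * (4 * a + 2 + 1) ≤ 4 ^ (x.size + 1) * 4 ^ codeLength xs := by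
      rw [pow_succ, mul_assoc]
      exact Nat.mul_le_mul_left _ (by omega)
    obtain ⟨a', ha', hbits⟩ := exists_tape_bits N x (4 * a + 2) (hle.trans hN)
    refine ⟨a', ha'.trans_le hle, fun m k T hm hk hT => ?_⟩
    obtain ⟨m', rfl⟩ : ∃ m', m = m' + 1 + x.size := ⟨m - 1 - x.size, by omega⟩
    have haN : a ≤ N := by
      have : 4 ^ codeLength xs ≤ 4 ^ (x.size + 1) * 4 ^ codeLength xs :=
        Nat.le_mul_of_pos_left _ (by positivity)
      omega
    rw [Function.iterate_add_apply, hbits k T (by omega) (hT k le_rfl),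
      Function.iterate_succ_apply, tapeStep_sep haN, hrun m' (k + 1) _ (by omega) (by omega)]
    · funext i
      rcases lt_trichotomy i k with h | rfl | h
      · simp [h, show i < k + 1 by omega, h.ne]
      · simp
      · obtain ⟨j, rfl⟩ : ∃ j, i = k + 1 + j := ⟨i - (k + 1), by omega⟩
        simp [show ¬k + 1 + j < k by omega, show ¬k + 1 + j ≤ k by omega, show k + 1 + j - k = j + 1 by omega]
    · intro i hi
      rw [Function.update_of_ne (by omega)]
      exact hT i (by omega)

/-- Every list of numbers is encoded by some number. -/
theorem exists_tape {N : ℕ} {xs : List ℕ} (h : 4 ^ codeLength xs ≤ N) :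
    ∃ a < N, tape N a = fun i => xs.getD i 0 := by
  obtain ⟨a, ha, hrun⟩ := exists_tape_iterate N xs h
  have hlt : codeLength xs < N := (Nat.lt_pow_self (by norm_num)).trans_le h
  refine ⟨a, ha.trans_le h, ?_⟩
  rw [tape, hrun N 0 _ hlt.le (by simpa using hlt) (fun _ _ => rfl)]
  simp

/-- The advice for round `j` of the assembly. -/
def Move.ofTape (T : ℕ → ℕ) (j : ℕ) : Move :=
  ⟨T (7 * j), T (7 * j + 1), T (7 * j + 2), T (7 * j + 3), T (7 * j + 4), T (7 * j + 5),
    T (7 * j + 6)⟩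

/-- The set assembled according to the advice `T`. -/
noncomputable def assemble (G : SimpleGraph (Fin n)) (φ : Fin n → Finset (Fin n) → ℕ → Prop)
    (N : ℕ) (v : Fin n) (T : ℕ → ℕ) : Finset (Fin n) :=
  (List.range N).foldl (fun A j => moveStep G φ N v A (Move.ofTape T j)) {v}

/-- Beyond the end of the list `l` the advice is `0`, and the assembly does nothing any more. -/
theorem foldl_range_moves (N : ℕ) (v : Fin n) (l : List Move) : ∀ (k : ℕ) (T : ℕ → ℕ)
    (A : Finset (Fin n)), l.length ≤ k → (T = fun i => (l.flatMap Move.toList).getD i 0) →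
    (List.range k).foldl (fun A j => moveStep G φ N v A (Move.ofTape T j)) A =
      l.foldl (moveStep G φ N v) A := by
  induction l with
  | nil =>
    rintro k T A - rfl
    have : ∀ j, moveStep G φ N v A (Move.ofTape (fun _ => 0) j) = A := fun j => by
      simp [moveStep, Move.ofTape]
    simp only [List.flatMap_nil, List.getD_nil, List.foldl_nil]
    induction k with
    | zero => rfl
    | succ k ih => rw [List.range_succ, List.foldl_append, ih]; exact this k
  | cons m l ih =>
    rintro k T A hk rfl
    obtain ⟨k, rfl⟩ : ∃ k', k = k' + 1 := ⟨k - 1, by simp at hk; omega⟩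
    rw [List.range_succ_eq_map, List.foldl_cons, List.foldl_map, List.foldl_cons]
    have h0 : Move.ofTape (fun i => ((m :: l).flatMap Move.toList).getD i 0) 0 = m := by
      simp [Move.ofTape, Move.toList]
    have h1 : ∀ j, Move.ofTape (fun i => ((m :: l).flatMap Move.toList).getD i 0) (j + 1) =
        Move.ofTape (fun i => (l.flatMap Move.toList).getD i 0) j := by
      intro j
      have h2 : ∀ i, ((m :: l).flatMap Move.toList).getD (i + 7) 0 =
          (l.flatMap Move.toList).getD i 0 := by
        intro i
        simp [Move.toList]
      simp only [Move.ofTape, show 7 * (j + 1) = 7 * j + 7 by ring, h2,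
        show ∀ c, 7 * j + 7 + c = 7 * j + c + 7 by intro c; ring]
    simp only [h0, Nat.succ_eq_add_one, h1]
    exact ih k _ _ (by simpa using hk) rfl

/-- If `v` is in a cluster, then some number below `N` encodes advice that leads to a cluster
containing `v`. -/
theorem exists_advice (hμ : IsLocal G μ φ) {N : ℕ} (hN : n ≤ N)
    (hNp : 4 ^ (2 * n.size + 62 * p + 6) ≤ N) {v : Fin n} (h : ∃ C, v ∈ C ∧ IsCluster G μ p q C) :
    ∃ a < N, (v ∈ assemble G φ N v (tape N a) ∧
        IsCluster G μ p q (assemble G φ N v (tape N a))) ∨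
      (v ∈ fringeSet G v (core G v (tape N a 0) (tape N a 1)) (fun i => tape N a (i + 2)) ∧
        IsCluster G μ p q
          (fringeSet G v (core G v (tape N a 0) (tape N a 1)) (fun i => tape N a (i + 2)))) := by
  classical
  obtain ⟨C, hv, hC, hthrift⟩ := exists_thrifty_cluster hμ h
  have hpow : ∀ k ≤ 2 * n.size + 62 * p + 6, 4 ^ k ≤ N := fun k hk =>
    (Nat.pow_le_pow_right (by norm_num) hk).trans hNp
  by_cases hsmall : (C.erase v).card ≤ 3 * p
  · have hins : {v} ∪ C.erase v = C := by rw [← Finset.insert_eq, Finset.insert_erase hv]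
    obtain ⟨l, hl1, hl2⟩ := exists_moves hμ hN (C.erase v).card {v} (C.erase v) rfl (by simp)
      (by simp) (by simp) (hins.symm ▸ hC) hthrift (hpow _ (by omega))
    obtain ⟨a, ha, hT⟩ := exists_tape (hpow (codeLength (l.flatMap Move.toList)) (by omega))
    refine ⟨a, ha, .inl ?_⟩
    have hlen : l.length ≤ codeLength (l.flatMap Move.toList) := by
      clear hl1 hl2 hT
      induction l with
      | nil => simp
      | cons m l ih =>
        rw [List.flatMap_cons, codeLength_append]
        have : 1 ≤ codeLength m.toList := by simp [codeLength, Move.toList]; omega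
        simp only [List.length_cons]
        omega
    have hlt : codeLength (l.flatMap Move.toList) < N :=
      (Nat.lt_pow_self (by norm_num : 1 < 4)).trans_le (hpow _ (by omega))
    rw [assemble, foldl_range_moves N v l N _ {v} (by omega) hT]
    exact hl2
  · have hnd : nondeg G C ≤ p := by
      rcases hμ.card_or_nondeg hC.1 with h1 | h1
      · have := Finset.card_erase_le (a := v) (s := C)
        omega
      · exact h1
    obtain ⟨xs, hxs, he⟩ := exists_fringe_advice hv hthrift hnd (Finset.card_pos.1 (by omega))
      (by omega)
    obtain ⟨a, ha, hT⟩ := exists_tape (hpow (codeLength xs) (by omega))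
    exact ⟨a, ha, .inr (by simp only [hT, he]; exact ⟨hv, hC⟩)⟩

end Advice

/-! ### Terms for sets of vertices -/

namespace Term

/-- A term is regarded as true if its value is not `0`. -/
def Holds (N : ℕ) (t : Term) (s : State) : Prop := t.eval N s ≠ 0

/-- Negation. -/
def not (t : Term) : Term := .ite t (.const 0) (.const 1)

/-- Conjunction. -/
def and (t u : Term) : Term := .ite t u (.const 0)

/-- Disjunction. -/
def or (t u : Term) : Term := .ite t (.const 1) u

/-- Implication. -/
def imp (t u : Term) : Term := .ite t u (.const 1)

/-- The test `t ≤ u`. -/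
def le (t u : Term) : Term := not (.sub t u)

/-- The test `t < u`. -/
def lt (t u : Term) : Term := .sub u t

/-- The test `t = u`. -/
def eq (t u : Term) : Term := and (le t u) (le u t)

/-- The truth value, as `0` or `1`. -/
def bool (t : Term) : Term := .ite t (.const 1) (.const 0)

/-- The sum over all vertices; variable `0` holds the number of vertices. -/
def sumV (x : ℕ) (t : Term) : Term := .sum x (.ite (lt (.var x) (.var 0)) t (.const 0))

/-- The number of vertices that satisfy a test. -/
def count (x : ℕ) (t : Term) : Term := sumV x (bool t)

/-- Existence of a vertex that satisfies a test. -/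
def ex (x : ℕ) (t : Term) : Term := count x t

/-- The test that all vertices satisfy a test. -/
def all (x : ℕ) (t : Term) : Term := not (ex x (not t))

/-- The product of the variable `x` with the number of vertices. (The programming language has no
multiplication.) -/
def mulN (x : ℕ) : Term := .sum 39 (.ite (lt (.var 39) (.var x)) (.var 0) (.const 0))

/-- The test that the vertices in the variables `x` and `y` are adjacent. -/
def adj (x y : ℕ) : Term := .cell 0 (.add (mulN x) (.var y))

/-- The test that the vertex in the variable `x` belongs to the set in the array `a`. -/
def mem (x a : ℕ) : Term := .cell a (.var x)

/-- The `k`-th vertex that satisfies a test in the variable `21`. -/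
def nthVertex (t k : Term) : Term :=
  .sum 20 (bool (le (count 21 (and (le (.var 21) (.var 20)) t)) k))

/-- The size of the cut of the set in the array `a`. -/
def cut (a : ℕ) : Term := sumV 20 (count 21 (and (mem 20 a) (and (not (mem 21 a)) (adj 20 21))))

end Term

/-- The set of vertices held by the array `a`. -/
def State.set (n : ℕ) (s : State) (a : ℕ) : Finset (Fin n) :=
  Finset.univ.filter fun u => s.arr a u ≠ 0

@[simp] theorem State.mem_set {n : ℕ} {s : State} {a : ℕ} {u : Fin n} :
    u ∈ s.set n a ↔ s.arr a u ≠ 0 := by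
  simp [State.set]

/-- The variable `0` holds the number of vertices and the array `0` the adjacency matrix of `G`. -/
structure State.HasGraph {n : ℕ} (s : State) (G : SimpleGraph (Fin n)) : Prop where
  var : s.var 0 = n
  adj : ∀ u w : Fin n, s.arr 0 (u * n + w) ≠ 0 ↔ G.Adj u w

theorem State.HasGraph.congr {n : ℕ} {s s' : State} {G : SimpleGraph (Fin n)} (h : s.HasGraph G)
    (h0 : s'.var 0 = s.var 0) (h1 : s'.arr 0 = s.arr 0) : s'.HasGraph G :=
  ⟨h0 ▸ h.var, by rw [h1]; exact h.adj⟩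

theorem State.HasGraph.setVar {n : ℕ} {s : State} {G : SimpleGraph (Fin n)} (h : s.HasGraph G)
    {x k : ℕ} (hx : 0 ≠ x) : (s.setVar x k).HasGraph G :=
  h.congr (by simp [hx]) rfl

section TermLemmas

variable {N n : ℕ} {G : SimpleGraph (Fin n)} {s : State} {t u : Term}

open Term

@[simp] theorem Term.holds_not : (not t).Holds N s ↔ ¬t.Holds N s := by
  by_cases h : t.eval N s = 0 <;> simp [Holds, Term.not, eval, h]

@[simp] theorem Term.holds_and : (and t u).Holds N s ↔ t.Holds N s ∧ u.Holds N s := by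
  by_cases h : t.eval N s = 0 <;> simp [Holds, Term.and, eval, h]

@[simp] theorem Term.holds_or : (or t u).Holds N s ↔ t.Holds N s ∨ u.Holds N s := by
  by_cases h : t.eval N s = 0 <;> simp [Holds, Term.or, eval, h]

@[simp] theorem Term.holds_imp : (imp t u).Holds N s ↔ (t.Holds N s → u.Holds N s) := by
  by_cases h : t.eval N s = 0 <;> simp [Holds, Term.imp, eval, h]

@[simp] theorem Term.holds_le : (le t u).Holds N s ↔ t.eval N s ≤ u.eval N s := by
  rw [le, holds_not, Holds, eval]; omega

@[simp] theorem Term.holds_lt : (lt t u).Holds N s ↔ t.eval N s < u.eval N s := by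
  rw [lt, Holds, eval]; omega

@[simp] theorem Term.holds_sub : (sub t u).Holds N s ↔ ¬t.eval N s - u.eval N s = 0 := Iff.rfl

@[simp] theorem Term.holds_eq : (eq t u).Holds N s ↔ t.eval N s = u.eval N s := by
  rw [eq, holds_and, holds_le, holds_le]; omega

@[simp] theorem Term.holds_const {k : ℕ} : (const k).Holds N s ↔ k ≠ 0 := Iff.rfl

@[simp] theorem Term.holds_mem {x a : ℕ} : (mem x a).Holds N s ↔ s.arr a (s.var x) ≠ 0 := Iff.rfl

@[simp] theorem Term.holds_cell {a : ℕ} : (cell a t).Holds N s ↔ s.arr a (t.eval N s) ≠ 0 := Iff.rfl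

@[simp] theorem Term.eval_const {k : ℕ} : (const k).eval N s = k := rfl

@[simp] theorem Term.eval_var {x : ℕ} : (var x).eval N s = s.var x := rfl

@[simp] theorem Term.eval_cell {a : ℕ} : (cell a t).eval N s = s.arr a (t.eval N s) := rfl

@[simp] theorem Term.eval_mem {x a : ℕ} : (mem x a).eval N s = s.arr a (s.var x) := rfl

@[simp] theorem Term.eval_add : (add t u).eval N s = t.eval N s + u.eval N s := rfl

@[simp] theorem Term.eval_sub : (sub t u).eval N s = t.eval N s - u.eval N s := rfl

@[simp] theorem Term.eval_bool : (bool t).eval N s = ind (t.Holds N s) := by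
  by_cases h : t.eval N s = 0 <;> simp [Holds, bool, eval, h]

theorem Term.eval_ite {c : Term} : (ite c t u).eval N s =
    open Classical in if c.Holds N s then t.eval N s else u.eval N s := by
  by_cases h : c.eval N s = 0 <;> simp [Holds, eval, h]

theorem sum_range_ite_lt {m : ℕ} (h : m ≤ N) (f : ℕ → ℕ) :
    ∑ i ∈ Finset.range N, (if i < m then f i else 0) = ∑ i : Fin m, f i := by
  rw [← Finset.sum_filter, Fin.sum_univ_eq_sum_range]
  congr 1
  ext i
  simp only [Finset.mem_filter, Finset.mem_range]
  omega

theorem Term.eval_sumV (hN : n ≤ N) (hs : s.var 0 = n) {x : ℕ} (hx : 0 ≠ x) :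
    (sumV x t).eval N s = ∑ i : Fin n, t.eval N (s.setVar x i) := by
  rw [sumV, eval, ← sum_range_ite_lt hN fun i => t.eval N (s.setVar x i)]
  refine Finset.sum_congr rfl fun i _ => ?_
  rw [eval_ite]
  simp [hx, hs]

theorem Term.eval_count (hN : n ≤ N) (hs : s.var 0 = n) {x : ℕ} (hx : 0 ≠ x) :
    (count x t).eval N s = ∑ i : Fin n, ind (t.Holds N (s.setVar x i)) := by
  rw [count, eval_sumV hN hs hx]
  simp

theorem Term.holds_ex (hN : n ≤ N) (hs : s.var 0 = n) {x : ℕ} (hx : 0 ≠ x) :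
    (ex x t).Holds N s ↔ ∃ i : Fin n, t.Holds N (s.setVar x i) := by
  rw [ex, Holds, eval_count hN hs hx, ne_eq, Finset.sum_eq_zero_iff]
  simp only [Finset.mem_univ, true_imp_iff, not_forall, ← ne_eq, ind_ne_zero]

theorem Term.holds_all (hN : n ≤ N) (hs : s.var 0 = n) {x : ℕ} (hx : 0 ≠ x) :
    (all x t).Holds N s ↔ ∀ i : Fin n, t.Holds N (s.setVar x i) := by
  rw [all, holds_not, holds_ex hN hs hx]
  simp

theorem Term.eval_mulN {x k : ℕ} (hx : x ≠ 39) (hk : k ≤ N) (hs : s.var 0 = n) (hsx : s.var x = k) :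
    (mulN x).eval N s = k * n := by
  have := sum_range_ite_lt hk fun _ => n
  rw [mulN, eval, ← smul_eq_mul, ← Fintype.card_fin k, ← Finset.card_univ, ← Finset.sum_const,
    ← this]
  refine Finset.sum_congr rfl fun i _ => ?_
  rw [eval_ite]
  simp [hx, hs, hsx]

theorem Term.holds_adj (hN : n ≤ N) (hs : s.HasGraph G) {x y : ℕ} (hx : x ≠ 39) {u w : Fin n}
    (hu : s.var x = u) (hw : s.var y = w) : (adj x y).Holds N s ↔ G.Adj u w := by
  rw [← hs.adj, adj, Holds, eval_cell, eval_add,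
    eval_mulN hx (u.isLt.le.trans hN) hs.var hu, eval_var, hw]

theorem Term.eval_cut (hN : n ≤ N) (hs : s.HasGraph G) (a : ℕ) :
    (cut a).eval N s = cutSize G (s.set n a) := by
  rw [cut, eval_sumV hN hs.var (by decide), cutSize_eq']
  refine Finset.sum_congr rfl fun u _ => ?_
  rw [eval_count hN (hs.setVar (by decide)).var (by decide)]
  refine Finset.sum_congr rfl fun w _ => congrArg ind (propext ?_)
  rw [holds_and, holds_and, holds_not,
    holds_adj hN ((hs.setVar (by decide)).setVar (by decide)) (by decide) (u := u) (w := w)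
      (by simp) (by simp)]
  simp

theorem Term.eval_nthVertex (hN : n ≤ N) (hs : s.var 0 = n) {F : Finset (Fin n)}
    (ht : ∀ (i : ℕ) (z : Fin n), t.Holds N ((s.setVar 20 i).setVar 21 z) ↔ z ∈ F) {k : ℕ}
    (hk : ∀ i, u.eval N (s.setVar 20 i) = k) : (nthVertex t u).eval N s = nth N F k := by
  rw [nthVertex, eval, nth]
  refine Finset.sum_congr rfl fun i _ => ?_
  rw [eval_bool, holds_le, eval_count (n := n) hN (by simp [hs]) (by decide), hk]
  simp [ht]

/-- Division as a bounded sum; the quotient is cut off at `N`. -/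
theorem sum_range_ind_le {c : ℕ} (hc : 0 < c) (b : ℕ) :
    ∑ i ∈ Finset.range N, ind (c * i + c ≤ b) = min N (b / c) := by
  have h : ∀ i ∈ Finset.range N, ind (c * i + c ≤ b) = if i < b / c then 1 else 0 := by
    intro i _
    have : i < b / c ↔ c * i + c ≤ b := by
      rw [← Nat.succ_le_iff, Nat.le_div_iff_mul_le hc, Nat.succ_mul, mul_comm]
    by_cases h : i < b / c
    · simp [h, this.1 h]
    · simp [h, mt this.2 h]
  rw [Finset.sum_congr rfl h, Finset.sum_boole]
  have : (Finset.range N).filter (fun i => i < b / c) = Finset.range (min N (b / c)) := by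
    ext i; simp
  simp [this]

end TermLemmas

/-! ### Reasoning about commands -/

/-- The command does not assign to the variable `y`. -/
def Cmd.keepsVar (y : ℕ) : Cmd → Bool
  | .assign x _ => decide (y ≠ x)
  | .fill _ _ _ => true
  | .seq c d => c.keepsVar y && d.keepsVar y
  | .ite _ c d => c.keepsVar y && d.keepsVar y
  | .skip => true
  | .loop x c => decide (y ≠ x) && c.keepsVar y

/-- The command does not write to the array `b`. -/
def Cmd.keepsArr (b : ℕ) : Cmd → Bool
  | .assign _ _ => true
  | .fill a _ _ => decide (b ≠ a)
  | .seq c d => c.keepsArr b && d.keepsArr b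
  | .ite _ c d => c.keepsArr b && d.keepsArr b
  | .skip => true
  | .loop _ c => c.keepsArr b

theorem foldl_invariant {σ α : Type*} {f : σ → α → σ} (P : σ → Prop) {l : List α}
    (h : ∀ s, ∀ i ∈ l, P s → P (f s i)) (s : σ) (hs : P s) : P (l.foldl f s) := by
  induction l generalizing s with
  | nil => exact hs
  | cons i l ih =>
    exact ih (fun s j hj => h s j (List.mem_cons_of_mem _ hj)) _ (h s i List.mem_cons_self hs)

/-- A fold that preserves `P` is simulated by a fold on abstract values. -/
theorem foldl_simulation {σ α β : Type*} {f : σ → α → σ} {g : β → α → β} (abs : σ → β)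
    (P : σ → Prop) {l : List α}
    (h : ∀ s, ∀ i ∈ l, P s → P (f s i) ∧ abs (f s i) = g (abs s) i) (s : σ) (hs : P s) :
    P (l.foldl f s) ∧ abs (l.foldl f s) = l.foldl g (abs s) := by
  induction l generalizing s with
  | nil => exact ⟨hs, rfl⟩
  | cons i l ih =>
    have h1 := h s i List.mem_cons_self hs
    have h2 := ih (fun s j hj => h s j (List.mem_cons_of_mem _ hj)) _ h1.1
    rw [h1.2] at h2
    exact h2

section CmdLemmas

variable {N n : ℕ} {G : SimpleGraph (Fin n)} {s : State}

theorem Cmd.run_var {c : Cmd} {y : ℕ} (h : c.keepsVar y = true) :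
    (c.run N s).var y = s.var y := by
  induction c generalizing s with
  | assign x t => simp only [keepsVar, decide_eq_true_eq] at h; simp [run, h]
  | fill a x t => rfl
  | seq c d ihc ihd =>
    simp only [keepsVar, Bool.and_eq_true] at h
    rw [run, ihd h.2, ihc h.1]
  | ite t c d ihc ihd =>
    simp only [keepsVar, Bool.and_eq_true] at h
    rw [run]
    split_ifs
    · exact ihc h.1
    · exact ihd h.2
  | skip => rfl
  | loop x c ih =>
    simp only [keepsVar, Bool.and_eq_true, decide_eq_true_eq] at h
    exact foldl_invariant (f := fun s' i => c.run N (s'.setVar x i)) (l := List.range N)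
      (fun s' => s'.var y = s.var y)
      (fun s' i _ hs => by rw [ih h.2]; simp [h.1, hs]) s rfl

theorem Cmd.run_arr {c : Cmd} {b : ℕ} (h : c.keepsArr b = true) :
    (c.run N s).arr b = s.arr b := by
  induction c generalizing s with
  | assign x t => rfl
  | fill a x t => simp only [keepsArr, decide_eq_true_eq] at h; simp [run, h]
  | seq c d ihc ihd =>
    simp only [keepsArr, Bool.and_eq_true] at h
    rw [run, ihd h.2, ihc h.1]
  | ite t c d ihc ihd =>
    simp only [keepsArr, Bool.and_eq_true] at h
    rw [run]
    split_ifs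
    · exact ihc h.1
    · exact ihd h.2
  | skip => rfl
  | loop x c ih =>
    exact foldl_invariant (f := fun s' i => c.run N (s'.setVar x i)) (l := List.range N)
      (fun s' => s'.arr b = s.arr b)
      (fun s' i _ hs => by rw [ih h]; simp [hs]) s rfl

/-- Commands do not write to cells beyond the common bound. -/
theorem Cmd.run_arr_of_le {c : Cmd} {b i : ℕ} (h : N ≤ i) :
    (c.run N s).arr b i = s.arr b i := by
  induction c generalizing s with
  | assign x t => rfl
  | fill a x t => by_cases hb : b = a <;> simp [run, hb, not_lt.2 h]
  | seq c d ihc ihd => rw [run, ihd, ihc]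
  | ite t c d ihc ihd =>
    rw [run]
    split_ifs
    · exact ihc
    · exact ihd
  | skip => rfl
  | loop x c ih =>
    exact foldl_invariant (f := fun s' i => c.run N (s'.setVar x i)) (l := List.range N)
      (fun s' => s'.arr b i = s.arr b i)
      (fun s' i _ hs => by rw [ih]; simp [hs]) s rfl

theorem State.set_congr {s' : State} {a : ℕ} (h : s'.arr a = s.arr a) : s'.set n a = s.set n a := by
  simp only [State.set, h]

theorem Cmd.run_set {c : Cmd} {b : ℕ} (h : c.keepsArr b = true) :
    (c.run N s).set n b = s.set n b := State.set_congr (run_arr h)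

theorem Cmd.run_hasGraph {c : Cmd} (h0 : c.keepsVar 0 = true) (h1 : c.keepsArr 0 = true)
    (hs : s.HasGraph G) : (c.run N s).HasGraph G := hs.congr (run_var h0) (run_arr h1)

/-- Simulation of a loop by a function on abstract values. -/
theorem Cmd.loop_simulation {β : Type*} (x : ℕ) (c : Cmd) (abs : State → β) (g : β → ℕ → β)
    (P : State → Prop) (h : ∀ s, ∀ i < N, P s →
      P (c.run N (s.setVar x i)) ∧ abs (c.run N (s.setVar x i)) = g (abs s) i) (hs : P s) :
    P ((Cmd.loop x c).run N s) ∧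
      abs ((Cmd.loop x c).run N s) = (List.range N).foldl g (abs s) :=
  foldl_simulation abs P (fun s i hi hs => h s i (List.mem_range.1 hi) hs) s hs

theorem Cmd.loop_invariant (x : ℕ) (c : Cmd) (P : State → Prop)
    (h : ∀ s, ∀ i < N, P s → P (c.run N (s.setVar x i))) (hs : P s) :
    P ((Cmd.loop x c).run N s) :=
  foldl_invariant P (fun s i hi hs => h s i (List.mem_range.1 hi) hs) s hs

theorem Cmd.run_ite {t : Term} {c d : Cmd} : (Cmd.ite t c d).run N s =
    open Classical in if t.Holds N s then c.run N s else d.run N s := by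
  by_cases h : t.eval N s = 0 <;> simp [Term.Holds, run, h]

theorem Cmd.mem_run_fill (hN : n ≤ N) {a x : ℕ} {t : Term} {u : Fin n} :
    u ∈ ((Cmd.fill a x t).run N s).set n a ↔ t.Holds N (s.setVar x u) := by
  simp [run, u.isLt.trans_le hN, Term.Holds]

end CmdLemmas

section Simp

variable {N n : ℕ} {s : State}

@[simp] theorem Cmd.run_seq {c d : Cmd} : (Cmd.seq c d).run N s = d.run N (c.run N s) := rfl

@[simp] theorem Cmd.run_assign {x : ℕ} {t : Term} :
    (Cmd.assign x t).run N s = s.setVar x (t.eval N s) := rfl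

@[simp] theorem Cmd.run_skip : Cmd.skip.run N s = s := rfl

@[simp] theorem Cmd.run_fill_var {a x : ℕ} {t : Term} : ((Cmd.fill a x t).run N s).var = s.var := rfl

@[simp] theorem Cmd.run_fill_arr_of_ne {a x b : ℕ} {t : Term} (h : b ≠ a) :
    ((Cmd.fill a x t).run N s).arr b = s.arr b := by simp [run, h]

theorem Cmd.run_fill_arr {a x i : ℕ} {t : Term} :
    ((Cmd.fill a x t).run N s).arr a i = if i < N then t.eval N (s.setVar x i) else s.arr a i := by
  simp [run]

@[simp] theorem Cmd.run_fill_arr_eq_zero {a x i : ℕ} {t : Term} (h : i < N) :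
    ((Cmd.fill a x t).run N s).arr a i = 0 ↔ ¬t.Holds N (s.setVar x i) := by
  simp [run, h, Term.Holds]

@[simp] theorem State.setVar_set {x k a : ℕ} : (s.setVar x k).set n a = s.set n a := rfl

end Simp

/-! ### The program -/

/-!
Memory: the variables `0`, `1`, `2` and the array `0` hold the instance, variable `3` the vertex `v`
for which a cluster is searched, and variable `4` the advice, which is decoded into array `4`. The
arrays `2` and `3` are used by explorations, array `6` holds the set that is built, array `7` the
representative of a type (or the core of a large cluster), and array `8` the fringe. A cell of array
`9` is not `0` if a cluster containing the respective vertex has been found; this cluster is then a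
row of the array `10`. The result is put into array `1`. The variables from `20` on are bound
variables.
-/

namespace Code

open Term

/-- One step of an exploration. Array `2` holds the set explored so far, array `3` the set of the
rejected vertices, variable `8` the directions. -/
def exploreBody : Cmd :=
  .seq (.assign 5 (nthVertex (and (not (mem 21 2)) (and (not (mem 21 3))
    (ex 22 (and (mem 22 2) (adj 22 21))))) (const 0)))
  (.seq (.assign 10 (.sum 20 (bool (le (add (add (var 20) (var 20)) (const 2)) (var 8)))))
  (.seq (.fill 2 20 (or (mem 20 2)
    (and (eq (var 20) (var 5)) (sub (var 8) (add (var 10) (var 10))))))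
  (.seq (.fill 3 20 (or (mem 20 3)
    (and (eq (var 20) (var 5)) (not (sub (var 8) (add (var 10) (var 10)))))))
  (.assign 8 (var 10)))))

/-- The exploration from the vertex in variable `6`, avoiding the one in variable `3`, and directed
by variable `8`. The result is in array `2`. -/
def explore : Cmd :=
  .seq (.fill 2 20 (eq (var 20) (var 6))) (.seq (.fill 3 20 (eq (var 20) (var 3)))
    (.loop 19 exploreBody))

/-- The test that the set in array `2` fits the description in the variables `11` to `14`, and may
be added to the set in array `6`. -/
def fits (φT : Term) : Term :=
  and (eq (count 20 (mem 20 2)) (var 11)) (and (eq (cut 2) (var 12))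
    (and (eq (count 20 (and (mem 20 2) (adj 3 20))) (var 13)) (and φT
      (all 20 (imp (mem 20 2) (and (not (mem 20 6))
        (all 21 (imp (mem 21 6) (imp (not (eq (var 21) (var 3))) (not (adj 20 21)))))))))))

/-- The exploration from the vertex in variable `6`, directed by variable `7`. If it finds a fitting
set, this set is stored in array `7`. -/
def searchBody (φT : Term) : Cmd :=
  .seq (.assign 8 (var 7)) (.seq explore
    (.ite (and (lt (var 7) (var 15)) (fits φT)) (.fill 7 20 (mem 20 2)) .skip))

/-- The search for a representative, which ends up in array `7`. -/
def search (φT : Term) : Cmd :=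
  .seq (.fill 7 20 (const 0)) (.loop 6 (.loop 7 (searchBody φT)))

/-- Reading an entry of the array `4` of advice. -/
def advice (k : ℕ) : Term :=
  .cell 4 (add (add (add (add (var 18) (var 18)) (add (var 18) (var 18)))
    (add (add (var 18) (var 18)) (var 18))) (const k))

/-- The search for a representative, and the exploration started next to it. -/
def extend (φT : Term) : Cmd :=
  .seq (search φT) (.seq (.assign 6 (nthVertex (and (not (eq (var 21) (var 3))) (or (mem 21 7)
    (ex 22 (and (mem 22 7) (adj 22 21))))) (var 16)))
  (.seq (.assign 8 (var 17)) (.seq explore (.fill 6 20 (or (mem 20 6) (mem 20 2))))))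

/-- Reading the advice for one round of the assembly. -/
def readMove : Cmd :=
  .seq (.assign 11 (advice 0)) (.seq (.assign 12 (advice 1)) (.seq (.assign 13 (advice 2))
  (.seq (.assign 14 (advice 3)) (.seq (.assign 15 (advice 4)) (.seq (.assign 16 (advice 5))
  (.assign 17 (advice 6)))))))

/-- One round of the assembly. -/
def assembleBody (φT : Term) : Cmd := .seq readMove (.ite (var 11) (extend φT) .skip)

/-- The assembly of a small cluster containing the vertex in variable `3`, in array `6`. -/
def assemble (φT : Term) : Cmd :=
  .seq (.fill 6 20 (eq (var 20) (var 3))) (.loop 18 (assembleBody φT))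

/-- The construction of a large cluster containing the vertex in variable `3`, in array `6`. -/
def fringe : Cmd :=
  .seq (.assign 11 (.cell 4 (const 0))) (.seq (.assign 12 (.cell 4 (const 1)))
  (.seq (.fill 7 20 (and (not (eq (var 20) (var 3))) (and (not (eq (var 20) (var 12)))
    (or (eq (var 20) (var 11)) (ex 21 (and (eq (var 21) (var 11)) (adj 21 20)))))))
  (.seq (.fill 8 20 (and (not (mem 20 7)) (and (not (eq (var 20) (var 3)))
    (le (count 21 (mem 21 7)) (add (count 21 (and (mem 21 7) (adj 20 21)))
      (count 21 (and (mem 21 7) (adj 20 21))))))))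
  (.fill 6 20 (or (eq (var 20) (var 3)) (or (mem 20 7) (and (mem 20 8)
    (.cell 4 (add (count 21 (and (mem 21 8) (lt (var 21) (var 20)))) (const 2))))))))))

/-- One step of decoding the advice. -/
def decodeBody : Cmd :=
  .seq (.assign 5 (.sum 20 (bool (le (add (add (add (var 20) (var 20)) (add (var 20) (var 20)))
    (const 4)) (var 8)))))
  (.seq (.assign 10 (sub (var 8) (add (add (var 5) (var 5)) (add (var 5) (var 5)))))
  (.seq (.fill 4 20 (.ite (and (eq (var 20) (var 9)) (lt (var 10) (const 2)))
    (add (add (mem 20 4) (mem 20 4)) (var 10)) (mem 20 4)))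
  (.seq (.assign 9 (.ite (lt (var 10) (const 2)) (var 9) (add (var 9) (const 1))))
  (.assign 8 (var 5)))))

/-- Decoding the number in variable `4` into the array `4` of advice. -/
def decode : Cmd :=
  .seq (.fill 4 20 (const 0)) (.seq (.assign 8 (var 4)) (.seq (.assign 9 (const 0))
    (.loop 19 decodeBody)))

/-- Copying the set in array `a` to the row with the number in variable `x` of array `10`. -/
def setRow (x a : ℕ) : Cmd :=
  .fill 10 20 (.ite (and (le (mulN x) (var 20)) (lt (var 20) (add (mulN x) (var 0))))
    (.cell a (sub (var 20) (mulN x))) (mem 20 10))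

/-- Recording the set in array `6` if it is a cluster that contains the vertex in variable `3`. -/
def check (μT : Term) : Cmd :=
  .ite (and (mem 3 6) (and μT (le (cut 6) (var 2))))
    (.seq (.fill 9 20 (.ite (eq (var 20) (var 3)) (const 1) (mem 20 9))) (setRow 3 6)) .skip

/-- The search for a cluster that contains the vertex in variable `3`, with the advice encoded by
variable `4`. -/
def tryAdvice (μT φT : Term) : Cmd :=
  .seq decode (.seq (assemble φT) (.seq (check μT) (.seq fringe (check μT))))

/-- The search for a cluster that contains the vertex in variable `3`. -/
def findCluster (μT φT : Term) : Cmd :=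
  .ite (lt (var 3) (var 0)) (.loop 4 (tryAdvice μT φT)) .skip

/-- The search for clusters containing the vertices. -/
def findClusters (μT φT : Term) : Cmd :=
  .seq (.fill 9 20 (const 0)) (.loop 3 (findCluster μT φT))

/-- The test that the vertex in variable `y` belongs to the set in row `x` of array `10`. -/
def inRow (x y : ℕ) : Term := .cell 10 (add (mulN x) (var y))

/-- Making the sets in the rows `3` and `4` disjoint. -/
def uncrossBody : Cmd :=
  .ite (and (lt (var 3) (var 4)) (lt (var 4) (var 0)))
    (.seq (.fill 2 20 (and (inRow 3 20) (not (inRow 4 20))))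
      (.ite (le (cut 2) (var 2)) (setRow 3 2)
        (.seq (.fill 2 20 (and (inRow 4 20) (not (inRow 3 20)))) (setRow 4 2)))) .skip

/-- Making all rows disjoint. -/
def uncross : Cmd := .loop 3 (.loop 4 uncrossBody)

/-- The whole algorithm. -/
def solve (μT φT : Term) : Cmd :=
  .seq (findClusters μT φT) (.ite (all 20 (mem 20 9))
    (.seq uncross (.seq (.fill 1 20 (sumV 21 (.ite (inRow 21 20) (var 21) (const 0))))
      (.assign 0 (const 1)))) (.assign 0 (const 0)))

end Code

/-! ### Correctness of the search for clusters -/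

section Correctness

variable {N n : ℕ} {G : SimpleGraph (Fin n)} {s : State}

theorem setVar_setVar_hasGraph (hs : s.HasGraph G) {x y i j : ℕ} (hx : 0 ≠ x) (hy : 0 ≠ y) :
    ((s.setVar x i).setVar y j).HasGraph G := (hs.setVar hx).setVar hy

open Term in
theorem run_exploreBody (hN : n ≤ N) (hs : s.HasGraph G) :
    ((Code.exploreBody.run N s).set n 2, (Code.exploreBody.run N s).set n 3,
      (Code.exploreBody.run N s).var 8) = exploreStep G N (s.set n 2, s.set n 3, s.var 8) := by
  have hlt : ∀ u : Fin n, (u : ℕ) < N := fun u => u.isLt.trans_le hN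
  have h5 : (nthVertex (and (not (mem 21 2)) (and (not (mem 21 3))
      (ex 22 (and (mem 22 2) (adj 22 21))))) (const 0)).eval N s =
        nth N (frontier G (s.set n 2) (s.set n 3)) 0 := by
    refine eval_nthVertex hN hs.var (fun i z => ?_) (fun i => rfl)
    have hg : ((s.setVar 20 i).setVar 21 z).HasGraph G :=
      (hs.setVar (by decide)).setVar (by decide)
    rw [holds_and, holds_and, holds_ex hN hg.var (by decide), mem_frontier]
    simp only [holds_and, holds_not, holds_mem, State.mem_set, State.setVar_var, State.setVar_arr]
    have : ∀ u : Fin n, (adj 22 21).Holds N (((s.setVar 20 i).setVar 21 z).setVar 22 u) ↔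
        G.Adj u z := fun u => holds_adj hN (hg.setVar (by decide)) (by decide) (by simp) (by simp)
    simp [this]
  have h10 : ∀ s : State, (Term.sum 20 (bool (le (add (add (var 20) (var 20)) (const 2))
      (var 8)))).eval N s = min N (s.var 8 / 2) := by
    intro s
    rw [← sum_range_ind_le two_pos, eval]
    refine Finset.sum_congr rfl fun i _ => ?_
    simp [two_mul]
  refine Prod.ext ?_ (Prod.ext ?_ ?_)
  · ext u
    simp [Code.exploreBody, h5, h10, exploreStep, hlt, two_mul]
    tauto
  · ext u
    simp [Code.exploreBody, h5, h10, exploreStep, hlt, two_mul]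
    tauto
  · simp [Code.exploreBody, h5, h10, exploreStep]

theorem run_explore (hN : n ≤ N) (hs : s.HasGraph G) {v : Fin n} (hv : s.var 3 = v) :
    (Code.explore.run N s).set n 2 = explore G N v (s.var 6) (s.var 8) := by
  have hlt : ∀ u : Fin n, (u : ℕ) < N := fun u => u.isLt.trans_le hN
  rw [Code.explore, Cmd.run_seq, Cmd.run_seq]
  set s₁ := (Cmd.fill 3 20 (.eq (.var 20) (.var 3))).run N
    ((Cmd.fill 2 20 (.eq (.var 20) (.var 6))).run N s) with hs₁
  have h := Cmd.loop_simulation (N := N) (s := s₁) 19 Code.exploreBody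
    (fun s => (s.set n 2, s.set n 3, s.var 8)) (fun st _ => exploreStep G N st)
    (fun s => s.HasGraph G) (fun s i _ hs => by
      have := hs.setVar (x := 19) (k := i) (by decide)
      exact ⟨Cmd.run_hasGraph rfl rfl this, by rw [run_exploreBody hN this]; rfl⟩)
    (hs.congr rfl rfl)
  rw [List.foldl_const, List.length_range] at h
  have h1 := congrArg Prod.fst h.2
  refine h1.trans ?_
  rw [explore]
  refine congrArg (fun st => ((exploreStep G N)^[N] st).1) (Prod.ext ?_ (Prod.ext ?_ ?_))
  · ext u; simp [hs₁, hlt]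
  · ext u; simp [hs₁, hlt, hv, Fin.ext_iff]
  · simp [hs₁]

/-- The advice held by the variables `11` to `17`. -/
def State.move (s : State) : Move :=
  ⟨s.var 11, s.var 12, s.var 13, s.var 14, s.var 15, s.var 16, s.var 17⟩

/-- What is constant during the search for a representative. -/
structure SearchInv (G : SimpleGraph (Fin n)) (v : Fin n) (A : Finset (Fin n)) (m : Move)
    (s : State) : Prop where
  graph : s.HasGraph G
  var : s.var 3 = v
  set : s.set n 6 = A
  move : s.move = m

theorem SearchInv.setVar {v : Fin n} {A : Finset (Fin n)} {m : Move} (h : SearchInv G v A m s)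
    {x k : ℕ} (hx : x ∉ [0, 3, 11, 12, 13, 14, 15, 16, 17]) :
    SearchInv G v A m (s.setVar x k) := by
  simp only [List.mem_cons, List.not_mem_nil, or_false, not_or, ← ne_eq] at hx
  obtain ⟨h0, h3, h11, h12, h13, h14, h15, h16, h17⟩ := hx
  exact ⟨h.graph.setVar h0.symm, by simp [h3.symm, h.var], h.set, by
    rw [← h.move]
    simp [State.move, h11.symm, h12.symm, h13.symm, h14.symm, h15.symm, h16.symm, h17.symm]⟩

theorem SearchInv.run {v : Fin n} {A : Finset (Fin n)} {m : Move} (h : SearchInv G v A m s)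
    {c : Cmd} (hc : ([0, 3, 11, 12, 13, 14, 15, 16, 17].all fun x => c.keepsVar x) = true)
    (ha : (c.keepsArr 0 && c.keepsArr 6) = true) : SearchInv G v A m (c.run N s) := by
  simp only [List.all_cons, List.all_nil, Bool.and_true, Bool.and_eq_true] at hc ha
  obtain ⟨h0, h3, h11, h12, h13, h14, h15, h16, h17⟩ := hc
  refine ⟨Cmd.run_hasGraph h0 ha.1 h.graph, by rw [Cmd.run_var h3, h.var],
    by rw [Cmd.run_set ha.2, h.set], ?_⟩
  rw [← h.move]
  simp only [State.move, Cmd.run_var h11, Cmd.run_var h12, Cmd.run_var h13, Cmd.run_var h14,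
    Cmd.run_var h15, Cmd.run_var h16, Cmd.run_var h17]

variable {φ : Fin n → Finset (Fin n) → ℕ → Prop} {φT : Term}

/-- The term expresses the local condition `φ` for the vertex in variable `3`, the set in array `2`
and the number in variable `14`. -/
def Expresses (N : ℕ) (G : SimpleGraph (Fin n)) (φT : Term)
    (φ : Fin n → Finset (Fin n) → ℕ → Prop) : Prop :=
  ∀ (s : State) (v : Fin n), s.HasGraph G → s.var 3 = v →
    (φT.Holds N s ↔ φ v (s.set n 2) (s.var 14))

theorem Term.eval_count_mem (hN : n ≤ N) (hs : s.var 0 = n) {x a : ℕ} (hx : 0 ≠ x) :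
    (Term.count x (Term.mem x a)).eval N s = (s.set n a).card := by
  rw [eval_count hN hs hx, ← sum_ind_mem]
  simp

open Term in
theorem holds_fits (hN : n ≤ N) (hφ : Expresses N G φT φ) (hs : s.HasGraph G) {v : Fin n}
    (hv : s.var 3 = v) :
    (Code.fits φT).Holds N s ↔ Fits G φ v (s.set n 6) s.move (s.set n 2) := by
  have h1 : (count 20 (and (mem 20 2) (adj 3 20))).eval N s = edges G {v} (s.set n 2) := by
    rw [eval_count hN hs.var (by decide), edges_singleton]
    refine Finset.sum_congr rfl fun w _ => congrArg ind (propext ?_)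
    rw [holds_and, holds_adj hN (hs.setVar (by decide)) (by decide) (u := v) (w := w)
      (by simp [hv]) (by simp)]
    simp
  have h2 : ∀ u w : Fin n, (adj 20 21).Holds N ((s.setVar 20 u).setVar 21 w) ↔ G.Adj u w :=
    fun u w => holds_adj hN (setVar_setVar_hasGraph hs (by decide) (by decide)) (by decide)
      (by simp) (by simp)
  rw [Code.fits, holds_and, holds_and, holds_and, holds_and, holds_eq, holds_eq, holds_eq, h1,
    eval_cut hN hs, eval_count_mem hN hs.var (by decide), hφ s v hs hv,
    holds_all hN hs.var (by decide), Fits]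
  refine and_congr Iff.rfl (and_congr Iff.rfl (and_congr Iff.rfl (and_congr Iff.rfl ?_)))
  refine forall_congr' fun u => ?_
  rw [holds_imp, holds_and, holds_all hN (hs.setVar (by decide)).var (by decide)]
  simp [h2, hv, Fin.ext_iff]

theorem run_search (hN : n ≤ N) (hφ : Expresses N G φT φ) {v : Fin n} {A : Finset (Fin n)}
    {m : Move} (hs : SearchInv G v A m s) :
    ((Code.search φT).run N s).set n 7 = representative G φ N v A m := by
  classical
  have hlt : ∀ u : Fin n, (u : ℕ) < N := fun u => u.isLt.trans_le hN
  have hinner : ∀ (s : State) (b : ℕ), SearchInv G v A m s →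
      ((Code.searchBody φT).run N (s.setVar 7 b)).set n 7 =
      if b < m.β ∧ Fits G φ v A m (explore G N v (s.var 6) b) then explore G N v (s.var 6) b
        else s.set n 7 := by
    intro s b hs
    have h1 : SearchInv G v A m ((s.setVar 7 b).setVar 8 b) :=
      (hs.setVar (by decide)).setVar (by decide)
    have h2 : SearchInv G v A m (Code.explore.run N ((s.setVar 7 b).setVar 8 b)) :=
      h1.run (by rfl) (by rfl)
    have h3 := run_explore hN h1.graph h1.var
    simp only [State.setVar_var, if_true, show (6 : ℕ) ≠ 8 by decide, show (6 : ℕ) ≠ 7 by decide,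
      if_false] at h3
    have h4 : (Term.and (.lt (.var 7) (.var 15)) (Code.fits φT)).Holds N
        (Code.explore.run N ((s.setVar 7 b).setVar 8 b)) ↔
        b < m.β ∧ Fits G φ v A m (explore G N v (s.var 6) b) := by
      rw [Term.holds_and, holds_fits hN hφ h2.graph h2.var, h2.set, h2.move, h3, ← h2.move]
      simp only [Term.holds_lt, Term.eval_var, State.move,
        Cmd.run_var (c := Code.explore) (y := 7) rfl]
      simp
    rw [Code.searchBody, Cmd.run_seq, Cmd.run_seq, Cmd.run_assign]
    simp only [Term.eval_var, State.setVar_var, if_true]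
    rw [Cmd.run_ite]
    simp only [h4]
    split_ifs with hc
    · rw [← h3]
      ext u
      simp [hlt]
    · rw [Cmd.run_skip, Cmd.run_set (by rfl)]
      rfl
  have houter : ∀ (s : State) (w : ℕ), SearchInv G v A m s →
      ((Cmd.loop 7 (Code.searchBody φT)).run N (s.setVar 6 w)).set n 7 =
      (List.range N).foldl (fun R b => if b < m.β ∧ Fits G φ v A m (explore G N v w b) then
        explore G N v w b else R) (s.set n 7) := by
    intro s w hs
    refine (Cmd.loop_simulation 7 (Code.searchBody φT) (fun s => s.set n 7) _
      (fun s => SearchInv G v A m s ∧ s.var 6 = w)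
      (fun s b _ hs => ⟨⟨(hs.1.setVar (by decide)).run (by rfl) (by rfl), ?_⟩, ?_⟩)
      ⟨hs.setVar (by decide), by simp⟩).2
    · rw [Cmd.run_var (by rfl)]
      simp [hs.2]
    · rw [hinner s b hs.1, hs.2]
  rw [Code.search, Cmd.run_seq, representative]
  refine (Cmd.loop_simulation 6 (.loop 7 (Code.searchBody φT)) (fun s => s.set n 7)
    (fun R w => (List.range N).foldl (fun R b => if b < m.β ∧ Fits G φ v A m (explore G N v w b)
      then explore G N v w b else R) R) (fun s => SearchInv G v A m s) (fun s w _ hs =>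
      ⟨(hs.setVar (by decide)).run (by rfl) (by rfl), houter s w hs⟩)
    (hs.run (by rfl) (by rfl))).2.trans ?_
  congr 1
  ext u
  simp [hlt]

open Term in
theorem run_extend (hN : n ≤ N) (hφ : Expresses N G φT φ) {v : Fin n} {A : Finset (Fin n)}
    {m : Move} (hs : SearchInv G v A m s) :
    ((Code.extend φT).run N s).set n 6 =
      A ∪ explore G N v (nth N (hood G v (representative G φ N v A m)) m.i) m.b := by
  have h1 : SearchInv G v A m ((Code.search φT).run N s) := hs.run (by rfl) (by rfl)
  have h2 := run_search hN hφ hs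
  set s₁ := (Code.search φT).run N s with hs₁
  have h3 : (nthVertex (and (not (eq (var 21) (var 3))) (or (mem 21 7)
      (ex 22 (and (mem 22 7) (adj 22 21))))) (var 16)).eval N s₁ =
      nth N (hood G v (representative G φ N v A m)) m.i := by
    refine eval_nthVertex hN h1.graph.var (fun i z => ?_) 
      (fun i => by rw [← h1.move]; simp [State.move])
    have hg := setVar_setVar_hasGraph (x := 20) (y := 21) (i := i) (j := z) h1.graph
      (by decide) (by decide)
    have : ∀ u : Fin n, (adj 22 21).Holds N (((s₁.setVar 20 i).setVar 21 z).setVar 22 u) ↔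
        G.Adj u z := fun u => holds_adj hN (hg.setVar (by decide)) (by decide) (by simp) (by simp)
    rw [holds_and, holds_or, holds_ex hN hg.var (by decide), mem_hood, ← h2]
    simp [this, h1.var, Fin.ext_iff]
  have h4 : SearchInv G v A m ((s₁.setVar 6 (nth N (hood G v (representative G φ N v A m))
      m.i)).setVar 8 m.b) := (h1.setVar (by decide)).setVar (by decide)
  have h5 := run_explore hN h4.graph h4.var
  have h6 : s₁.var 17 = m.b := by rw [← h1.move]; rfl
  have h7 : SearchInv G v A m (Code.explore.run N ((s₁.setVar 6 (nth N (hood G v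
      (representative G φ N v A m)) m.i)).setVar 8 m.b)) := h4.run (by rfl) (by rfl)
  simp only [State.setVar_var, if_true, show (6 : ℕ) ≠ 8 by decide, if_false] at h5
  rw [Code.extend, Cmd.run_seq, Cmd.run_seq, Cmd.run_seq, Cmd.run_seq, ← hs₁,
    Cmd.run_assign (x := 6), h3, Cmd.run_assign, eval_var, State.setVar_var, if_neg (by decide), h6]
  ext u
  rw [Finset.mem_union, ← h5, Cmd.mem_run_fill hN, holds_or, ← Finset.ext_iff.1 h7.set u]
  simp

theorem run_readMove : (Code.readMove.run N s).move = Move.ofTape (s.arr 4) (s.var 18) := by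
  have h : ∀ k, s.var 18 + s.var 18 + (s.var 18 + s.var 18) +
      (s.var 18 + s.var 18 + s.var 18) + k = 7 * s.var 18 + k := fun k => by ring
  simp [Code.readMove, Code.advice, State.move, Move.ofTape, h]

theorem run_assemble (hN : n ≤ N) (hφ : Expresses N G φT φ) (hs : s.HasGraph G) {v : Fin n}
    (hv : s.var 3 = v) :
    ((Code.assemble φT).run N s).set n 6 = assemble G φ N v (s.arr 4) := by
  have hlt : ∀ u : Fin n, (u : ℕ) < N := fun u => u.isLt.trans_le hN
  rw [Code.assemble, Cmd.run_seq, assemble]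
  refine (Cmd.loop_simulation (N := N)
    (s := (Cmd.fill 6 20 (.eq (.var 20) (.var 3))).run N s) 18 (Code.assembleBody φT)
    (fun s => s.set n 6)
    (fun A j => moveStep G φ N v A (Move.ofTape (s.arr 4) j))
    (fun s' => s'.HasGraph G ∧ s'.var 3 = v ∧ s'.arr 4 = s.arr 4)
    (fun s' j _ hs' =>
      ⟨⟨Cmd.run_hasGraph (by rfl) (by rfl) (hs'.1.setVar (by decide)), ?_, ?_⟩, ?_⟩)
    ⟨hs.congr rfl rfl, hv, by simp⟩).2.trans ?_
  · rw [Cmd.run_var (by rfl)]; simp [hs'.2.1]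
  · rw [Cmd.run_arr (by rfl)]; simp [hs'.2.2]
  · have h1 : (Code.readMove.run N (s'.setVar 18 j)).move = Move.ofTape (s.arr 4) j := by
      rw [run_readMove]; simp [hs'.2.2]
    have h2 : SearchInv G v (s'.set n 6) (Move.ofTape (s.arr 4) j)
        (Code.readMove.run N (s'.setVar 18 j)) :=
      ⟨Cmd.run_hasGraph (by rfl) (by rfl) (hs'.1.setVar (by decide)), by
        rw [Cmd.run_var (by rfl)]; simp [hs'.2.1], by rw [Cmd.run_set (by rfl)]; rfl, h1⟩
    rw [Code.assembleBody, Cmd.run_seq, Cmd.run_ite, moveStep]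
    have h3 : (Term.var 11).Holds N (Code.readMove.run N (s'.setVar 18 j)) ↔
        (Move.ofTape (s.arr 4) j).s ≠ 0 := by rw [← h1]; rfl
    simp only [h3]
    split_ifs
    · exact run_extend hN hφ h2
    · exact h2.set
  · congr 1
    ext u
    simp [hlt, hv, Fin.ext_iff]

open Term in
theorem run_fringe (hN : n ≤ N) (hs : s.HasGraph G) {v : Fin n} (hv : s.var 3 = v) :
    (Code.fringe.run N s).set n 6 =
      fringeSet G v (core G v (s.arr 4 0) (s.arr 4 1)) (fun i => s.arr 4 (i + 2)) := by
  have hlt : ∀ u : Fin n, (u : ℕ) < N := fun u => u.isLt.trans_le hN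
  rw [Code.fringe, Cmd.run_seq, Cmd.run_seq, Cmd.run_seq, Cmd.run_seq, Cmd.run_assign,
    Cmd.run_assign]
  simp only [eval_cell, eval_const, State.setVar_arr]
  set s₁ := (s.setVar 11 (s.arr 4 0)).setVar 12 (s.arr 4 1) with hs₁
  have hg₁ : s₁.HasGraph G := setVar_setVar_hasGraph hs (by decide) (by decide)
  have hs₁3 : s₁.var 3 = v := by simp [hs₁, hv]
  have hs₁11 : s₁.var 11 = s.arr 4 0 := by simp [hs₁]
  have hs₁12 : s₁.var 12 = s.arr 4 1 := by simp [hs₁]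
  set s₂ := (Cmd.fill 7 20 (and (not (eq (var 20) (var 3))) (and (not (eq (var 20) (var 12)))
    (or (eq (var 20) (var 11)) (ex 21 (and (eq (var 21) (var 11)) (adj 21 20))))))).run N s₁
    with hs₂
  have hg₂ : s₂.HasGraph G := hg₁.congr rfl rfl
  have hv₂ : s₂.var = s₁.var := rfl
  have h1 : s₂.set n 7 = core G v (s.arr 4 0) (s.arr 4 1) := by
    ext u
    have : ∀ z : Fin n, (adj 21 20).Holds N ((s₁.setVar 20 u).setVar 21 z) ↔
        G.Adj z u := fun z => holds_adj hN (setVar_setVar_hasGraph hg₁ (by decide) (by decide))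
          (by decide) (by simp) (by simp)
    rw [hs₂, Cmd.mem_run_fill hN, holds_and, holds_and, holds_or,
      holds_ex hN (hg₁.setVar (by decide)).var (by decide)]
    simp [this, core, hs₁3, hs₁11, hs₁12, Fin.ext_iff]
  generalize core G v (s.arr 4 0) (s.arr 4 1) = M at h1 ⊢
  set s₃ := (Cmd.fill 8 20 (and (not (mem 20 7)) (and (not (eq (var 20) (var 3)))
    (le (count 21 (mem 21 7)) (add (count 21 (and (mem 21 7) (adj 20 21)))
      (count 21 (and (mem 21 7) (adj 20 21)))))))).run N s₂ with hs₃
  have hg₃ : s₃.HasGraph G := hg₂.congr rfl rfl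
  have h2 : s₃.set n 8 = fringe G v M := by
    ext u
    have hg := hg₂.setVar (x := 20) (k := u) (by decide)
    have : ∀ z : Fin n, (adj 20 21).Holds N ((s₂.setVar 20 u).setVar 21 z) ↔
        G.Adj u z := fun z => holds_adj hN (setVar_setVar_hasGraph hg₂ (by decide) (by decide))
          (by decide) (by simp) (by simp)
    rw [hs₃, Cmd.mem_run_fill hN, holds_and, holds_and, holds_le,
      eval_count_mem hN hg.var (by decide), eval_add, eval_count hN hg.var (by decide),
      State.setVar_set, h1, mem_fringe, ← two_mul, ← h1]
    simp [this, hv₂, hs₁3, Fin.ext_iff]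
  have h3 : s₃.set n 7 = M := by rw [← h1]; exact State.set_congr (by simp [hs₃])
  have h4 : s₃.arr 4 = s.arr 4 := by simp [hs₃, hs₂, hs₁]
  have h5 : s₃.var 3 = v := by simp [hs₃, hs₂, hs₁, hv]
  ext u
  have hg := hg₃.setVar (x := 20) (k := u) (by decide)
  rw [Cmd.mem_run_fill hN, fringeSet, ← h2, ← h3, holds_or, holds_or, holds_and, holds_cell,
    eval_add, eval_count hN hg.var (by decide)]
  simp [h5, h4, Fin.ext_iff]

end Correctness

/-! ### Correctness of the recording of clusters -/

section Decoding

variable {N n : ℕ} {G : SimpleGraph (Fin n)} {s : State}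

open Term in
theorem run_decodeBody :
    ((Code.decodeBody.run N s).var 8, (Code.decodeBody.run N s).var 9,
      (Code.decodeBody.run N s).arr 4) = tapeStep N (s.var 8, s.var 9, s.arr 4) := by
  have h5 : (Term.sum 20 (bool (le (add (add (add (var 20) (var 20)) (add (var 20) (var 20)))
      (const 4)) (var 8)))).eval N s = min N (s.var 8 / 4) := by
    rw [← sum_range_ind_le four_pos, eval]
    refine Finset.sum_congr rfl fun i _ => ?_
    rw [eval_bool]
    refine congrArg ind (propext ?_)
    simp only [holds_le, eval_add, eval_var, eval_const, State.setVar_var, if_true,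
      show (8 : ℕ) ≠ 20 by decide, if_false]
    constructor <;> intro h <;> omega
  have h4 : min N (s.var 8 / 4) + min N (s.var 8 / 4) + (min N (s.var 8 / 4) +
      min N (s.var 8 / 4)) = 4 * min N (s.var 8 / 4) := by ring
  refine Prod.ext ?_ (Prod.ext ?_ ?_)
  · simp [Code.decodeBody, h5, tapeStep]
  · simp only [Code.decodeBody, tapeStep, Cmd.run_seq, Cmd.run_assign, h5]
    simp [eval_ite, h4]
  · simp only [Code.decodeBody, tapeStep, Cmd.run_seq, Cmd.run_assign, h5]
    funext i
    simp [Cmd.run_fill_arr, eval_ite, h4, two_mul]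

theorem run_decode (hs : ∀ i ≥ N, s.arr 4 i = 0) :
    (Code.decode.run N s).arr 4 = tape N (s.var 4) := by
  set s₁ := ((Cmd.fill 4 20 (.const 0)).run N s).setVar 8 (s.var 4) |>.setVar 9 0 with hs₁
  have h := (Cmd.loop_simulation (N := N) (s := s₁) 19 Code.decodeBody
    (fun s => (s.var 8, s.var 9, s.arr 4)) (fun st _ => tapeStep N st)
    (fun _ => True) (fun s i _ _ => ⟨trivial, by rw [run_decodeBody]; simp⟩) trivial).2
  rw [List.foldl_const, List.length_range] at h
  refine (congrArg (fun st => st.2.2) h).trans ?_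
  refine congrArg (fun st => ((tapeStep N)^[N] st).2.2) (Prod.ext ?_ (Prod.ext ?_ ?_))
  · simp [hs₁]
  · simp [hs₁]
  · funext i
    simp only [hs₁, State.setVar_arr, Cmd.run_fill_arr, Term.eval_const]
    split_ifs with h
    · rfl
    · exact hs i (by omega)

end Decoding

section Rows

variable {N n : ℕ} {G : SimpleGraph (Fin n)} {s : State}

/-- The set of vertices held by row `i` of the array `10`. -/
def State.row (n : ℕ) (s : State) (i : Fin n) : Finset (Fin n) :=
  Finset.univ.filter fun u => s.arr 10 (i * n + u) ≠ 0

@[simp] theorem State.mem_row {i u : Fin n} : u ∈ s.row n i ↔ s.arr 10 (i * n + u) ≠ 0 := by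
  simp [State.row]

theorem State.row_congr {s' : State} (h : s'.arr 10 = s.arr 10) (i : Fin n) :
    s'.row n i = s.row n i := by simp only [State.row, h]

theorem Cmd.run_row {c : Cmd} (h : c.keepsArr 10 = true) (i : Fin n) :
    (c.run N s).row n i = s.row n i := State.row_congr (run_arr h) i

theorem row_index_lt (hN : n * n ≤ N) (i u : Fin n) : (i : ℕ) * n + u < N := by
  have h1 : (i : ℕ) + 1 ≤ n := i.isLt
  have h2 : ((i : ℕ) + 1) * n ≤ n * n := Nat.mul_le_mul_right n h1
  have := u.isLt
  rw [Nat.add_mul] at h2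
  omega

open Term in
theorem run_setRow (hN : n ≤ N) (hNn : n * n ≤ N) (hs : s.var 0 = n) {x a : ℕ} (hx : x ≠ 39)
    (hx' : x ≠ 20) {i : Fin n} (hi : s.var x = i) (j : Fin n) :
    ((Code.setRow x a).run N s).row n j = if j = i then s.set n a else s.row n j := by
  ext u
  have hlt := row_index_lt hNn j u
  have hm : (mulN x).eval N (s.setVar 20 (j * n + u)) = i * n :=
    eval_mulN hx (i.isLt.le.trans hN) (by simp [hs]) (by simp [hx', hi])
  have hu := u.isLt
  rw [State.mem_row, Code.setRow, Cmd.run_fill_arr, if_pos hlt, eval_ite]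
  simp only [holds_and, holds_le, holds_lt, eval_add, eval_sub, eval_cell, eval_mem, eval_var, hm,
    State.setVar_var, State.setVar_arr, if_true, show (0 : ℕ) ≠ 20 by decide, if_false, hs]
  by_cases hji : j = i
  · subst hji
    simp [hu]
  · rw [if_neg, if_neg hji, State.mem_row]
    rintro ⟨h1, h2⟩
    apply hji
    refine Fin.ext ?_
    have h3 : (i : ℕ) < j + 1 := by
      by_contra! h
      have := Nat.mul_le_mul_right n h
      rw [Nat.add_mul] at this
      omega
    have h4 : (j : ℕ) < i + 1 := by
      by_contra! h
      have := Nat.mul_le_mul_right n h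
      rw [Nat.add_mul] at this
      omega
    omega

theorem Term.holds_inRow (hN : n ≤ N) (hs : s.var 0 = n) {x y : ℕ} (hx : x ≠ 39) {i u : Fin n}
    (hi : s.var x = i) (hu : s.var y = u) : (Code.inRow x y).Holds N s ↔ u ∈ s.row n i := by
  rw [Code.inRow, holds_cell, eval_add, eval_mulN hx (i.isLt.le.trans hN) hs hi, eval_var, hu,
    State.mem_row]

end Rows

section Clusters

variable {N n p q : ℕ} {G : SimpleGraph (Fin n)} {s : State} {μ : Finset (Fin n) → ℕ}
  {φ : Fin n → Finset (Fin n) → ℕ → Prop} {μT φT : Term}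

/-- The term expresses that the value of `μ` at the set in array `6` is at most the number in
variable `1`. -/
def ExpressesBound (N : ℕ) (G : SimpleGraph (Fin n)) (μT : Term) (μ : Finset (Fin n) → ℕ) : Prop :=
  ∀ s : State, s.HasGraph G → (μT.Holds N s ↔ μ (s.set n 6) ≤ s.var 1)

/-- The memory during the search for clusters: if cell `v` of the array `9` is not `0`, then row `v`
of the array `10` is a cluster that contains `v`. -/
structure ClusterInv (N : ℕ) (G : SimpleGraph (Fin n)) (μ : Finset (Fin n) → ℕ) (p q : ℕ)
    (s : State) : Prop where
  graph : s.HasGraph G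
  var_p : s.var 1 = p
  var_q : s.var 2 = q
  tail : ∀ i ≥ N, s.arr 4 i = 0
  row : ∀ v : Fin n, s.arr 9 v ≠ 0 → v ∈ s.row n v ∧ IsCluster G μ p q (s.row n v)

theorem ClusterInv.setVar (h : ClusterInv N G μ p q s) {x k : ℕ} (hx : x ∉ [0, 1, 2]) :
    ClusterInv N G μ p q (s.setVar x k) := by
  simp only [List.mem_cons, List.not_mem_nil, or_false, not_or, ← ne_eq] at hx
  exact ⟨h.graph.setVar hx.1.symm, by simp [hx.2.1.symm, h.var_p], by simp [hx.2.2.symm, h.var_q], h.tail,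
    h.row⟩

theorem ClusterInv.run (h : ClusterInv N G μ p q s) {c : Cmd}
    (hc : (c.keepsVar 0 && (c.keepsVar 1 && c.keepsVar 2)) = true)
    (ha : (c.keepsArr 0 && (c.keepsArr 9 && c.keepsArr 10)) = true) :
    ClusterInv N G μ p q (c.run N s) := by
  simp only [Bool.and_eq_true] at hc ha
  refine ⟨Cmd.run_hasGraph hc.1 ha.1 h.graph, by rw [Cmd.run_var hc.2.1, h.var_p],
    by rw [Cmd.run_var hc.2.2, h.var_q], fun i hi => by rw [Cmd.run_arr_of_le hi, h.tail i hi],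
    fun v => ?_⟩
  rw [Cmd.run_arr ha.2.1, Cmd.run_row ha.2.2]
  exact h.row v

open Term in
theorem run_check (hN : n ≤ N) (hNn : n * n ≤ N) (hμ : ExpressesBound N G μT μ)
    (hs : ClusterInv N G μ p q s) {v : Fin n} (hv : s.var 3 = v) :
    ClusterInv N G μ p q ((Code.check μT).run N s) ∧
      (∀ u : Fin n, s.arr 9 u ≠ 0 → ((Code.check μT).run N s).arr 9 u ≠ 0) ∧
      (v ∈ s.set n 6 → IsCluster G μ p q (s.set n 6) → ((Code.check μT).run N s).arr 9 v ≠ 0) := by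
  have hcond : (and (mem 3 6) (and μT (le (cut 6) (var 2)))).Holds N s ↔
      v ∈ s.set n 6 ∧ IsCluster G μ p q (s.set n 6) := by
    rw [holds_and, holds_and, hμ s hs.graph, holds_le, eval_cut hN hs.graph, eval_var, hs.var_p, hs.var_q,
      holds_mem, hv, State.mem_set, IsCluster]
  rw [Code.check, Cmd.run_ite]
  split_ifs with hc <;> rw [hcond] at hc
  · rw [Cmd.run_seq]
    set s₁ := (Cmd.fill 9 20 (.ite (eq (var 20) (var 3)) (const 1) (mem 20 9))).run N s with hs₁
    have hrow : ∀ u : Fin n, ((Code.setRow 3 6).run N s₁).row n u =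
        if u = v then s.set n 6 else s.row n u := by
      intro u
      rw [run_setRow hN hNn (by simpa [hs₁] using hs.graph.var) (by decide) (by decide) (i := v)
        (by simpa [hs₁] using hv)]
      have h1 : s₁.set n 6 = s.set n 6 := State.set_congr (by simp [hs₁])
      have h2 : s₁.row n u = s.row n u := State.row_congr (by simp [hs₁]) u
      rw [h1, h2]
    have hhas : ∀ u : Fin n, ((Code.setRow 3 6).run N s₁).arr 9 u =
        if u = v then 1 else s.arr 9 u := by
      intro u
      rw [Cmd.run_arr (by rfl), hs₁, Cmd.run_fill_arr, if_pos (u.isLt.trans_le hN), eval_ite]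
      simp [hv, Fin.ext_iff]
    refine ⟨⟨Cmd.run_hasGraph rfl rfl (hs.graph.congr rfl rfl), ?_, ?_, fun i hi => ?_,
      fun u hu => ?_⟩, fun u hu => ?_, fun _ _ => ?_⟩
    · rw [Cmd.run_var (by rfl)]; exact hs.var_p
    · rw [Cmd.run_var (by rfl)]; exact hs.var_q
    · rw [Cmd.run_arr (by rfl), Cmd.run_arr (by rfl)]; exact hs.tail i hi
    · rw [hrow]
      rw [hhas] at hu
      split_ifs with huv
      · rw [huv]; exact hc
      · rw [if_neg huv] at hu
        exact hs.row u hu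
    · rw [hhas]
      split_ifs
      · exact one_ne_zero
      · exact hu
    · rw [hhas, if_pos rfl]; exact one_ne_zero
  · exact ⟨hs, fun u hu => hu, fun h1 h2 => absurd ⟨h1, h2⟩ hc⟩

/-- A property that is preserved by all rounds of a loop and established by round `j` holds in the
end. -/
theorem Cmd.loop_establishes (x : ℕ) (c : Cmd) (P Q : State → Prop)
    (hP : ∀ s, ∀ i < N, P s → P (c.run N (s.setVar x i)))
    (hQ : ∀ s, ∀ i < N, P s → Q s → Q (c.run N (s.setVar x i))) {j : ℕ} (hj : j < N)
    (hest : ∀ s, P s → Q (c.run N (s.setVar x j))) (hs : P s) : Q ((Cmd.loop x c).run N s) := by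
  rw [Cmd.run]
  obtain ⟨l₁, l₂, hl⟩ := List.append_of_mem (List.mem_range.2 hj)
  have hmem : ∀ i, i ∈ l₁ ++ j :: l₂ → i < N := fun i hi => List.mem_range.1 (hl ▸ hi)
  rw [hl, List.foldl_append, List.foldl_cons]
  have h1 := foldl_invariant (f := fun s' i => c.run N (s'.setVar x i)) P
    (l := l₁) (fun s i hi => hP s i (hmem i (by simp [hi]))) s hs
  exact (foldl_invariant (fun s => P s ∧ Q s) (l := l₂) (fun s i hi h =>
    ⟨hP s i (hmem i (by simp [hi])) h.1, hQ s i (hmem i (by simp [hi])) h.1 h.2⟩) _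
    ⟨hP _ j hj h1, hest _ h1⟩).2

/-- Trying the advice `a` keeps all clusters found so far, and if the advice leads to a cluster
containing `v`, then such a cluster has been found afterwards. -/
theorem run_try (hN : n ≤ N) (hNn : n * n ≤ N) (hμ : ExpressesBound N G μT μ)
    (hφ : Expresses N G φT φ) (hs : ClusterInv N G μ p q s) {v : Fin n} (hv : s.var 3 = v) (a : ℕ) :
    ClusterInv N G μ p q ((Code.tryAdvice μT φT).run N (s.setVar 4 a)) ∧
      ((Code.tryAdvice μT φT).run N (s.setVar 4 a)).var 3 = v ∧
      (∀ u : Fin n, s.arr 9 u ≠ 0 → ((Code.tryAdvice μT φT).run N (s.setVar 4 a)).arr 9 u ≠ 0) ∧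
      ((v ∈ assemble G φ N v (tape N a) ∧ IsCluster G μ p q (assemble G φ N v (tape N a))) ∨
        (v ∈ fringeSet G v (core G v (tape N a 0) (tape N a 1)) (fun i => tape N a (i + 2)) ∧
          IsCluster G μ p q
            (fringeSet G v (core G v (tape N a 0) (tape N a 1)) (fun i => tape N a (i + 2)))) →
        ((Code.tryAdvice μT φT).run N (s.setVar 4 a)).arr 9 v ≠ 0) := by
  have h0 : ClusterInv N G μ p q (s.setVar 4 a) := hs.setVar (by decide)
  have ht := run_decode (N := N) (s := s.setVar 4 a) h0.tail
  rw [State.setVar_var, if_pos rfl] at ht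
  have hv3 : ((Code.tryAdvice μT φT).run N (s.setVar 4 a)).var 3 = v := by
    rw [Cmd.run_var (by rfl)]; simpa using hv
  rw [Code.tryAdvice] at hv3 ⊢
  simp only [Cmd.run_seq] at hv3 ⊢
  set s₁ := Code.decode.run N (s.setVar 4 a) with hs₁
  have h1 : ClusterInv N G μ p q s₁ := h0.run (by rfl) (by rfl)
  have hv1 : s₁.var 3 = v := by rw [hs₁, Cmd.run_var (by rfl)]; simpa using hv
  have h91 : s₁.arr 9 = s.arr 9 := by rw [hs₁, Cmd.run_arr (by rfl)]; rfl
  have h2 := run_assemble (s := s₁) hN hφ h1.graph hv1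
  rw [ht] at h2
  set s₂ := (Code.assemble φT).run N s₁ with hs₂
  have h2' : ClusterInv N G μ p q s₂ := h1.run (by rfl) (by rfl)
  have hv2 : s₂.var 3 = v := by rw [hs₂, Cmd.run_var (by rfl), hv1]
  have h92 : s₂.arr 9 = s.arr 9 := by rw [hs₂, Cmd.run_arr (by rfl), h91]
  have h42 : s₂.arr 4 = tape N a := by rw [hs₂, Cmd.run_arr (by rfl), ht]
  have h3 := run_check hN hNn hμ h2' hv2
  rw [h2, h92] at h3
  set s₃ := (Code.check μT).run N s₂ with hs₃
  have hv3' : s₃.var 3 = v := by rw [hs₃, Cmd.run_var (by rfl), hv2]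
  have h43 : s₃.arr 4 = tape N a := by rw [hs₃, Cmd.run_arr (by rfl), h42]
  have h4 := run_fringe hN h3.1.graph hv3'
  rw [h43] at h4
  have h94 : (Code.fringe.run N s₃).arr 9 = s₃.arr 9 := Cmd.run_arr (by rfl)
  have h5 := run_check hN hNn hμ (h3.1.run (c := Code.fringe) (by rfl) (by rfl)) (v := v)
    (by rw [Cmd.run_var (by rfl), hv3'])
  rw [h4, h94] at h5
  refine ⟨h5.1, hv3, fun u hu => h5.2.1 u (h3.2.1 u hu), ?_⟩
  rintro (h | h)
  · exact h5.2.1 v (h3.2.2 h.1 h.2)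
  · exact h5.2.2 h.1 h.2

end Clusters

section FindClusters

variable {N n p q : ℕ} {G : SimpleGraph (Fin n)} {s : State} {μ : Finset (Fin n) → ℕ}
  {φ : Fin n → Finset (Fin n) → ℕ → Prop} {μT φT : Term}

theorem run_findCluster (hN : n ≤ N) (hNn : n * n ≤ N) (hμ : ExpressesBound N G μT μ)
    (hφ : Expresses N G φT φ) (hs : ClusterInv N G μ p q s) (i : ℕ) :
    ClusterInv N G μ p q ((Code.findCluster μT φT).run N (s.setVar 3 i)) ∧
      ∀ u : Fin n, s.arr 9 u ≠ 0 →
        ((Code.findCluster μT φT).run N (s.setVar 3 i)).arr 9 u ≠ 0 := by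
  rw [Code.findCluster, Cmd.run_ite]
  split_ifs with h
  · have hi : i < n := by simpa [hs.graph.var] using h
    have := Cmd.loop_invariant (N := N) (s := s.setVar 3 i) 4 (Code.tryAdvice μT φT)
      (fun s' => ClusterInv N G μ p q s' ∧ s'.var 3 = (⟨i, hi⟩ : Fin n) ∧
        ∀ u : Fin n, s.arr 9 u ≠ 0 → s'.arr 9 u ≠ 0) (fun s' a _ hs' => by
        have h := run_try hN hNn hμ hφ hs'.1 hs'.2.1 a
        exact ⟨h.1, h.2.1, fun u hu => h.2.2.1 u (hs'.2.2 u hu)⟩)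
      ⟨hs.setVar (by decide), by simp, fun u hu => hu⟩
    exact ⟨this.1, this.2.2⟩
  · exact ⟨hs.setVar (by decide), fun u hu => hu⟩

theorem run_findCluster_self (hN : n ≤ N) (hNn : n * n ≤ N)
    (hNp : 4 ^ (2 * n.size + 62 * p + 6) ≤ N) (hloc : IsLocal G μ φ) (hμ : ExpressesBound N G μT μ)
    (hφ : Expresses N G φT φ) (hs : ClusterInv N G μ p q s) {v : Fin n}
    (hv : ∃ C, v ∈ C ∧ IsCluster G μ p q C) :
    ((Code.findCluster μT φT).run N (s.setVar 3 v)).arr 9 v ≠ 0 := by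
  obtain ⟨a, ha, h⟩ := exists_advice hloc hN hNp hv
  have hv' : (Term.lt (.var 3) (.var 0)).Holds N (s.setVar 3 v) := by simp [hs.graph.var]
  rw [Code.findCluster, Cmd.run_ite, if_pos hv']
  refine Cmd.loop_establishes (N := N) 4 (Code.tryAdvice μT φT)
    (fun s' => ClusterInv N G μ p q s' ∧ s'.var 3 = v) (fun s' => s'.arr 9 v ≠ 0)
    (fun s' b _ hs' => ?_) (fun s' b _ hs' hu => ?_) ha (fun s' hs' => ?_)
    ⟨hs.setVar (by decide), by simp⟩
  · have h := run_try hN hNn hμ hφ hs'.1 hs'.2 b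
    exact ⟨h.1, h.2.1⟩
  · exact (run_try hN hNn hμ hφ hs'.1 hs'.2 b).2.2.1 v hu
  · exact (run_try hN hNn hμ hφ hs'.1 hs'.2 a).2.2.2 h

theorem run_findClusters (hN : n ≤ N) (hNn : n * n ≤ N)
    (hNp : 4 ^ (2 * n.size + 62 * p + 6) ≤ N) (hloc : IsLocal G μ φ) (hμ : ExpressesBound N G μT μ)
    (hφ : Expresses N G φT φ) (hs : s.HasGraph G) (hp : s.var 1 = p) (hq : s.var 2 = q)
    (ht : ∀ i ≥ N, s.arr 4 i = 0) :
    ClusterInv N G μ p q ((Code.findClusters μT φT).run N s) ∧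
      ∀ v : Fin n, (∃ C, v ∈ C ∧ IsCluster G μ p q C) →
        ((Code.findClusters μT φT).run N s).arr 9 v ≠ 0 := by
  rw [Code.findClusters, Cmd.run_seq]
  have h0 : ClusterInv N G μ p q ((Cmd.fill 9 20 (.const 0)).run N s) := by
    refine ⟨hs.congr rfl rfl, hp, hq, ht, fun v hv => absurd ?_ hv⟩
    rw [Cmd.run_fill_arr, if_pos (v.isLt.trans_le hN), Term.eval_const]
  exact ⟨Cmd.loop_invariant 3 _ _ (fun s' i _ hs' => (run_findCluster hN hNn hμ hφ hs' i).1) h0,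
    fun v hv => Cmd.loop_establishes 3 _ (ClusterInv N G μ p q) (fun s' => s'.arr 9 v ≠ 0)
      (fun s' i _ hs' => (run_findCluster hN hNn hμ hφ hs' i).1)
      (fun s' i _ hs' => (run_findCluster hN hNn hμ hφ hs' i).2 v) (v.isLt.trans_le hN)
      (fun s' hs' => run_findCluster_self hN hNn hNp hloc hμ hφ hs' hv) h0⟩

end FindClusters

/-! ### Correctness of the uncrossing -/

section Uncrossing

variable {N n p q : ℕ} {G : SimpleGraph (Fin n)} {s : State} {μ : Finset (Fin n) → ℕ}

/-- The memory while the rows of the array `10` are made disjoint: they are clusters that cover all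
vertices. -/
structure CoverInv (G : SimpleGraph (Fin n)) (μ : Finset (Fin n) → ℕ) (p q : ℕ) (s : State) :
    Prop where
  graph : s.HasGraph G
  var_q : s.var 2 = q
  cluster : ∀ i, IsCluster G μ p q (s.row n i)
  cover : ∀ u, ∃ i, u ∈ s.row n i

theorem CoverInv.setVar (h : CoverInv G μ p q s) {x k : ℕ} (hx : x ∉ [0, 2]) :
    CoverInv G μ p q (s.setVar x k) := by
  simp only [List.mem_cons, List.not_mem_nil, or_false, not_or, ← ne_eq] at hx
  exact ⟨h.graph.setVar hx.1.symm, by simp [hx.2.symm, h.var_q], h.cluster, h.cover⟩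

open Term in
/-- The rows only shrink, so that rows that have been made disjoint remain so. -/
theorem run_uncrossBody (hN : n ≤ N) (hNn : n * n ≤ N) (hμ : ∀ {X Y}, X ⊆ Y → μ X ≤ μ Y)
    (hs : CoverInv G μ p q s) :
    CoverInv G μ p q (Code.uncrossBody.run N s) ∧
      (∀ k, (Code.uncrossBody.run N s).row n k ⊆ s.row n k) ∧
      ∀ i j : Fin n, s.var 3 = i → s.var 4 = j → i < j →
        Disjoint ((Code.uncrossBody.run N s).row n i) ((Code.uncrossBody.run N s).row n j) := by
  rw [Code.uncrossBody, Cmd.run_ite]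
  split_ifs with h
  swap
  · refine ⟨hs, fun k => subset_rfl, fun i j hi hj hij => absurd ?_ h⟩
    simpa [hi, hj, hs.graph.var] using hij
  rw [holds_and, holds_lt, holds_lt, eval_var, eval_var, eval_var, hs.graph.var] at h
  obtain ⟨i, hi⟩ : ∃ i : Fin n, s.var 3 = i := ⟨⟨_, h.1.trans h.2⟩, rfl⟩
  obtain ⟨j, hj⟩ : ∃ j : Fin n, s.var 4 = j := ⟨⟨_, h.2⟩, rfl⟩
  have hij : i ≠ j := by
    rintro rfl
    omega
  have key : ∀ s' : State, s'.HasGraph G → s'.var 2 = q →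
      ((∀ k, s'.row n k = if k = i then s.row n i \ s.row n j else s.row n k) ∧
        cutSize G (s.row n i \ s.row n j) ≤ q ∨
      (∀ k, s'.row n k = if k = j then s.row n j \ s.row n i else s.row n k) ∧
        cutSize G (s.row n j \ s.row n i) ≤ q) →
      CoverInv G μ p q s' ∧ (∀ k, s'.row n k ⊆ s.row n k) ∧
        ∀ i j : Fin n, s.var 3 = i → s.var 4 = j → i < j →
          Disjoint (s'.row n i) (s'.row n j) := by
    intro s' hg hq hrow
    have h1 : ∀ k, s'.row n k ⊆ s.row n k := by
      intro k
      rcases hrow with hrow | hrow <;> rw [hrow.1] <;> split_ifs with hk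
      · rw [hk]; exact Finset.sdiff_subset
      · exact subset_rfl
      · rw [hk]; exact Finset.sdiff_subset
      · exact subset_rfl
    refine ⟨⟨hg, hq, fun k => ⟨(hμ (h1 k)).trans (hs.cluster k).1, ?_⟩, fun u => ?_⟩, h1, ?_⟩
    · rcases hrow with hrow | hrow <;> rw [hrow.1] <;> split_ifs with hk
      · exact hrow.2
      · exact (hs.cluster k).2
      · exact hrow.2
      · exact (hs.cluster k).2
    · obtain ⟨k, hk⟩ := hs.cover u
      rcases hrow with hrow | hrow
      · by_cases hu : u ∈ s.row n j
        · exact ⟨j, by rw [hrow.1, if_neg hij.symm]; exact hu⟩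
        · refine ⟨k, ?_⟩
          rw [hrow.1]
          split_ifs with hki
          · subst hki
            exact Finset.mem_sdiff.2 ⟨hk, hu⟩
          · exact hk
      · by_cases hu : u ∈ s.row n i
        · exact ⟨i, by rw [hrow.1, if_neg hij]; exact hu⟩
        · refine ⟨k, ?_⟩
          rw [hrow.1]
          split_ifs with hkj
          · subst hkj
            exact Finset.mem_sdiff.2 ⟨hk, hu⟩
          · exact hk
    · intro i' j' hi' hj' _
      obtain rfl : i' = i := Fin.ext (hi'.symm.trans hi)
      obtain rfl : j' = j := Fin.ext (hj'.symm.trans hj)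
      rcases hrow with hrow | hrow <;> rw [hrow.1, hrow.1]
      · rw [if_pos rfl, if_neg hij.symm]; exact Finset.sdiff_disjoint
      · rw [if_neg hij, if_pos rfl]; exact Finset.disjoint_sdiff
  have hfill : ∀ (x y : ℕ) (s' : State) (a b : Fin n), s'.HasGraph G → s'.arr 10 = s.arr 10 →
      x ∉ [20, 39] → y ∉ [20, 39] → s'.var x = a → s'.var y = b →
      ((Cmd.fill 2 20 (and (Code.inRow x 20) (not (Code.inRow y 20)))).run N s').set n 2 =
        s.row n a \ s.row n b := by
    intro x y s' a b hg h10 hx hy ha hb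
    simp only [List.mem_cons, List.not_mem_nil, or_false, not_or] at hx hy
    ext u
    have hg' := (hg.setVar (x := 20) (k := u) (by decide)).var
    rw [Cmd.mem_run_fill hN, holds_and, holds_not,
      holds_inRow hN hg' hx.2 (i := a) (u := u) (by simpa [hx.1] using ha) (by simp),
      holds_inRow hN hg' hy.2 (i := b) (u := u) (by simpa [hy.1] using hb) (by simp),
      State.row_congr (s' := s'.setVar 20 u) h10, State.row_congr (s' := s'.setVar 20 u) h10,
      Finset.mem_sdiff]
  rw [Cmd.run_seq]
  set s₁ := (Cmd.fill 2 20 (and (Code.inRow 3 20) (not (Code.inRow 4 20)))).run N s with hs₁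
  have hg₁ : s₁.HasGraph G := hs.graph.congr rfl rfl
  have h10 : s₁.arr 10 = s.arr 10 := by simp [hs₁]
  have h2 : s₁.set n 2 = s.row n i \ s.row n j :=
    hfill 3 4 s i j hs.graph rfl (by decide) (by decide) hi hj
  have hcut : (le (cut 2) (var 2)).Holds N s₁ ↔ cutSize G (s.row n i \ s.row n j) ≤ q := by
    rw [holds_le, eval_cut hN hg₁, h2, eval_var]
    exact iff_of_eq (congrArg _ hs.var_q)
  rw [Cmd.run_ite]
  split_ifs with hc <;> rw [hcut] at hc
  · refine key _ (Cmd.run_hasGraph (by rfl) (by rfl) hg₁)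
      ((Cmd.run_var (by rfl)).trans hs.var_q) (.inl ⟨fun k => ?_, hc⟩)
    rw [run_setRow hN hNn hg₁.var (by decide) (by decide) (i := i) hi, h2, State.row_congr h10]
  · rw [Cmd.run_seq]
    set s₂ := (Cmd.fill 2 20 (and (Code.inRow 4 20) (not (Code.inRow 3 20)))).run N s₁ with hs₂
    have hg₂ : s₂.HasGraph G := hg₁.congr rfl rfl
    have h2' : s₂.set n 2 = s.row n j \ s.row n i :=
      hfill 4 3 s₁ j i hg₁ h10 (by decide) (by decide) hj hi
    have h10' : s₂.arr 10 = s.arr 10 := by simp [hs₂, h10]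
    refine key _ (Cmd.run_hasGraph (by rfl) (by rfl) hg₂)
      ((Cmd.run_var (by rfl)).trans hs.var_q) (.inr ⟨fun k => ?_, ?_⟩)
    · rw [run_setRow hN hNn hg₂.var (by decide) (by decide) (i := j) hj, h2',
        State.row_congr h10']
    · have h3 := cutSize_sdiff_add_le (G := G) (s.row n i) (s.row n j)
      have h4 := (hs.cluster i).2
      have h5 := (hs.cluster j).2
      omega

theorem run_uncross (hN : n ≤ N) (hNn : n * n ≤ N) (hμ : ∀ {X Y}, X ⊆ Y → μ X ≤ μ Y)
    (hs : CoverInv G μ p q s) :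
    CoverInv G μ p q (Code.uncross.run N s) ∧ ∀ i j : Fin n, i < j →
      Disjoint ((Code.uncross.run N s).row n i) ((Code.uncross.run N s).row n j) := by
  have hinner : ∀ (s : State) (k : ℕ), CoverInv G μ p q s →
      CoverInv G μ p q ((Cmd.loop 4 Code.uncrossBody).run N (s.setVar 3 k)) := fun s k hs =>
    Cmd.loop_invariant 4 _ _ (fun s' l _ hs' =>
      (run_uncrossBody hN hNn hμ (hs'.setVar (x := 4) (k := l) (by decide))).1)
      (hs.setVar (by decide))
  refine ⟨Cmd.loop_invariant 3 _ _ (fun s k _ hs => hinner s k hs) hs, fun i j hij => ?_⟩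
  have hkeep : ∀ (s : State) (l : ℕ), CoverInv G μ p q s →
      Disjoint (s.row n i) (s.row n j) →
      Disjoint ((Code.uncrossBody.run N (s.setVar 4 l)).row n i)
        ((Code.uncrossBody.run N (s.setVar 4 l)).row n j) := fun s l hs hd => by
    have h := (run_uncrossBody hN hNn hμ (hs.setVar (x := 4) (k := l) (by decide))).2.1
    exact hd.mono (h i) (h j)
  refine Cmd.loop_establishes 3 (.loop 4 Code.uncrossBody) (CoverInv G μ p q)
    (fun s => Disjoint (s.row n i) (s.row n j)) (fun s k _ hs => hinner s k hs)
    (fun s k _ hs hd => ?_) (i.isLt.trans_le hN) (fun s hs => ?_) hs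
  · exact (Cmd.loop_invariant 4 _ (fun s => CoverInv G μ p q s ∧ Disjoint (s.row n i) (s.row n j))
      (fun s' l _ hs' => ⟨(run_uncrossBody hN hNn hμ (hs'.1.setVar (x := 4) (k := l)
        (by decide))).1, hkeep s' l hs'.1 hs'.2⟩) ⟨hs.setVar (by decide), hd⟩).2
  · refine Cmd.loop_establishes 4 Code.uncrossBody
      (fun s => CoverInv G μ p q s ∧ s.var 3 = i) (fun s => Disjoint (s.row n i) (s.row n j))
      (fun s l _ hs => ⟨(run_uncrossBody hN hNn hμ (hs.1.setVar (x := 4) (k := l)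
        (by decide))).1, ?_⟩) (fun s l _ hs => hkeep s l hs.1) (j.isLt.trans_le hN) (fun s hs => ?_)
      ⟨hs.setVar (by decide), by simp⟩
    · rw [Cmd.run_var (by rfl)]
      simpa using hs.2
    · exact (run_uncrossBody hN hNn hμ (hs.1.setVar (x := 4) (k := j) (by decide))).2.2 i j
        (by simpa using hs.2) (by simp) hij

end Uncrossing

/-! ### Correctness of the algorithm -/

section Solve

variable {N n p q : ℕ} {G : SimpleGraph (Fin n)} {s : State} {μ : Finset (Fin n) → ℕ}
  {φ : Fin n → Finset (Fin n) → ℕ → Prop} {μT φT : Term}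

/-- Disjoint clusters that cover the vertex set form a partition, which is represented by any
labelling that maps the vertices of each cluster to its number. -/
theorem exists_partition {R : Fin n → Finset (Fin n)} {f : Fin n → Fin n}
    (hR : ∀ i, IsCluster G μ p q (R i)) (hf : ∀ i u, u ∈ R i ↔ f u = i) :
    ∃ P : Finpartition (Finset.univ : Finset (Fin n)), IsClusterPartition G μ p q P ∧
      ∀ u v, P.part u = P.part v ↔ f u = f v := by
  have : DecidableRel (Setoid.ker f) := Classical.decRel _
  have hrel : ∀ u v, v ∈ (Finpartition.ofSetoid (Setoid.ker f)).part u ↔ f u = f v := fun u v =>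
    Finpartition.mem_part_ofSetoid_iff_rel
  refine ⟨Finpartition.ofSetoid (Setoid.ker f), fun C hC => ?_, fun u v => ?_⟩
  · obtain ⟨u, hu⟩ := Finpartition.nonempty_of_mem_parts _ hC
    have h : C = R (f u) := by
      rw [← Finpartition.part_eq_of_mem _ hC hu]
      ext w
      rw [hrel, hf, eq_comm]
    rw [h]
    exact hR _
  · rw [← hrel]
    constructor
    · intro h
      rw [h]
      exact Finpartition.mem_part _ (Finset.mem_univ v)
    · intro h
      exact (Finpartition.part_eq_of_mem _ ((Finpartition.part_mem _).2 (Finset.mem_univ u)) h).symm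

open Term in
theorem run_solve (hN : n ≤ N) (hNn : n * n ≤ N)
    (hNp : 4 ^ (2 * n.size + 62 * p + 6) ≤ N) (hloc : IsLocal G μ φ) (hμ : ExpressesBound N G μT μ)
    (hφ : Expresses N G φT φ) (hs : s.HasGraph G) (hp : s.var 1 = p) (hq : s.var 2 = q)
    (ht : ∀ i ≥ N, s.arr 4 i = 0) :
    IsCorrectAnswer G μ p q ((Code.solve μT φT).run N s) := by
  obtain ⟨h1, h2⟩ := run_findClusters hN hNn hNp hloc hμ hφ hs hp hq ht
  rw [Code.solve, Cmd.run_seq]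
  set s₁ := (Code.findClusters μT φT).run N s with hs₁
  have hall : (all 20 (mem 20 9)).Holds N s₁ ↔ ∀ u : Fin n, s₁.arr 9 u ≠ 0 := by
    rw [holds_all hN h1.graph.var (by decide)]
    simp
  rw [Cmd.run_ite]
  split_ifs with hc <;> rw [hall] at hc
  · left
    have hcov : CoverInv G μ p q s₁ := ⟨h1.graph, h1.var_q, fun i => (h1.row i (hc i)).2,
      fun u => ⟨u, (h1.row u (hc u)).1⟩⟩
    obtain ⟨h3, h4⟩ := run_uncross hN hNn hloc.mono hcov
    rw [Cmd.run_seq, Cmd.run_seq]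
    set s₂ := Code.uncross.run N s₁ with hs₂
    have huniq : ∀ u i j, u ∈ s₂.row n i → u ∈ s₂.row n j → i = j := by
      intro u i j hi hj
      rcases lt_trichotomy i j with h | h | h
      · exact absurd hj (Finset.disjoint_left.1 (h4 i j h) hi)
      · exact h
      · exact absurd hi (Finset.disjoint_left.1 (h4 j i h) hj)
    choose f hf using h3.cover
    obtain ⟨P, hP, hPf⟩ := exists_partition (f := f) h3.cluster fun i u =>
      ⟨fun h => huniq u _ _ (hf u) h, fun h => h ▸ hf u⟩
    refine ⟨by simp, P, hP, fun u v => ?_⟩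
    have hval : ∀ u : Fin n, ((Cmd.fill 1 20 (sumV 21 (.ite (Code.inRow 21 20) (var 21)
        (const 0)))).run N s₂).arr 1 u = f u := by
      intro u
      rw [Cmd.run_fill_arr, if_pos (u.isLt.trans_le hN),
        eval_sumV hN (h3.graph.setVar (by decide)).var (by decide)]
      rw [Finset.sum_eq_single_of_mem (f u) (Finset.mem_univ _)]
      · rw [eval_ite, if_pos]
        · simp
        · rw [holds_inRow hN (setVar_setVar_hasGraph h3.graph (by decide) (by decide)).var
            (by decide) (i := f u) (u := u) (by simp) (by simp)]
          exact hf u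
      · intro i _ hi
        rw [eval_ite, if_neg, eval_const]
        rw [holds_inRow hN (setVar_setVar_hasGraph h3.graph (by decide) (by decide)).var
            (by decide) (i := i) (u := u) (by simp) (by simp)]
        exact fun h => hi (huniq u _ _ h (hf u))
    rw [hPf, Cmd.run_assign, State.setVar_arr, hval, hval, Fin.ext_iff]
  · right
    refine ⟨by simp, fun ⟨P, hP⟩ => hc fun u => h2 u ⟨P.part u, ?_, ?_⟩⟩
    · exact P.mem_part (Finset.mem_univ u)
    · exact hP _ (P.part_mem.2 (Finset.mem_univ u))

end Solve

/-! ### The three measures in the programming language -/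

namespace Term

/-- The test that the vertices in the variables `x` and `y` are distinct and not adjacent. -/
def nonadj (x y : ℕ) : Term := and (not (eq (var x) (var y))) (not (adj x y))

/-- The number of vertices of the set in the array `a` that are distinct from and not adjacent to
the vertex in the variable `20`. -/
def numNonnbrs (a : ℕ) : Term := count 21 (and (mem 21 a) (nonadj 20 21))

/-- The number of pairs of distinct non-adjacent vertices in the set in the array `a`. -/
def numNonedges (a : ℕ) : Term :=
  sumV 20 (count 21 (and (mem 20 a) (and (mem 21 a) (nonadj 20 21))))

end Term

section Measures

variable {N n : ℕ} {G : SimpleGraph (Fin n)} {s : State}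

theorem Term.holds_nonadj (hN : n ≤ N) (hs : s.HasGraph G) {x y : ℕ} (hx : x ≠ 39) {u w : Fin n}
    (hu : s.var x = u) (hw : s.var y = w) :
    (nonadj x y).Holds N s ↔ u ≠ w ∧ ¬G.Adj u w := by
  rw [nonadj, holds_and, holds_not, holds_not, holds_adj hN hs hx hu hw, holds_eq, eval_var,
    eval_var, hu, hw, ne_eq, Fin.ext_iff]

theorem Term.eval_numNonnbrs (hN : n ≤ N) (hs : s.HasGraph G) (a : ℕ) {u : Fin n}
    (hu : s.var 20 = u) : (numNonnbrs a).eval N s = nonnbrs G (s.set n a) u := by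
  rw [numNonnbrs, eval_count hN hs.var (by decide)]
  refine Finset.sum_congr rfl fun w _ => congrArg ind (propext ?_)
  rw [holds_and, holds_nonadj hN (hs.setVar (by decide)) (by decide) (u := u) (w := w)
    (by simp [hu]) (by simp)]
  simp

theorem Term.eval_numNonedges (hN : n ≤ N) (hs : s.HasGraph G) (a : ℕ) :
    (numNonedges a).eval N s = nonedges G (s.set n a) (s.set n a) := by
  rw [numNonedges, eval_sumV hN hs.var (by decide)]
  refine Finset.sum_congr rfl fun u _ => ?_
  rw [eval_count hN (hs.setVar (by decide)).var (by decide)]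
  refine Finset.sum_congr rfl fun w _ => congrArg ind (propext ?_)
  rw [holds_and, holds_and, holds_nonadj hN (setVar_setVar_hasGraph hs (by decide) (by decide))
    (by decide) (u := u) (w := w) (by simp) (by simp)]
  simp

open Term

theorem expressesBound_size (hN : n ≤ N) :
    ExpressesBound N G (le (count 20 (mem 20 6)) (var 1)) (size G) := fun s hs => by
  rw [holds_le, eval_count_mem hN hs.var (by decide), eval_var, size]

theorem expresses_true : Expresses N G (const 1) fun _ _ _ => True := fun s v _ _ => by simp

theorem expressesBound_nonedge (hN : n ≤ N) :
    ExpressesBound N G (le (numNonedges 6) (add (var 1) (var 1))) (nonedge G) := fun s hs => by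
  rw [holds_le, eval_numNonedges hN hs, ← two_mul_nonedge, eval_add, eval_var]
  omega

theorem expresses_nonedges (hN : n ≤ N) : Expresses N G (le (numNonedges 2) (var 14))
    fun _ K t => nonedges G K K ≤ t := fun s v hs _ => by
  rw [holds_le, eval_numNonedges hN hs, eval_var]

theorem expressesBound_nondeg (hN : n ≤ N) : ExpressesBound N G
    (all 20 (imp (mem 20 6) (le (numNonnbrs 6) (var 1)))) (nondeg G) := fun s hs => by
  rw [holds_all hN hs.var (by decide), nondeg_le_iff]
  refine forall_congr' fun u => ?_
  rw [holds_imp, holds_le, eval_numNonnbrs hN (hs.setVar (by decide)) 6 (u := u) (by simp)]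
  simp

theorem expresses_nonnbrs (hN : n ≤ N) : Expresses N G
    (all 20 (imp (mem 20 2) (le (add (numNonnbrs 2) (bool (not (adj 20 3)))) (var 14))))
    fun v K t => ∀ u ∈ K, nonnbrs G K u + ind (¬G.Adj u v) ≤ t := fun s v hs hv => by
  rw [holds_all hN hs.var (by decide)]
  refine forall_congr' fun u => ?_
  have hg := hs.setVar (x := 20) (k := u) (by decide)
  rw [holds_imp, holds_le, eval_add, eval_numNonnbrs hN hg 2 (u := u) (by simp), eval_bool, holds_not,
    holds_adj hN hg (by decide) (u := u) (w := v) (by simp) (by simp [hv])]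
  simp

end Measures

/-! ### The running time -/

/-- The `k`-fold repetition of a command. -/
def Cmd.repeated (c : Cmd) : ℕ → Cmd
  | 0 => .skip
  | k + 1 => .seq c (c.repeated k)

theorem Cmd.run_repeated {N k : ℕ} {c : Cmd} {s : State} :
    (c.repeated k).run N s = (c.run N)^[k] s := by
  induction k generalizing s with
  | zero => rfl
  | succ k ih => rw [repeated, run_seq, ih, Function.iterate_succ_apply]

namespace Code

open Term

/-- The computation of `(n + 1) ^ 4 * 2 ^ (124 * p) * 65536` in variable `5`, by doublings and by
adding `n` copies of a number to it. All loops need only range over the numbers below `n + p`. -/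
def bound : Cmd :=
  .seq (.assign 5 (const 65536)) (.seq
    (.loop 19 (.ite (lt (var 19) (var 1)) (.repeated (.assign 5 (add (var 5) (var 5))) 124) .skip))
    (.repeated (.assign 5 (add (var 5) (sumV 20 (var 5)))) 4))

end Code

section Bound

variable {N n p : ℕ} {s : State}

theorem iterate_mul_var {x : ℕ} {f : State → State} {k : ℕ} (P : State → Prop)
    (hf : ∀ s, P s → P (f s) ∧ (f s).var x = k * s.var x) (m : ℕ) (s : State) (hs : P s) :
    P (f^[m] s) ∧ (f^[m] s).var x = k ^ m * s.var x := by
  induction m generalizing s with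
  | zero => simp [hs]
  | succ m ih =>
    obtain ⟨h1, h2⟩ := hf s hs
    obtain ⟨h3, h4⟩ := ih _ h1
    rw [Function.iterate_succ_apply]
    exact ⟨h3, by rw [h4, h2]; ring⟩

theorem foldl_mul_of_lt (k y : ℕ) : ∀ N, p ≤ N →
    (List.range N).foldl (fun y i => if i < p then k * y else y) y = k ^ p * y := by
  have h : ∀ N, (List.range N).foldl (fun y i => if i < p then k * y else y) y =
      k ^ min N p * y := by
    intro N
    induction N with
    | zero => simp
    | succ N ih =>
      rw [List.range_succ, List.foldl_append, ih]
      simp only [List.foldl_cons, List.foldl_nil]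
      split_ifs with h
      · rw [min_eq_left h.le, min_eq_left (Nat.succ_le_of_lt h), Nat.pow_succ]
        ring
      · rw [min_eq_right (by omega), min_eq_right (by omega)]
  intro N hN
  rw [h, min_eq_right hN]

open Term in
theorem run_bound (hn : n ≤ N) (hp : p ≤ N) (hsn : s.var 0 = n) (hsp : s.var 1 = p) :
    (Code.bound.run N s).var 5 = (n + 1) ^ 4 * ((2 ^ 124) ^ p * 65536) := by
  have hdouble : ∀ s : State, ((Cmd.repeated (.assign 5 (add (var 5) (var 5))) 124).run N s).var 5 =
      2 ^ 124 * s.var 5 := fun s => by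
    rw [Cmd.run_repeated]
    exact (iterate_mul_var (fun _ => True) (fun s _ => ⟨trivial, by simp [two_mul]⟩) 124 s trivial).2
  have hloop := Cmd.loop_simulation (N := N) (s := s.setVar 5 65536) 19
    (.ite (lt (var 19) (var 1)) (.repeated (.assign 5 (add (var 5) (var 5))) 124) .skip)
    (fun s => s.var 5) (fun y i => if i < p then 2 ^ 124 * y else y)
    (fun s => s.var 0 = n ∧ s.var 1 = p) (fun s i _ hs => by
      refine ⟨⟨?_, ?_⟩, ?_⟩
      · rw [Cmd.run_var (by rfl)]; simpa using hs.1
      · rw [Cmd.run_var (by rfl)]; simpa using hs.2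
      · rw [Cmd.run_ite]
        have : (lt (var 19) (var 1)).Holds N (s.setVar 19 i) ↔ i < p := by simp [hs.2]
        simp only [this]
        split_ifs
        · rw [hdouble]; simp
        · simp) (by simp [hsn, hsp])
  rw [Code.bound, Cmd.run_seq, Cmd.run_seq, Cmd.run_repeated, Cmd.run_assign, eval_const]
  refine (iterate_mul_var (k := n + 1) (fun s => s.var 0 = n) (fun s hs => ⟨by simp [hs], ?_⟩) 4 _
    hloop.1.1).2.trans ?_
  · rw [Cmd.run_assign, State.setVar_var, if_pos rfl, eval_add, eval_sumV hn hs (by decide)]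
    simp [Nat.add_mul, Nat.add_comm]
  · rw [hloop.2, foldl_mul_of_lt _ _ _ hp]
    simp

theorem pow_size_le (n : ℕ) : 2 ^ n.size ≤ 2 * (n + 1) := by
  rcases h : n.size with _ | k
  · rw [pow_zero]
    omega
  · have := Nat.lt_size.1 (h.symm.subst (motive := (k < ·)) k.lt_succ_self)
    rw [pow_succ]
    omega

/-- The number computed by `Code.bound` is large enough for the search. -/
theorem four_pow_le (n p : ℕ) :
    4 ^ (2 * n.size + 62 * p + 6) ≤ (n + 1) ^ 4 * ((2 ^ 124) ^ p * 65536) := by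
  have h : (2 ^ n.size) ^ 4 ≤ (2 * (n + 1)) ^ 4 := Nat.pow_le_pow_left (pow_size_le n) 4
  calc 4 ^ (2 * n.size + 62 * p + 6) = (2 ^ n.size) ^ 4 * ((2 ^ 124) ^ p * 4096) := by
        rw [show (4 : ℕ) = 2 ^ 2 by norm_num, ← pow_mul, ← pow_mul, ← pow_mul,
          show 4096 = 2 ^ 12 by norm_num, ← pow_add, ← pow_add]
        congr 1
        ring
    _ ≤ (2 * (n + 1)) ^ 4 * ((2 ^ 124) ^ p * 4096) := Nat.mul_le_mul_right _ h
    _ = _ := by ring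

/-- A polynomial in `N`, for the value of `N` computed by `Code.bound`, is `2 ^ O(p) * n ^ O(1)`. -/
theorem mul_pow_le {n p N : ℕ} (hN : 1 ≤ N) (k : ℕ) {c : ℕ}
    (hNp : N ≤ (n + 1) ^ 4 * ((2 ^ 124) ^ p * 65536))
    (hc : c = (6 + k) * (2 ^ 17) ^ k + 124 * k) :
    (6 + k) * (N + 1) ^ k ≤ c * 2 ^ (c * p) * (n + 1) ^ c := by
  have h1 : (N + 1) ^ k ≤ ((n + 1) ^ 4 * ((2 ^ 124) ^ p * 2 ^ 17)) ^ k :=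
    Nat.pow_le_pow_left (by linarith) k
  have h2 : 124 * k ≤ c := by omega
  calc (6 + k) * (N + 1) ^ k ≤ (6 + k) * ((n + 1) ^ 4 * ((2 ^ 124) ^ p * 2 ^ 17)) ^ k :=
        Nat.mul_le_mul_left _ h1
    _ = (6 + k) * (2 ^ 17) ^ k * 2 ^ (124 * k * p) * (n + 1) ^ (4 * k) := by
        rw [mul_pow, mul_pow, ← pow_mul, ← pow_mul 2 124 p, ← pow_mul 2 (124 * p) k,
          mul_right_comm 124 p k]
        ring
    _ ≤ c * 2 ^ (c * p) * (n + 1) ^ c := by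
        refine Nat.mul_le_mul (Nat.mul_le_mul (by omega) ?_) ?_
        · exact Nat.pow_le_pow_right two_pos (Nat.mul_le_mul_right p h2)
        · exact Nat.pow_le_pow_right n.succ_pos (by omega)

end Bound

theorem inputState_hasGraph {n : ℕ} (G : SimpleGraph (Fin n)) (p q : ℕ) :
    (inputState G p q).HasGraph G := by
  classical
  refine ⟨by simp [inputState], fun u w => ?_⟩
  simp only [inputState]
  rw [ne_eq, ite_eq_right_iff, Classical.not_imp]
  refine ⟨?_, fun h => ⟨⟨trivial, u, w, h, rfl⟩, one_ne_zero⟩⟩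
  rintro ⟨⟨-, u', w', h, he⟩, -⟩
  have hw := u.pos
  have h1 : (u : ℕ) = u' := by
    have := congrArg (· / n) he
    simpa [Nat.add_div_of_dvd_right, Nat.mul_div_cancel _ hw, Nat.div_eq_of_lt] using this
  obtain rfl : u = u' := Fin.ext h1
  obtain rfl : w = w' := Fin.ext (by omega)
  exact h

theorem IsCorrectAnswer.of_agree {n : ℕ} {G : SimpleGraph (Fin n)} {μ : Finset (Fin n) → ℕ}
    {p q : ℕ} {s s' : State} (h : Agree s s') (hs : IsCorrectAnswer G μ p q s') :
    IsCorrectAnswer G μ p q s := by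
  simpa only [IsCorrectAnswer, HoldsPartition, h.var 0 (by decide), h.arr 1 (by decide)] using hs

theorem Agree.setVar_scratch {s s' : State} (h : Agree s s') (k : ℕ) :
    Agree (s.setVar scratch k) s' :=
  ⟨fun x hx => by simp [hx.ne, h.var x hx], h.arr⟩

/-- The program that solves the partition problem for the measure expressed by `μT`: it first runs
`Code.bound` with the loop bound `n + p`, and then the algorithm with the loop bound found by it. -/
def solver (μT φT : Term) : Program :=
  .seq (.assign scratch (.add (.var 0) (.var 1))) (.seq (Code.bound.compile 41)
    (.seq (.assign scratch (.var 5)) ((Code.solve μT φT).compile 41)))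

/-- Every measure that is local and, together with its local condition, expressible in the
programming language gives rise to a partition problem that can be solved in time
`2 ^ O(p) * n ^ O(1)`. -/
theorem exists_partitionSolvableInTime {μ : ∀ n : ℕ, SimpleGraph (Fin n) → Finset (Fin n) → ℕ}
    {φ : ∀ n : ℕ, SimpleGraph (Fin n) → Fin n → Finset (Fin n) → ℕ → Prop} {μT φT : Term}
    (hwf : (Code.solve μT φT).WF = true) (hloc : ∀ n G, IsLocal G (μ n G) (φ n G))
    (hμ : ∀ (N n : ℕ) G, n ≤ N → ExpressesBound N G μT (μ n G))
    (hφ : ∀ (N n : ℕ) G, n ≤ N → Expresses N G φT (φ n G)) :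
    ∃ c : ℕ, PartitionSolvableInTime μ fun n p => c * 2 ^ (c * p) * (n + 1) ^ c := by
  obtain ⟨k₁, hk₁⟩ := Cmd.polyBounded_cost Code.bound
  obtain ⟨k₂, hk₂⟩ := Cmd.polyBounded_cost (Code.solve μT φT)
  refine ⟨(6 + (k₁ + k₂)) * (2 ^ 17) ^ (k₁ + k₂) + 124 * (k₁ + k₂), solver μT φT,
    fun n G p q => ?_⟩
  set N := (n + 1) ^ 4 * ((2 ^ 124) ^ p * 65536) with hNdef
  have h1 : 1 ≤ (2 ^ 124) ^ p * 65536 := Nat.mul_pos (by positivity) (by norm_num)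
  have hNn' : (n + 1) * (n + 1) ≤ N := by
    refine le_trans ?_ (Nat.le_mul_of_pos_right _ h1)
    rw [← pow_two]
    exact Nat.pow_le_pow_right (by omega) (by norm_num)
  have hN : n ≤ N := by nlinarith
  have hNn : n * n ≤ N := by nlinarith
  have hpp : p + 1 ≤ (2 ^ 124) ^ p := Nat.lt_pow_self (by norm_num)
  have hNp : n + p + 1 ≤ N := by
    have h2 : (n + 1) * (p + 1) ≤ N := by
      refine Nat.mul_le_mul ?_ (hpp.trans (Nat.le_mul_of_pos_right _ (by norm_num)))
      exact Nat.le_self_pow (by norm_num) _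
    nlinarith
  -- the first phase runs all loops up to `n + p`, the second one up to `N`
  obtain ⟨s₁, t₁, hrun₁, ht₁, ha₁, -⟩ := Cmd.runs_compile (n + p) Code.bound (by rfl) 41
    ((inputState G p q).setVar scratch (n + p)) (inputState G p q) (by decide)
    (Agree.setVar_scratch ⟨fun _ _ => rfl, fun _ _ => rfl⟩ _) (by simp)
  have hv : s₁.var 5 = N := by
    rw [ha₁.var 5 (by decide), run_bound (n := n) (p := p) (by omega) (by omega)
      (by simp [inputState]) (by simp [inputState])]
  obtain ⟨s₂, t₂, hrun₂, ht₂, ha₂, -⟩ := Cmd.runs_compile N (Code.solve μT φT) hwf 41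
    (s₁.setVar scratch N) _ (by decide) (ha₁.setVar_scratch N) (by simp)
  have hv' : (Expr.var 5).eval s₁ = N := hv
  refine ⟨s₂, _, .seq (.assign _ _ _) (.seq (s' := s₁) (t := t₁) ?_ (.seq (.assign _ _ _)
    (t' := t₂) (hv'.symm ▸ hrun₂))), ?_, .of_agree ha₂ ?_⟩
  · simpa [Expr.eval, inputState] using hrun₁
  · simp only [Expr.cost]
    refine le_trans ?_ (mul_pow_le (N := N) (by omega) (k₁ + k₂) hNdef.le rfl)
    have h3 : (n + p + 1) ^ k₁ ≤ (N + 1) ^ (k₁ + k₂) :=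
      (Nat.pow_le_pow_left (by omega) k₁).trans (Nat.pow_le_pow_right (by omega) (by omega))
    have h4 : (N + 1) ^ k₂ ≤ (N + 1) ^ (k₁ + k₂) := Nat.pow_le_pow_right (by omega) (by omega)
    have h5 := (ht₁.trans (hk₁ _)).trans (Nat.mul_le_mul_left k₁ h3)
    have h6 := (ht₂.trans (hk₂ _)).trans (Nat.mul_le_mul_left k₂ h4)
    have h7 : 1 ≤ (N + 1) ^ (k₁ + k₂) := Nat.pos_of_ne_zero (by positivity)
    generalize (N + 1) ^ (k₁ + k₂) = M at h5 h6 h7 ⊢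
    nlinarith
  · refine run_solve hN hNn (four_pow_le n p) (hloc n G) (hμ N n G hN) (hφ N n G hN)
      (Cmd.run_hasGraph (by rfl) (by rfl) (inputState_hasGraph G p q)) ?_ ?_ fun i _ => ?_
    · rw [Cmd.run_var (by rfl)]; simp [inputState]
    · rw [Cmd.run_var (by rfl)]; simp [inputState]
    · rw [Cmd.run_arr (by rfl)]; simp [inputState]

theorem exists_partitionSolvableInTime_size :
    ∃ c : ℕ, PartitionSolvableInTime (fun _ G => size G)
      fun n p => c * 2 ^ (c * p) * (n + 1) ^ c :=
  exists_partitionSolvableInTime (by rfl) (fun _ _ => isLocal_size)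
    (fun _ _ _ hN => expressesBound_size hN) fun _ _ _ _ => expresses_true

theorem exists_partitionSolvableInTime_nonedge :
    ∃ c : ℕ, PartitionSolvableInTime (fun _ G => nonedge G)
      fun n p => c * 2 ^ (c * p) * (n + 1) ^ c :=
  exists_partitionSolvableInTime (by rfl) (fun _ _ => isLocal_nonedge)
    (fun _ _ _ hN => expressesBound_nonedge hN) fun _ _ _ hN => expresses_nonedges hN

theorem exists_partitionSolvableInTime_nondeg :
    ∃ c : ℕ, PartitionSolvableInTime (fun _ G => nondeg G)
      fun n p => c * 2 ^ (c * p) * (n + 1) ^ c :=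
  exists_partitionSolvableInTime (by rfl) (fun _ _ => isLocal_nondeg)
    (fun _ _ _ hN => expressesBound_nondeg hN) fun _ _ _ hN => expresses_nonnbrs hN

end GraphClustering

/-- The three partition problems can be solved in time `2 ^ O(p) * n ^ O(1)`, where `p` and `q` are
part of the input. -/
theorem mainTheorem4 :
    (∃ c : ℕ, GraphClustering.PartitionSolvableInTime (fun _ G => GraphClustering.size G)
      fun n p => c * 2 ^ (c * p) * (n + 1) ^ c) ∧
    (∃ c : ℕ, GraphClustering.PartitionSolvableInTime (fun _ G => GraphClustering.nonedge G)
      fun n p => c * 2 ^ (c * p) * (n + 1) ^ c) ∧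
    (∃ c : ℕ, GraphClustering.PartitionSolvableInTime (fun _ G => GraphClustering.nondeg G)
      fun n p => c * 2 ^ (c * p) * (n + 1) ^ c) :=
  ⟨GraphClustering.exists_partitionSolvableInTime_size,
    GraphClustering.exists_partitionSolvableInTime_nonedge,
    GraphClustering.exists_partitionSolvableInTime_nondeg⟩
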